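/- **Setting.** Let $\omega\subset\mathbb R^2$ be open (for instance a domain) and let $\mathcal T_h$ be a triangulation of $\omega$: a finite conforming set of nondegenerate closed triangles (two triangles meet in the convex hull of their common vertices) with $\bigcup_{T\in\mathcal T_h}T=\overline\omega$ and $\operatorname{int}T\subset\omega$ for all $T$. Let $h_T$ be the diameter of $T$, and $\mathcal N_h$, $\mathcal E_h$ the sets of vertices and edges of elements. Call $\mathcal T_h$ *$\kappa$-regular* if every $T\in\mathcal T_h$ contains a closed disc of some radius $\rho>0$ with $h_T\le\kappa\rho$. Gradients of piecewise polynomial functions are taken elementwise, $P_k(T)$ is the set of polynomials of degree at most $k$ on $T$, and $L^2$ norms of vector, matrix and tensor fields use the Euclidean (Frobenius) norm. With $x_T=\frac13\sum_{z\in\mathcal N_h\cap T}z$ let $$P_3^{\rm red}(T)=\Bigl\{p\in P_3(T): p(x_T)=\tfrac16\sum_{z\in\mathcal N_h\cap T}\bigl(2p(z)-\nabla p(z)\cdot(z-x_T)\bigr)\Bigr\},$$ $$\mathcal S^{\rm dkt}(\mathcal T_h)=\{w_h\in C(\overline\omega): w_h|_T\in P_3^{\rm red}(T)\ \forall\, T\in\mathcal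 T_h,\ \nabla w_h\text{ continuous at every }z\in\mathcal N_h\},$$ $$\mathcal S^2(\mathcal T_h)=\{\theta_h\in C(\overline\omega):\theta_h|_T\in P_2(T)\ \forall\, T\in\mathcal T_h\}.$$ For $w_h\in\mathcal S^{\rm dkt}(\mathcal T_h)$, the discrete gradient $\nabla_hw_h$ is the function $\theta_h\in\mathcal S^2(\mathcal T_h)^2$ with $$\theta_h(z)=\nabla w_h(z),\qquad \theta_h(z_E)\cdot t_E=\nabla w_h(z_E)\cdot t_E,\qquad \theta_h(z_E)\cdot n_E=\tfrac12\bigl[\nabla w_h(z_E^1)+\nabla w_h(z_E^2)\bigr]\cdot n_E$$ for all $z\in\mathcal N_h$ and all $E\in\mathcal E_h$ with endpoints $z_E^1,z_E^2$, midpoint $z_E$, unit tangent $t_E$ and unit normal $n_E$. For $w\in H^3(\omega)$ with a representative in $C^1(\overline\omega)$, put $\nabla_hw=\nabla_h\mathcal I_h^{\rm dkt}w$, where $\mathcal I_h^{\rm dkt}w\in\mathcal S^{\rm dkt}(\mathcal T_h)$ has the same values and gradients as that representative at all $z\in\mathcal N_h$. **Proposition (properties of the discrete gradient operator).** For every $\kappa$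 there are constants $c_1,c_2,c_3,c_4>0$, depending only on $\kappa$, such that for every open set $\omega\subset\mathbb R^2$ and every $\kappa$-regular triangulation $\mathcal T_h$ of $\omega$ the following holds. (0) $\nabla_hw_h$ exists and is unique on $\overline\omega$ for every $w_h\in\mathcal S^{\rm dkt}(\mathcal T_h)$. If $\omega$ has a Lipschitz boundary, then also $\nabla_hw$ exists and is unique on $\overline\omega$ for every $w\in H^3(\omega)$. (i) For all $w_h\in\mathcal S^{\rm dkt}(\mathcal T_h)$: $$c_1^{-1}\|\nabla w_h\|_{L^2(\omega)}\le\|\nabla_hw_h\|_{L^2(\omega)}\le c_1\|\nabla w_h\|_{L^2(\omega)}.$$ (ii) For all $w_h\in\mathcal S^{\rm dkt}(\mathcal T_h)$ and $T\in\mathcal T_h$: $$c_2^{-1}\|D^2w_h\|_{L^2(T)}\le\|\nabla\nabla_hw_h\|_{L^2(T)}\le c_2\|D^2w_h\|_{L^2(T)}.$$ (iii) For all $w\in H^3(\omega)$ for which $\nabla_hw$ is defined (all $w\in H^3(\omega)$ if the boundary of $\omega$ is Lipschitz) and all $T\in\mathcal T_h$: $$\|\nabla w-\nabla_hw\|_{L^2(T)}+h_T\|D^2w-\nabla\nabla_hw\|_{L^2(T)}\le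 c_3h_T^2\|D^3w\|_{L^2(T)}.$$ (iv) For all $w_h\in\mathcal S^{\rm dkt}(\mathcal T_h)$ and $T\in\mathcal T_h$: $$\|\nabla_hw_h-\nabla w_h\|_{L^2(T)}\le c_4h_T\|\nabla\nabla_hw_h\|_{L^2(T)}.$$ -/

import Mathlib

open MeasureTheory Geometry

noncomputable section

/-- The Euclidean plane. -/
abbrev Plane : Type := EuclideanSpace ℝ (Fin 2)

/-! ### Triangulations -/

/-- The closed triangle with vertex set `T`. -/
def tri (T : Finset Plane) : Set Plane := convexHull ℝ (T : Set Plane)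

/-- The triangles (as vertex sets) of a simplicial complex in the plane. -/
def triangles (K : SimplicialComplex ℝ Plane) : Set (Finset Plane) :=
  {T | T ∈ K.faces ∧ T.card = 3}

/-- `K` is a conforming triangulation of the open set `ω`: a finite simplicial complex all of whose
faces are faces of triangles, which fills `closure ω`, the open triangles being parts of `ω`. -/
structure IsTriangulation (ω : Set Plane) (K : SimplicialComplex ℝ Plane) : Prop where
  finite : K.faces.Finite
  pure : ∀ s ∈ K.faces, ∃ T ∈ triangles K, s ⊆ T
  space_eq : K.space = closure ω
  interior_subset : ∀ T ∈ triangles K, interior (tri T) ⊆ ω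

/-- The diameter `h_T` of a triangle. -/
def diamT (T : Finset Plane) : ℝ := Metric.diam (tri T)

/-- Shape regularity: the quotient of the diameter and the inradius of every triangle
is at most `κ`. -/
def IsShapeRegular (κ : ℝ) (K : SimplicialComplex ℝ Plane) : Prop :=
  ∀ T ∈ triangles K, ∃ (x : Plane) (ρ : ℝ), 0 < ρ ∧ Metric.closedBall x ρ ⊆ tri T ∧
    diamT T ≤ κ * ρ

/-- Near each of its boundary points, `ω` is, in suitable Cartesian coordinates, the strict
subgraph of a Lipschitz continuous function. -/
def HasLipschitzBoundary (ω : Set Plane) : Prop :=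
  ∀ x ∈ frontier ω, ∃ (Φ : Plane ≃ₗᵢ[ℝ] Plane) (γ : ℝ → ℝ) (L : NNReal) (U : Set Plane),
    LipschitzWith L γ ∧ U ∈ nhds x ∧ ∀ y ∈ U, (y ∈ ω ↔ Φ y 1 < γ (Φ y 0))

/-! ### Finite element spaces -/

/-- `f` coincides on `S` with a polynomial of total degree at most `k`. -/
def IsPolyOn (k : ℕ) (S : Set Plane) (f : Plane → ℝ) : Prop :=
  ∃ p : MvPolynomial (Fin 2) ℝ, p.totalDegree ≤ k ∧
    ∀ x ∈ S, f x = MvPolynomial.eval (fun i => x i) p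

/-- The gradient of the restriction `w|_T`, at any point of the closed triangle `T`. -/
def gradT (w : Plane → ℝ) (T : Finset Plane) (x : Plane) : Plane := gradientWithin w (tri T) x

/-- The centre of gravity of a triangle. -/
def center (T : Finset Plane) : Plane := (1 / 3 : ℝ) • ∑ z ∈ T, z

/-- `w|_T` belongs to the reduced cubic space `P₃^red(T)`. -/
def IsReducedCubicOn (T : Finset Plane) (w : Plane → ℝ) : Prop :=
  IsPolyOn 3 (tri T) w ∧
    w (center T) = (1 / 6) * ∑ z ∈ T, (2 * w z - inner ℝ (gradT w T z) (z - center T))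

/-- `w` belongs to the space `S^dkt` of discrete Kirchhoff triangle functions; only the values of
`w` on `closure ω` matter. -/
structure IsDKT (ω : Set Plane) (K : SimplicialComplex ℝ Plane) (w : Plane → ℝ) : Prop where
  continuousOn : ContinuousOn w (closure ω)
  reducedCubic : ∀ T ∈ triangles K, IsReducedCubicOn T w
  grad_continuous : ∀ T ∈ triangles K, ∀ T' ∈ triangles K, ∀ z ∈ T, z ∈ T' →
    gradT w T z = gradT w T' z

/-- `θ` belongs to `(S²)²`: continuous on `closure ω`, with components quadratic on triangles. -/
structure IsS2Vector (ω : Set Plane) (K : SimplicialComplex ℝ Plane) (θ : Plane → Plane) :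
    Prop where
  continuousOn : ContinuousOn θ (closure ω)
  quadratic : ∀ T ∈ triangles K, ∀ i : Fin 2, IsPolyOn 2 (tri T) (fun x => θ x i)

/-- `θ = ∇_h w` for a function `w` of the space `S^dkt`. The edges are the segments `[a, b]`
between distinct vertices of a triangle. -/
structure IsDiscreteGradient (ω : Set Plane) (K : SimplicialComplex ℝ Plane)
    (w : Plane → ℝ) (θ : Plane → Plane) : Prop where
  mem : IsS2Vector ω K θ
  vertex : ∀ T ∈ triangles K, ∀ z ∈ T, θ z = gradT w T z
  tangential : ∀ T ∈ triangles K, ∀ a ∈ T, ∀ b ∈ T, a ≠ b →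
    inner ℝ (θ (midpoint ℝ a b)) (‖b - a‖⁻¹ • (b - a)) =
      inner ℝ (gradT w T (midpoint ℝ a b)) (‖b - a‖⁻¹ • (b - a))
  normal : ∀ T ∈ triangles K, ∀ a ∈ T, ∀ b ∈ T, a ≠ b →
    ∀ n : Plane, ‖n‖ = 1 → inner ℝ n (b - a) = 0 →
      inner ℝ (θ (midpoint ℝ a b)) n = (1 / 2) * inner ℝ (gradT w T a + gradT w T b) n

/-! ### The Sobolev space `H³` and the extension of the discrete gradient -/

/-- `g` is the weak derivative of `f` in `ω` in the `i`-th coordinate direction. -/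
def HasWeakPartial (ω : Set Plane) (i : Fin 2) (f g : Plane → ℝ) : Prop :=
  ∀ φ : Plane → ℝ, ContDiff ℝ (⊤ : ℕ∞) φ → HasCompactSupport φ → tsupport φ ⊆ ω →
    ∫ x in ω, f x * fderiv ℝ φ x (EuclideanSpace.single i 1) = - ∫ x in ω, g x * φ x

/-- `w ∈ H³(ω)`, with weak derivatives `G = (∂ᵢ w)`, `H = (∂ⱼ ∂ᵢ w)`, `D = (∂ₖ ∂ⱼ ∂ᵢ w)`. -/
structure IsSobolevH3 (ω : Set Plane) (w : Plane → ℝ) (G : Fin 2 → Plane → ℝ)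
    (H : Fin 2 → Fin 2 → Plane → ℝ) (D : Fin 2 → Fin 2 → Fin 2 → Plane → ℝ) : Prop where
  memLp_zero : MemLp w 2 (volume.restrict ω)
  memLp_one : ∀ i, MemLp (G i) 2 (volume.restrict ω)
  memLp_two : ∀ i j, MemLp (H i j) 2 (volume.restrict ω)
  memLp_three : ∀ i j k, MemLp (D i j k) 2 (volume.restrict ω)
  weak_one : ∀ i, HasWeakPartial ω i w (G i)
  weak_two : ∀ i j, HasWeakPartial ω j (G i) (H i j)
  weak_three : ∀ i j k, HasWeakPartial ω k (H i j) (D i j k)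

/-- `W`, with gradient `g`, is the representative in `C¹(closure ω)` of the class of `w`. -/
structure IsC1Representative (ω : Set Plane) (w W : Plane → ℝ) (g : Plane → Plane) : Prop where
  continuousOn : ContinuousOn W (closure ω)
  continuousOn_grad : ContinuousOn g (closure ω)
  hasGradientAt : ∀ x ∈ ω, HasGradientAt W (g x) x
  ae_eq : W =ᵐ[volume.restrict ω] w

/-- `v` is the nodal interpolant `I_h^dkt w` of (the `C¹` representative of) `w`. -/
def IsDKTInterpolant (ω : Set Plane) (K : SimplicialComplex ℝ Plane) (w v : Plane → ℝ) : Prop :=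
  IsDKT ω K v ∧ ∃ (W : Plane → ℝ) (g : Plane → Plane), IsC1Representative ω w W g ∧
    ∀ T ∈ triangles K, ∀ z ∈ T, v z = W z ∧ gradT v T z = g z

/-- `θ = ∇_h w := ∇_h (I_h^dkt w)`, the extension of the discrete gradient to `H³(ω)`. -/
def IsDiscreteGradientH3 (ω : Set Plane) (K : SimplicialComplex ℝ Plane)
    (w : Plane → ℝ) (θ : Plane → Plane) : Prop :=
  ∃ v : Plane → ℝ, IsDKTInterpolant ω K w v ∧ IsDiscreteGradient ω K v θ

/-! ### Norms -/

/-- The `L²(S)` norm of a vector, matrix or tensor field, in the Euclidean (Frobenius) norm. -/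
def l2norm {ι : Type} [Fintype ι] (S : Set Plane) (f : Plane → ι → ℝ) : ℝ :=
  Real.sqrt (∫ x in S, ∑ i, f x i ^ 2)

/-- The Jacobian `(∂ⱼ θᵢ)` of the restriction `θ|_T`. -/
def jacT (θ : Plane → Plane) (T : Finset Plane) (x : Plane) (p : Fin 2 × Fin 2) : ℝ :=
  fderivWithin ℝ θ (tri T) x (EuclideanSpace.single p.2 1) p.1

/-- The Hessian of the restriction `w|_T`. -/
def hessT (w : Plane → ℝ) (T : Finset Plane) : Plane → Fin 2 × Fin 2 → ℝ :=
  jacT (gradT w T) T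

end

/-! Everything reduces to explicit nodal formulas on one triangle. A reduced cubic is recovered from
its nodal values `W` and nodal gradients `g` by `dktForm`: linear interpolation, terms λ_a²λ_b
weighted by the Hermite excesses, and a cubic bubble whose coefficient is forced by the constraint
at the centre of gravity. The tangential derivative of a cubic at an edge midpoint is determined by
the end point data, so the discrete gradient is `gradForm`: linear interpolation of `g` plus
quadratic edge bubbles directed along the edges, weighted by the defect of the trapezoidal rule
(`eqOn_gradForm`). Uniqueness is then immediate. Existence follows by gluing: on a common face,
barycentric coordinates of the two triangles agree and only data at common vertices enter
(`gradForm_eq_of_mem`, `dktForm_eq_of_mem`).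

For (i), (ii) and (iv) the comparisons are first made in the maximum norm (`norm_theta_le`,
`norm_gradT_le`, `abs_hessT_le`, `abs_jacT_le`): one field controls differences of nodal data along
edges, and these control the other field, every derivative of a barycentric coordinate costing at
most 1/(2ρ). All fields involved are polynomials of degree at most two, so the inverse estimate
`exists_inverse_estimate` turns maximum norms into L² norms (`exists_l2norm_le`). It uses the disc
inside the triangle and the concentric disc of radius κρ around it, so that no reference triangle is
needed. The global estimate (i) is the sum over the triangles.

For (iii), the averaged Taylor polynomial of ∇w is an affine field which is uniformly close to ∇w on
the triangle, with error of order h‖D³w‖ (`IsBody.norm_sub_affine_le`). The nodal formula reproduces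
affine fields and the trapezoidal rule is exact for them, so the discrete gradient and its
derivative are close to this field and its linear part as well. That linear part is the mean of D²w,
and the Poincaré inequality on convex sets finishes the estimate (`exists_approx_le`).

The Sobolev facts are proved on compact convex sets with interior. Mollification after contraction
towards an inner point gives functions smooth up to the boundary; the averaged Taylor expansion
yields a Sobolev inequality, hence uniform convergence and a C¹ representative
(`IsBody.exists_hasGradientAt`). On a Lipschitz domain the representatives of the single triangles
fit together: inside ω they agree with the one on a small ball, and at boundary points they agree
because ω is locally connected there (`HasLipschitzBoundary.eq_of_mem`). -/

noncomputable section

/-! ### Polynomial functions on the plane -/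

/-- `f` is a polynomial function of total degree at most `k` on the whole plane. -/
def PolyFun (k : ℕ) (f : Plane → ℝ) : Prop :=
  ∃ p : MvPolynomial (Fin 2) ℝ, p.totalDegree ≤ k ∧
    ∀ x, f x = MvPolynomial.eval (fun i => x i) p

namespace PolyFun

variable {k l : ℕ} {f g : Plane → ℝ}

lemma isPolyOn (h : PolyFun k f) (S : Set Plane) : IsPolyOn k S f := by
  obtain ⟨p, hp, h⟩ := h
  exact ⟨p, hp, fun x _ => h x⟩

lemma mono (h : PolyFun k f) (hkl : k ≤ l) : PolyFun l f := by
  obtain ⟨p, hp, h⟩ := h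
  exact ⟨p, hp.trans hkl, h⟩

lemma const (c : ℝ) : PolyFun k (fun _ => c) :=
  ⟨MvPolynomial.C c, by simp, by simp⟩

lemma coord (i : Fin 2) : PolyFun 1 (fun x => x i) :=
  ⟨MvPolynomial.X i, by simp, by simp⟩

lemma add (hf : PolyFun k f) (hg : PolyFun k g) : PolyFun k (fun x => f x + g x) := by
  obtain ⟨p, hp, hf⟩ := hf
  obtain ⟨q, hq, hg⟩ := hg
  exact ⟨p + q, (MvPolynomial.totalDegree_add p q).trans (max_le hp hq), fun x => by
    simp [hf, hg]⟩

lemma mul (hf : PolyFun k f) (hg : PolyFun l g) : PolyFun (k + l) (fun x => f x * g x) := by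
  obtain ⟨p, hp, hf⟩ := hf
  obtain ⟨q, hq, hg⟩ := hg
  exact ⟨p * q, (MvPolynomial.totalDegree_mul p q).trans (add_le_add hp hq), fun x => by
    simp [hf, hg]⟩

lemma const_mul (c : ℝ) (hf : PolyFun k f) : PolyFun k (fun x => c * f x) := by
  simpa using (const (k := 0) c).mul hf

lemma mul_const (c : ℝ) (hf : PolyFun k f) : PolyFun k (fun x => f x * c) := by
  simpa using hf.mul (const (k := 0) c)

lemma sum {ι : Type*} (s : Finset ι) {F : ι → Plane → ℝ} (h : ∀ i ∈ s, PolyFun k (F i)) :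
    PolyFun k (fun x => ∑ i ∈ s, F i x) := by
  classical
  induction s using Finset.induction_on with
  | empty => simpa using const (k := k) 0
  | insert a s ha ih =>
    simp only [Finset.sum_insert ha]
    exact (h a (by simp)).add (ih fun i hi => h i (by simp [hi]))

lemma prod {ι : Type*} (s : Finset ι) {F : ι → Plane → ℝ} (h : ∀ i ∈ s, PolyFun 1 (F i)) :
    PolyFun s.card (fun x => ∏ i ∈ s, F i x) := by
  classical
  induction s using Finset.induction_on with
  | empty => simpa using const (k := 0) 1
  | insert a s ha ih =>
    simp only [Finset.prod_insert ha, Finset.card_insert_of_notMem ha]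
    rw [add_comm]
    exact (h a (by simp)).mul (ih fun i hi => h i (by simp [hi]))

lemma pow (hf : PolyFun 1 f) (n : ℕ) : PolyFun n (fun x => f x ^ n) := by
  simpa using prod (Finset.range n) (F := fun _ => f) (fun _ _ => hf)

/-- A polynomial function is a linear combination of monomials. -/
lemma exists_coeff (hf : PolyFun k f) : ∃ (s : Finset (Fin 2 →₀ ℕ)) (c : (Fin 2 →₀ ℕ) → ℝ),
    (∀ m ∈ s, m 0 + m 1 ≤ k) ∧ ∀ x, f x = ∑ m ∈ s, c m * (x 0 ^ m 0 * x 1 ^ m 1) := by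
  obtain ⟨p, hp, hf⟩ := hf
  refine ⟨p.support, p.coeff, fun m hm => ?_, fun x => ?_⟩
  · have := (MvPolynomial.le_totalDegree hm).trans hp
    rw [Finsupp.sum_fintype _ _ (by simp)] at this
    simpa using this
  · rw [hf, MvPolynomial.eval_eq']
    simp

/-- Composition with a map whose coordinates are affine. -/
lemma comp (hf : PolyFun k f) {A : Plane → Plane} (hA : ∀ i, PolyFun 1 (fun x => A x i)) :
    PolyFun k (fun x => f (A x)) := by
  obtain ⟨s, c, hs, h⟩ := hf.exists_coeff
  simp only [h]
  exact sum s fun m hm => ((((hA 0).pow (m 0)).mul ((hA 1).pow (m 1))).mono (hs m hm)).const_mul _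

/-- The ten coefficients of a cubic polynomial function. -/
lemma exists_cubic (hf : PolyFun 3 f) : ∃ c : Fin 4 → Fin 4 → ℝ, ∀ x : Plane,
    f x = c 0 0 + c 1 0 * x 0 + c 0 1 * x 1 + c 2 0 * x 0 ^ 2 + c 1 1 * (x 0 * x 1)
      + c 0 2 * x 1 ^ 2 + c 3 0 * x 0 ^ 3 + c 2 1 * (x 0 ^ 2 * x 1) + c 1 2 * (x 0 * x 1 ^ 2)
      + c 0 3 * x 1 ^ 3 := by
  obtain ⟨s, c, hs, h⟩ := hf.exists_coeff
  clear hf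
  induction s using Finset.induction_on generalizing f with
  | empty => exact ⟨0, fun x => by simp [h]⟩
  | insert a s ha ih =>
    obtain ⟨d, hd⟩ := ih (f := fun x => ∑ m ∈ s, c m * (x 0 ^ m 0 * x 1 ^ m 1))
      (fun m hm => hs m (by simp [hm])) (fun x => rfl)
    have hle := hs a (by simp)
    refine ⟨fun i j => d i j + if (i : ℕ) = a 0 ∧ (j : ℕ) = a 1 then c a else 0, fun x => ?_⟩
    rw [h, Finset.sum_insert ha, hd]
    generalize a 0 = i at *
    generalize a 1 = j at *
    have hi : i ≤ 3 := by omega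
    have hj : j ≤ 3 := by omega
    -- The degree bound leaves finitely many exponent pairs; those of total degree above three
    -- contradict it.
    interval_cases i <;> interval_cases j <;> first | omega | (simp; try ring)

/-- The six coefficients of a quadratic polynomial function. -/
lemma exists_quadratic (hf : PolyFun 2 f) : ∃ c : Fin 6 → ℝ, ∀ x : Plane,
    f x = c 0 + c 1 * x 0 + c 2 * x 1 + c 3 * x 0 ^ 2 + c 4 * (x 0 * x 1) + c 5 * x 1 ^ 2 := by
  obtain ⟨s, c, hs, h⟩ := hf.exists_coeff
  clear hf
  induction s using Finset.induction_on generalizing f with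
  | empty => exact ⟨0, fun x => by simp [h]⟩
  | insert a s ha ih =>
    obtain ⟨d, hd⟩ := ih (f := fun x => ∑ m ∈ s, c m * (x 0 ^ m 0 * x 1 ^ m 1))
      (fun m hm => hs m (by simp [hm])) (fun x => rfl)
    have hle := hs a (by simp)
    refine ⟨fun q => d q + if (a 0, a 1) = ![(0, 0), (1, 0), (0, 1), (2, 0), (1, 1), (0, 2)] q
      then c a else 0, fun x => ?_⟩
    rw [h, Finset.sum_insert ha, hd]
    generalize a 0 = i at *
    generalize a 1 = j at *
    have hi : i ≤ 2 := by omega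
    have hj : j ≤ 2 := by omega
    interval_cases i <;> interval_cases j <;> first | omega | (simp; try ring)

lemma contDiff (hf : PolyFun k f) : ContDiff ℝ (⊤ : ℕ∞) f := by
  obtain ⟨s, c, hs, h⟩ := hf.exists_coeff
  have : f = fun x => ∑ m ∈ s, c m * (x 0 ^ m 0 * x 1 ^ m 1) := funext h
  rw [this]
  fun_prop

lemma continuous (hf : PolyFun k f) : Continuous f := hf.contDiff.continuous

lemma differentiable (hf : PolyFun k f) : Differentiable ℝ f := hf.contDiff.differentiable (by simp)

end PolyFun

lemma IsPolyOn.exists_polyFun {k : ℕ} {S : Set Plane} {f : Plane → ℝ} (h : IsPolyOn k S f) :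
    ∃ P, PolyFun k P ∧ Set.EqOn f P S := by
  obtain ⟨p, hp, h⟩ := h
  exact ⟨_, ⟨p, hp, fun x => rfl⟩, h⟩

/-! ### Inverse estimate on balls -/

/-- The six monomials of degree at most two. -/
def quadMonomial (x : Plane) : Fin 6 → ℝ :=
  ![1, x 0, x 1, x 0 ^ 2, x 0 * x 1, x 1 ^ 2]

lemma continuous_quadMonomial (i : Fin 6) : Continuous fun x => quadMonomial x i := by
  fin_cases i <;> simp [quadMonomial] <;> fun_prop

lemma PolyFun.exists_quadMonomial {f : Plane → ℝ} (hf : PolyFun 2 f) :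
    ∃ c : Fin 6 → ℝ, ∀ x, f x = ∑ i, c i * quadMonomial x i := by
  obtain ⟨c, hc⟩ := hf.exists_quadratic
  exact ⟨c, fun x => by rw [hc]; simp [Fin.sum_univ_six, quadMonomial]⟩

/-- Six sample points suffice: the origin, the points at distance 1/2 on both sides along each axis,
and (1/2, 1/2) for the mixed coefficient. -/
lemma eq_zero_of_quad_eq_zero {c : Fin 6 → ℝ}
    (h : ∀ x ∈ Metric.ball (0 : Plane) 1, ∑ i, c i * quadMonomial x i = 0) : c = 0 := by
  have key : ∀ a b : ℝ, a ^ 2 + b ^ 2 < 1 →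
      c 0 + c 1 * a + c 2 * b + c 3 * a ^ 2 + c 4 * (a * b) + c 5 * b ^ 2 = 0 := by
    intro a b hab
    have := h !₂[a, b] (by
      rw [mem_ball_zero_iff, EuclideanSpace.norm_eq, Real.sqrt_lt' one_pos]
      simpa [Fin.sum_univ_two] using hab)
    simpa [Fin.sum_univ_six, quadMonomial] using this
  have h0 := key 0 0 (by norm_num)
  have h1 := key (1/2) 0 (by norm_num)
  have h2 := key (-1/2) 0 (by norm_num)
  have h3 := key 0 (1/2) (by norm_num)
  have h4 := key 0 (-1/2) (by norm_num)
  have h5 := key (1/2) (1/2) (by norm_num)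
  ext i
  fin_cases i <;> simp <;> linarith

/-- The squared L² norm over the unit disc is a continuous quadratic form in the coefficients and is
positive on the compact unit sphere of coefficient space; its minimum there and homogeneity give the
constant. -/
lemma exists_quad_lower_bound : ∃ C : ℝ, 0 < C ∧ ∀ c : Fin 6 → ℝ, ∀ i,
    c i ^ 2 ≤ C * ∫ x in Metric.ball (0 : Plane) 1, (∑ i, c i * quadMonomial x i) ^ 2 := by
  set μ : Measure Plane := volume.restrict (Metric.ball (0 : Plane) 1)
  set F : (Fin 6 → ℝ) → ℝ := fun c => ∫ x, (∑ i, c i * quadMonomial x i) ^ 2 ∂μ with hF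
  have hint : ∀ g : Plane → ℝ, Continuous g → Integrable g μ := fun g hg =>
    (hg.continuousOn.integrableOn_compact (isCompact_closedBall (0 : Plane) 1)).mono_set
      Metric.ball_subset_closedBall
  have hFe : F = fun c => ∑ i, ∑ j, c i * c j * ∫ x, quadMonomial x i * quadMonomial x j ∂μ := by
    funext c
    simp only [hF, pow_two, Finset.sum_mul_sum]
    have hq := continuous_quadMonomial
    rw [integral_finsetSum]
    · refine Finset.sum_congr rfl fun i _ => ?_
      rw [integral_finsetSum]
      · refine Finset.sum_congr rfl fun j _ => ?_
        rw [← integral_const_mul]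
        congr 1; funext x; ring
      · intro j _
        exact hint _ (by have := hq i; have := hq j; fun_prop)
    · intro i _
      exact hint _ (by fun_prop)
  have hcont : Continuous F := by rw [hFe]; fun_prop
  have hpos : ∀ c ∈ Metric.sphere (0 : Fin 6 → ℝ) 1, 0 < F c := by
    intro c hc
    have h0 : 0 ≤ F c := integral_nonneg fun x => sq_nonneg _
    refine lt_of_le_of_ne h0 fun h => ?_
    have hcts : Continuous fun x : Plane => (∑ i, c i * quadMonomial x i) ^ 2 := by
      have hq := continuous_quadMonomial
      fun_prop
    -- A continuous function that vanishes almost everywhere on the open disc vanishes on all of it.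
    have hz := (integral_eq_zero_iff_of_nonneg (fun x => sq_nonneg _) (hint _ hcts)).1 h.symm
    have hz' := Measure.eqOn_open_of_ae_eq hz Metric.isOpen_ball hcts.continuousOn
      continuousOn_const
    have : c = 0 := eq_zero_of_quad_eq_zero fun x hx => by simpa using hz' hx
    simp [this] at hc
  obtain ⟨c₀, hc₀, hmin⟩ := (isCompact_sphere (0 : Fin 6 → ℝ) 1).exists_isMinOn
    (NormedSpace.sphere_nonempty.2 zero_le_one) hcont.continuousOn
  refine ⟨(F c₀)⁻¹, inv_pos.2 (hpos _ hc₀), fun c i => ?_⟩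
  change _ ≤ (F c₀)⁻¹ * F c
  by_cases hc : c = 0
  · subst hc
    simpa using mul_nonneg (inv_pos.2 (hpos _ hc₀)).le (integral_nonneg fun x => sq_nonneg _)
  have hn : 0 < ‖c‖ := norm_pos_iff.2 hc
  have hle : F c₀ ≤ F (‖c‖⁻¹ • c) := hmin (by simp [norm_smul, hn.ne'])
  have hsc : F (‖c‖⁻¹ • c) = (‖c‖ ^ 2)⁻¹ * F c := by
    simp only [hF]
    rw [← integral_const_mul]
    congr 1; funext x
    simp only [Pi.smul_apply, smul_eq_mul, mul_assoc, ← Finset.mul_sum]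
    rw [mul_pow, inv_pow]
  rw [hsc] at hle
  have h1 : c i ^ 2 ≤ ‖c‖ ^ 2 := by
    rw [← sq_abs]
    exact pow_le_pow_left₀ (abs_nonneg _) (norm_le_pi_norm c i) 2
  refine h1.trans ?_
  rw [inv_mul_eq_div, le_div_iff₀ (by positivity)] at hle
  rw [inv_mul_eq_div, le_div_iff₀ (hpos _ hc₀)]
  linarith [hle]

/-- A quadratic polynomial is bounded on a ball by its `L²` norm on a smaller concentric ball. -/
lemma exists_inverse_estimate_ball (κ : ℝ) : ∃ C : ℝ, 0 < C ∧ ∀ f : Plane → ℝ, PolyFun 2 f →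
    ∀ (a : Plane) (ρ : ℝ), 0 < ρ → ∀ x ∈ Metric.closedBall a (κ * ρ),
      f x ^ 2 ≤ C * (ρ ^ 2)⁻¹ * ∫ y in Metric.ball a ρ, f y ^ 2 := by
  obtain ⟨C, hC, h⟩ := exists_quad_lower_bound
  -- Cauchy–Schwarz over six coefficients and six monomials gives 6 · 6 = 36; on the disc of radius
  -- κ each squared monomial is at most `(max 1 (κ ^ 2)) ^ 2`.
  refine ⟨C * (36 * (max 1 (κ ^ 2)) ^ 2), by positivity, fun f hf a ρ hρ x hx => ?_⟩
  obtain ⟨c, hc⟩ := (hf.comp (A := fun y => a + ρ • y) fun i => by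
    simpa using (PolyFun.const (a i)).add ((PolyFun.coord i).const_mul ρ)).exists_quadMonomial
  have hI : ∫ y in Metric.ball a ρ, f y ^ 2 =
      ρ ^ 2 * ∫ y in Metric.ball (0 : Plane) 1, (∑ i, c i * quadMonomial y i) ^ 2 := by
    have h1 := Measure.setIntegral_comp_smul_of_pos (volume : Measure Plane)
      (fun y => f (a + y) ^ 2) (Metric.ball (0 : Plane) 1) hρ
    simp only [hc, smul_unitBall_of_pos hρ, finrank_euclideanSpace, Fintype.card_fin,
      smul_eq_mul] at h1
    rw [h1, ← mul_assoc, mul_inv_cancel₀ (by positivity), one_mul]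
    have h2 := (measurePreserving_add_left (volume : Measure Plane) a).setIntegral_preimage_emb
      (MeasurableEquiv.addLeft a).measurableEmbedding (fun y => f y ^ 2) (Metric.ball a ρ)
    rw [← h2]
    congr 2
    ext y
    simp [dist_eq_norm]
  rw [hI]
  set I := ∫ y in Metric.ball (0 : Plane) 1, (∑ i, c i * quadMonomial y i) ^ 2
  set y : Plane := ρ⁻¹ • (x - a) with hy
  have hxy : x = a + ρ • y := by simp [hy, smul_smul, hρ.ne']
  have hyn : ‖y‖ ≤ κ := by
    rw [hy, norm_smul, Real.norm_of_nonneg (by positivity), inv_mul_le_iff₀ hρ, mul_comm]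
    rwa [Metric.mem_closedBall, dist_eq_norm] at hx
  set M := max 1 (κ ^ 2)
  have hM1 : 1 ≤ M := le_max_left _ _
  have hM2 : κ ^ 2 ≤ M := le_max_right _ _
  have hyM : y 0 ^ 2 + y 1 ^ 2 ≤ M := by
    have : ‖y‖ ^ 2 = y 0 ^ 2 + y 1 ^ 2 := by
      rw [EuclideanSpace.norm_sq_eq]; simp [Fin.sum_univ_two]
    rw [← this]
    exact (pow_le_pow_left₀ (norm_nonneg _) hyn 2).trans hM2
  have hmon : ∀ i, quadMonomial y i ^ 2 ≤ M ^ 2 := by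
    have hMM : M ≤ M ^ 2 := by nlinarith
    have h0 := sq_nonneg (y 0)
    have h1 := sq_nonneg (y 1)
    intro i
    fin_cases i <;> simp only [quadMonomial, Fin.zero_eta, Fin.mk_one, Fin.reduceFinMk,
      Matrix.cons_val]
    · nlinarith
    · nlinarith
    · nlinarith
    · exact pow_le_pow_left₀ h0 (by linarith) 2
    · rw [mul_pow]; nlinarith [mul_nonneg h0 h1]
    · exact pow_le_pow_left₀ h1 (by linarith) 2
  have hf2 : f x ^ 2 ≤ 36 * M ^ 2 * (C * I) := by
    rw [hxy, hc]
    calc (∑ i, c i * quadMonomial y i) ^ 2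
        ≤ (∑ i, c i ^ 2) * ∑ i, quadMonomial y i ^ 2 := Finset.sum_mul_sq_le_sq_mul_sq _ _ _
      _ ≤ (∑ _i : Fin 6, C * I) * ∑ _i : Fin 6, M ^ 2 := by
        exact mul_le_mul (Finset.sum_le_sum fun i _ => h c i) (Finset.sum_le_sum fun i _ => hmon i)
          (Finset.sum_nonneg fun i _ => sq_nonneg _)
          (Finset.sum_nonneg fun i _ => (sq_nonneg _).trans (h c i))
      _ = 36 * M ^ 2 * (C * I) := by simp; ring
  calc f x ^ 2 ≤ 36 * M ^ 2 * (C * I) := hf2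
    _ = C * (36 * M ^ 2) * (ρ ^ 2)⁻¹ * (ρ ^ 2 * I) := by field_simp

end

noncomputable section

/-! ### Barycentric coordinates of a triangle -/

/-- `T` is the vertex set of a nondegenerate triangle. -/
structure IsTri (T : Finset Plane) : Prop where
  indep : AffineIndependent ℝ ((↑) : T → Plane)
  card : T.card = 3

lemma isTri_of_mem_triangles {K : SimplicialComplex ℝ Plane} {T : Finset Plane}
    (hT : T ∈ triangles K) : IsTri T := ⟨K.indep hT.1, hT.2⟩

namespace IsTri

variable {T T' : Finset Plane} {x y z a b : Plane} {ρ : ℝ}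

/-- The vertices of a triangle as an affine basis of the plane. -/
def basis (hT : IsTri T) : AffineBasis T ℝ Plane where
  toFun := (↑)
  ind' := hT.indep
  tot' := by
    rw [hT.indep.affineSpan_eq_top_iff_card_eq_finrank_add_one]
    simp [hT.card]

end IsTri

open Classical in
/-- The barycentric coordinate of the vertex `z` of the triangle `T`. -/
def bary (T : Finset Plane) (z : Plane) : Plane →ᵃ[ℝ] ℝ :=
  if h : IsTri T ∧ z ∈ T then h.1.basis.coord ⟨z, h.2⟩ else 0

/-- The derivative of a barycentric coordinate. -/
def dbary (T : Finset Plane) (z : Plane) : Plane →L[ℝ] ℝ :=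
  LinearMap.toContinuousLinearMap (bary T z).linear

lemma bary_add (T : Finset Plane) (z x v : Plane) :
    bary T z (x + v) = bary T z x + dbary T z v := by
  have := (bary T z).map_vadd x v
  simp only [vadd_eq_add] at this
  rw [add_comm x v, this, add_comm]
  rfl

lemma bary_sub (T : Finset Plane) (z x y : Plane) :
    dbary T z (y - x) = bary T z y - bary T z x := by
  have := bary_add T z x (y - x)
  rw [add_sub_cancel] at this
  linarith

lemma hasFDerivAt_bary (T : Finset Plane) (z x : Plane) :
    HasFDerivAt (bary T z) (dbary T z) x := by
  have h : (bary T z : Plane → ℝ) = fun x => bary T z 0 + dbary T z x := by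
    funext x
    simpa using bary_add T z 0 x
  rw [h]
  exact (dbary T z).hasFDerivAt.const_add _

lemma Plane.eq_coord (x : Plane) :
    x = x 0 • EuclideanSpace.single 0 1 + x 1 • EuclideanSpace.single 1 1 := by
  ext i
  fin_cases i <;> simp

lemma polyFun_bary (T : Finset Plane) (z : Plane) : PolyFun 1 (bary T z) := by
  have h : (bary T z : Plane → ℝ) = fun x => bary T z 0 +
      (x 0 * dbary T z (EuclideanSpace.single 0 1) + x 1 * dbary T z (EuclideanSpace.single 1 1)) := by
    funext x
    conv_lhs => rw [← zero_add x, bary_add, Plane.eq_coord x]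
    simp
  rw [h]
  exact (PolyFun.const _).add (((PolyFun.coord 0).mul_const _).add ((PolyFun.coord 1).mul_const _))

/-- The default value zero allows bounds on `bary` to be stated for all points `z`, and lets the
comparison of two triangles treat vertices that belong to only one of them. -/
lemma bary_of_notMem {T : Finset Plane} {z : Plane} (hz : z ∉ T) (x : Plane) : bary T z x = 0 := by
  simp [bary, hz]

namespace IsTri

variable {T T' : Finset Plane} {x y z a b : Plane} {ρ : ℝ}

lemma bary_eq (hT : IsTri T) (z : T) : bary T z = hT.basis.coord z := by
  rw [bary, dif_pos ⟨hT, z.2⟩]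

lemma sum_bary (hT : IsTri T) (x : Plane) : ∑ z ∈ T, bary T z x = 1 := by
  rw [← Finset.sum_coe_sort]
  simp only [hT.bary_eq]
  exact hT.basis.sum_coord_apply_eq_one x

lemma sum_bary_smul (hT : IsTri T) (x : Plane) : ∑ z ∈ T, bary T z x • z = x := by
  rw [← Finset.sum_coe_sort T fun z => bary T z x • z]
  simp only [hT.bary_eq]
  exact hT.basis.linear_combination_coord_eq_self x

lemma bary_eq_of_sum (hT : IsTri T) {c : Plane → ℝ} (h1 : ∑ z ∈ T, c z = 1)
    (hx : ∑ z ∈ T, c z • z = x) (hz : z ∈ T) : bary T z x = c z := by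
  rw [← Finset.sum_coe_sort] at h1
  rw [← Finset.sum_coe_sort T fun z => c z • z] at hx
  have hx' : Finset.univ.affineCombination ℝ hT.basis (fun z : T => c z) = x := by
    rw [Finset.affineCombination_eq_linear_combination _ _ _ h1]
    exact hx
  rw [hT.bary_eq ⟨z, hz⟩, ← hx', hT.basis.coord_apply_combination_of_mem (Finset.mem_univ _) h1]

lemma bary_vertex [DecidableEq Plane] (hT : IsTri T) (ha : a ∈ T) (hz : z ∈ T) :
    bary T z a = if z = a then 1 else 0 :=
  hT.bary_eq_of_sum (c := fun z => if z = a then 1 else 0) (by simp [ha]) (by simp [ha]) hz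

lemma mem_tri_iff (hT : IsTri T) : x ∈ tri T ↔ ∀ z ∈ T, 0 ≤ bary T z x := by
  constructor
  · intro hx z hz
    rw [tri, Finset.convexHull_eq, Set.mem_ofPred_eq] at hx
    obtain ⟨w, hw0, hw1, hw⟩ := hx
    rw [Finset.centerMass_eq_of_sum_1 _ _ hw1] at hw
    rw [hT.bary_eq_of_sum hw1 (by simpa using hw) hz]
    exact hw0 z hz
  · intro h
    rw [tri, Finset.convexHull_eq]
    refine ⟨fun z => bary T z x, h, hT.sum_bary x, ?_⟩
    rw [Finset.centerMass_eq_of_sum_1 _ _ (hT.sum_bary x)]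
    exact hT.sum_bary_smul x

lemma bary_nonneg (hT : IsTri T) (hx : x ∈ tri T) (z : Plane) : 0 ≤ bary T z x := by
  by_cases hz : z ∈ T
  · exact hT.mem_tri_iff.1 hx z hz
  · rw [bary_of_notMem hz]

lemma bary_le_one (hT : IsTri T) (hx : x ∈ tri T) (z : Plane) : bary T z x ≤ 1 := by
  by_cases hz : z ∈ T
  · rw [← hT.sum_bary x]
    exact Finset.single_le_sum (f := fun z => bary T z x) (fun z _ => hT.bary_nonneg hx z) hz
  · rw [bary_of_notMem hz]
    exact zero_le_one

/-- On a common face, barycentric coordinates agree. -/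
lemma bary_eq_bary (hT : IsTri T) (hT' : IsTri T')
    (hx : x ∈ convexHull ℝ ((T : Set Plane) ∩ (T' : Set Plane))) (z : Plane) :
    bary T z x = bary T' z x ∧ (z ∉ T' → bary T z x = 0) := by
  classical
  rw [← Finset.coe_inter, Finset.convexHull_eq, Set.mem_ofPred_eq] at hx
  obtain ⟨w, hw0, hw1, hw⟩ := hx
  rw [Finset.centerMass_eq_of_sum_1 _ _ hw1] at hw
  -- Extended by zero, the weights on the common vertices represent `x` with respect to both
  -- triangles, and such representations are unique.
  set c : Plane → ℝ := fun z => if z ∈ T ∩ T' then w z else 0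
  have key : ∀ U : Finset Plane, T ∩ T' ⊆ U → ∑ z ∈ U, c z = 1 ∧ ∑ z ∈ U, c z • z = x := by
    intro U hU
    constructor
    · rw [← hw1, ← Finset.sum_subset hU (fun z _ h => if_neg h)]
      exact Finset.sum_congr rfl fun z hz => if_pos hz
    · rw [← hw, ← Finset.sum_subset hU (fun z _ h => by simp only [c]; rw [if_neg h, zero_smul])]
      exact Finset.sum_congr rfl fun z hz => by simp only [c]; rw [if_pos hz]; rfl
  have h1 : ∀ z, bary T z x = c z := by
    intro z
    by_cases hz : z ∈ T
    · exact hT.bary_eq_of_sum (key T Finset.inter_subset_left).1 (key T Finset.inter_subset_left).2 hz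
    · rw [bary_of_notMem hz]; simp [c, hz]
  have h2 : ∀ z, bary T' z x = c z := by
    intro z
    by_cases hz : z ∈ T'
    · exact hT'.bary_eq_of_sum (key T' Finset.inter_subset_right).1
        (key T' Finset.inter_subset_right).2 hz
    · rw [bary_of_notMem hz]; simp [c, hz]
  exact ⟨by rw [h1, h2], fun hz => by rw [h1]; simp [c, hz]⟩

lemma vertex_mem (ha : a ∈ T) : a ∈ tri T := subset_convexHull ℝ _ ha

lemma isCompact_tri (T : Finset Plane) : IsCompact (tri T) :=
  T.finite_toSet.isCompact_convexHull ℝ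

lemma convex_tri (T : Finset Plane) : Convex ℝ (tri T) := convex_convexHull ℝ _

lemma interior_tri_nonempty (hT : IsTri T) : (interior (tri T)).Nonempty := by
  have := hT.basis.interior_convexHull
  have h2 : (interior (convexHull ℝ (Set.range hT.basis))).Nonempty :=
    ⟨_, hT.basis.centroid_mem_interior_convexHull⟩
  have h3 : Set.range hT.basis = (T : Set Plane) := Subtype.range_coe
  rwa [h3] at h2

lemma uniqueDiffOn_tri (hT : IsTri T) : UniqueDiffOn ℝ (tri T) :=
  uniqueDiffOn_convex (convex_tri T) hT.interior_tri_nonempty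

lemma norm_sub_le_diam (hx : x ∈ tri T) (hy : y ∈ tri T) : ‖x - y‖ ≤ diamT T := by
  rw [← dist_eq_norm]
  exact Metric.dist_le_diam_of_mem (isCompact_tri T).isBounded hx hy

/-- Between the end points of a diameter of the disc, of length 2ρ, a barycentric coordinate changes
by at most one. -/
lemma norm_dbary_le (hT : IsTri T) (hρ : 0 < ρ) (hb : Metric.closedBall x ρ ⊆ tri T) (z : Plane) :
    ‖dbary T z‖ ≤ (2 * ρ)⁻¹ := by
  refine ContinuousLinearMap.opNorm_le_of_unit_norm (𝕜 := ℝ) (by positivity) fun v hv => ?_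
  have h1 : x + ρ • v ∈ tri T := hb (by simp [hv, norm_smul, abs_of_pos hρ])
  have h2 : x - ρ • v ∈ tri T := hb (by simp [hv, norm_smul, abs_of_pos hρ])
  have h3 : (2 * ρ) * dbary T z v = bary T z (x + ρ • v) - bary T z (x - ρ • v) := by
    rw [← bary_sub, ← smul_eq_mul, ← map_smul]
    congr 1
    module
  have h4 := hT.bary_nonneg h1 z
  have h5 := hT.bary_nonneg h2 z
  have h6 := hT.bary_le_one h1 z
  have h7 := hT.bary_le_one h2 z
  rw [Real.norm_eq_abs, ← one_div, le_div_iff₀ (by positivity), mul_comm, ← abs_of_pos hρ]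
  have : |2 * |ρ| * dbary T z v| ≤ 1 := by
    rw [abs_of_pos hρ, h3, abs_le]; constructor <;> linarith
  rwa [abs_mul, abs_of_nonneg (by positivity)] at this

lemma two_mul_le_diam (hρ : 0 < ρ) (hball : Metric.closedBall x ρ ⊆ tri T) :
    2 * ρ ≤ diamT T := by
  have h1 : x + ρ • EuclideanSpace.single 0 1 ∈ tri T :=
    hball (by simp [norm_smul, abs_of_pos hρ])
  have h2 : x - ρ • EuclideanSpace.single 0 1 ∈ tri T :=
    hball (by simp [norm_smul, abs_of_pos hρ])
  have h3 := norm_sub_le_diam h1 h2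
  have h4 : x + ρ • EuclideanSpace.single (0 : Fin 2) (1 : ℝ) - (x - ρ • EuclideanSpace.single 0 1)
      = (2 * ρ) • EuclideanSpace.single 0 1 := by module
  rw [h4, norm_smul, Real.norm_of_nonneg (by positivity)] at h3
  simpa using h3

end IsTri

end

noncomputable section

/-! ### Nodal representations of cubic and quadratic polynomials -/

/-- The reduced cubic with nodal values `W` and Hermite excesses `α`. -/
def dktForm (T : Finset Plane) (W : Plane → ℝ) (α : Plane → Plane → ℝ) (x : Plane) : ℝ :=
  ∑ a ∈ T, W a * bary T a x + ∑ a ∈ T, ∑ b ∈ T, α a b * (bary T a x ^ 2 * bary T b x) +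
    1 / 2 * (∑ a ∈ T, ∑ b ∈ T, α a b) * ∏ a ∈ T, bary T a x

/-- The quadratic vector field with nodal values `g` and tangential edge excesses `δ`. -/
def gradForm (T : Finset Plane) (g : Plane → Plane) (δ : Plane → Plane → ℝ) (x : Plane) : Plane :=
  ∑ a ∈ T, bary T a x • g a +
    ∑ a ∈ T, ∑ b ∈ T, (3 * δ a b * (‖b - a‖ ^ 2)⁻¹ * (bary T a x * bary T b x)) • (b - a)

/-- The defect at `a` of the linear interpolation along `[a, b]` for nodal values `W` and nodal
gradients `g`. -/
def hermiteExcess (W : Plane → ℝ) (g : Plane → Plane) (a b : Plane) : ℝ :=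
  inner ℝ (g a) (b - a) - (W b - W a)

/-- The defect of the trapezoidal rule along `[a, b]` for nodal values `W` and nodal
gradients `g`. -/
def trapezoidExcess (W : Plane → ℝ) (g : Plane → Plane) (a b : Plane) : ℝ :=
  W b - W a - 1 / 2 * inner ℝ (g a + g b) (b - a)

/-- The cubic polynomial in two real variables with coefficients `c`. -/
def cubicEval (c : Fin 4 → Fin 4 → ℝ) (s t : ℝ) : ℝ :=
  c 0 0 + c 1 0 * s + c 0 1 * t + c 2 0 * s ^ 2 + c 1 1 * (s * t)
      + c 0 2 * t ^ 2 + c 3 0 * s ^ 3 + c 2 1 * (s ^ 2 * t) + c 1 2 * (s * t ^ 2)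
      + c 0 3 * t ^ 3

lemma PolyFun.comp_affine {k : ℕ} {P : Plane → ℝ} (hP : PolyFun k P) (a u v : Plane) :
    PolyFun k (fun x => P (a + x 0 • u + x 1 • v)) :=
  hP.comp fun i => by
    simpa using ((PolyFun.const (a i)).add ((PolyFun.coord 0).mul_const (u i))).add
      ((PolyFun.coord 1).mul_const (v i))

lemma PolyFun.exists_cubicEval {P : Plane → ℝ} (hP : PolyFun 3 P) (a u v : Plane) :
    ∃ c, ∀ s t : ℝ, P (a + s • u + t • v) = cubicEval c s t := by
  obtain ⟨c, hc⟩ := (hP.comp_affine a u v).exists_cubic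
  exact ⟨c, fun s t => by simpa [cubicEval] using hc !₂[s, t]⟩

lemma inner_gradient_eq {P : Plane → ℝ} (z e : Plane) :
    inner ℝ (gradient P z) e = fderiv ℝ P z e := by
  simp [gradient]

/-- Differentiating along the line through `z` in direction `e` reduces this to one real variable.
The vectors `u`, `v` need not be independent, so a single edge can be treated with `v = 0`. -/
lemma inner_gradient_cubicEval {P : Plane → ℝ} (hP : Differentiable ℝ P) {a u v : Plane}
    {c : Fin 4 → Fin 4 → ℝ} (h : ∀ s t : ℝ, P (a + s • u + t • v) = cubicEval c s t)
    (s t p r : ℝ) {z e : Plane} (hz : z = a + s • u + t • v) (he : e = p • u + r • v) :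
    inner ℝ (gradient P z) e =
      p * (c 1 0 + 2 * c 2 0 * s + c 1 1 * t + 3 * c 3 0 * s ^ 2 + 2 * c 2 1 * (s * t)
        + c 1 2 * t ^ 2) +
      r * (c 0 1 + 2 * c 0 2 * t + c 1 1 * s + 3 * c 0 3 * t ^ 2 + 2 * c 1 2 * (s * t)
        + c 2 1 * s ^ 2) := by
  rw [inner_gradient_eq]
  have h1 : HasDerivAt (fun τ : ℝ => P (z + τ • e)) (fderiv ℝ P z e) 0 :=
    (hP z).hasFDerivAt.hasLineDerivAt e
  have h2 : (fun τ : ℝ => P (z + τ • e)) = fun τ => cubicEval c (s + τ * p) (t + τ * r) := by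
    funext τ
    rw [← h, hz, he]
    congr 1
    module
  rw [h2] at h1
  have hs : HasDerivAt (fun τ : ℝ => s + τ * p) p 0 := by
    simpa using ((hasDerivAt_id (0 : ℝ)).mul_const p).const_add s
  have ht : HasDerivAt (fun τ : ℝ => t + τ * r) r 0 := by
    simpa using ((hasDerivAt_id (0 : ℝ)).mul_const r).const_add t
  have h3 := ((((((((((hasDerivAt_const (0 : ℝ) (c 0 0)).add (hs.const_mul (c 1 0))).add
    (ht.const_mul (c 0 1))).add ((hs.pow 2).const_mul (c 2 0))).add
    ((hs.mul ht).const_mul (c 1 1))).add ((ht.pow 2).const_mul (c 0 2))).add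
    ((hs.pow 3).const_mul (c 3 0))).add (((hs.pow 2).mul ht).const_mul (c 2 1))).add
    ((hs.mul (ht.pow 2)).const_mul (c 1 2))).add ((ht.pow 3).const_mul (c 0 3)))
  rw [h1.unique h3]
  simp
  ring

lemma IsTri.exists_triple [DecidableEq Plane] {T : Finset Plane} (hT : IsTri T) : ∃ a b c : Plane,
    a ≠ b ∧ a ≠ c ∧ b ≠ c ∧ T = {a, b, c} :=
  Finset.card_eq_three.1 hT.card

lemma sum_triple [DecidableEq Plane] {M : Type*} [AddCommMonoid M] {a b c : Plane} (hab : a ≠ b)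
    (hac : a ≠ c) (hbc : b ≠ c) (f : Plane → M) :
    ∑ z ∈ ({a, b, c} : Finset Plane), f z = f a + f b + f c := by
  rw [Finset.sum_insert (by simp [hab, hac]), Finset.sum_insert (by simp [hbc]),
    Finset.sum_singleton, add_assoc]

lemma prod_triple [DecidableEq Plane] {M : Type*} [CommMonoid M] {a b c : Plane} (hab : a ≠ b)
    (hac : a ≠ c) (hbc : b ≠ c) (f : Plane → M) :
    ∏ z ∈ ({a, b, c} : Finset Plane), f z = f a * f b * f c := by
  rw [Finset.prod_insert (by simp [hab, hac]), Finset.prod_insert (by simp [hbc]),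
    Finset.prod_singleton, mul_assoc]

lemma hermiteExcess_self (W : Plane → ℝ) (g : Plane → Plane) (a : Plane) :
    hermiteExcess W g a a = 0 := by simp [hermiteExcess]

/-- This shows antisymmetry of the trapezoid excess and lets bounds on Hermite excesses carry over
to it. -/
lemma trapezoidExcess_eq (W : Plane → ℝ) (g : Plane → Plane) (a b : Plane) :
    trapezoidExcess W g a b = 1 / 2 * (hermiteExcess W g b a - hermiteExcess W g a b) := by
  simp only [trapezoidExcess, hermiteExcess, inner_add_left]
  rw [← neg_sub b a, inner_neg_right]
  ring

/-- Every reduced cubic is given by its nodal values and gradients. -/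
lemma PolyFun.eq_dktForm {T : Finset Plane} (hT : IsTri T) {P : Plane → ℝ} (hP : PolyFun 3 P)
    (hred : P (center T) =
      (1 / 6) * ∑ z ∈ T, (2 * P z - inner ℝ (gradient P z) (z - center T))) (x : Plane) :
    P x = dktForm T P (hermiteExcess P (gradient P)) x := by
  classical
  obtain ⟨a, b, c, hab, hac, hbc, rfl⟩ := hT.exists_triple
  have h1 := hT.sum_bary x
  have h2 := hT.sum_bary_smul x
  simp only [center, dktForm, sum_triple hab hac hbc, prod_triple hab hac hbc,
    hermiteExcess_self] at *
  set s := bary {a, b, c} b x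
  set t := bary {a, b, c} c x
  have ha : bary {a, b, c} a x = 1 - s - t := by linarith
  rw [ha] at h2 ⊢
  obtain ⟨q, hq⟩ := hP.exists_cubicEval a (b - a) (c - a)
  have hx : P x = cubicEval q s t := by
    rw [← hq, ← h2]; congr 1; module
  have hPa : P a = cubicEval q 0 0 := by rw [← hq]; congr 1; module
  have hPb : P b = cubicEval q 1 0 := by rw [← hq]; congr 1; module
  have hPc : P c = cubicEval q 0 1 := by rw [← hq]; congr 1; module
  have hPm : P ((1 / 3 : ℝ) • (a + b + c)) = cubicEval q (1 / 3) (1 / 3) := by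
    rw [← hq]; congr 1; module
  have hg := inner_gradient_cubicEval hP.differentiable hq
  have ea : a = a + (0 : ℝ) • (b - a) + (0 : ℝ) • (c - a) := by module
  have eb : b = a + (1 : ℝ) • (b - a) + (0 : ℝ) • (c - a) := by module
  have ec : c = a + (0 : ℝ) • (b - a) + (1 : ℝ) • (c - a) := by module
  have gab := hg 0 0 1 0 (e := b - a) ea (by module)
  have gac := hg 0 0 0 1 (e := c - a) ea (by module)
  have gba := hg 1 0 (-1) 0 (e := a - b) eb (by module)
  have gbc := hg 1 0 (-1) 1 (e := c - b) eb (by module)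
  have gca := hg 0 1 0 (-1) (e := a - c) ec (by module)
  have gcb := hg 0 1 1 (-1) (e := b - c) ec (by module)
  have gam := hg 0 0 (-1/3) (-1/3) (e := a - (1 / 3 : ℝ) • (a + b + c)) ea (by module)
  have gbm := hg 1 0 (2/3) (-1/3) (e := b - (1 / 3 : ℝ) • (a + b + c)) eb (by module)
  have gcm := hg 0 1 (-1/3) (2/3) (e := c - (1 / 3 : ℝ) • (a + b + c)) ec (by module)
  simp only [hermiteExcess]
  rw [hPm, gam, gbm, gcm, hPa, hPb, hPc] at hred
  rw [hx, gab, gac, gba, gbc, gca, gcb, hPa, hPb, hPc]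
  simp only [cubicEval] at hred ⊢
  -- The remaining defect is a multiple of the cubic bubble, whose value at the centre of gravity is
  -- 1/27; the constraint there makes the coefficient match.
  linear_combination (27 * ((1 - s - t) * s * t)) * hred

/-- The derivative at the midpoint of an edge of a cubic polynomial. -/
lemma PolyFun.inner_gradient_midpoint {P : Plane → ℝ} (hP : PolyFun 3 P) (a b : Plane) :
    inner ℝ (gradient P (midpoint ℝ a b)) (b - a) =
      1 / 2 * inner ℝ (gradient P a + gradient P b) (b - a) +
        3 / 2 * trapezoidExcess P (gradient P) a b := by
  -- Only the restriction to the edge matters, so the second direction is taken to be zero.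
  obtain ⟨q, hq⟩ := hP.exists_cubicEval a (b - a) 0
  have hPa : P a = cubicEval q 0 0 := by rw [← hq]; congr 1; module
  have hPb : P b = cubicEval q 1 0 := by rw [← hq]; congr 1; module
  have hg := inner_gradient_cubicEval hP.differentiable hq
  have g0 := hg 0 0 1 0 (z := a) (e := b - a) (by module) (by module)
  have g1 := hg 1 0 1 0 (z := b) (e := b - a) (by module) (by module)
  have gm := hg (1 / 2) 0 1 0 (z := midpoint ℝ a b) (e := b - a)
    (by rw [midpoint_eq_smul_add, invOf_eq_inv]; module) (by module)
  rw [trapezoidExcess, inner_add_left, g0, g1, gm, hPa, hPb]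
  simp only [cubicEval]
  ring

/-- Every quadratic polynomial is given by its values at the vertices and edge midpoints. -/
lemma PolyFun.eq_quadratic_nodal {T : Finset Plane} (hT : IsTri T) {P : Plane → ℝ}
    (hP : PolyFun 2 P) (x : Plane) :
    P x = ∑ a ∈ T, bary T a x * P a + ∑ a ∈ T, ∑ b ∈ T,
      2 * (P (midpoint ℝ a b) - 1 / 2 * (P a + P b)) * (bary T a x * bary T b x) := by
  classical
  obtain ⟨a, b, c, hab, hac, hbc, rfl⟩ := hT.exists_triple
  have h1 := hT.sum_bary x
  have h2 := hT.sum_bary_smul x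
  simp only [sum_triple hab hac hbc] at *
  set s := bary {a, b, c} b x
  set t := bary {a, b, c} c x
  have ha : bary {a, b, c} a x = 1 - s - t := by linarith
  rw [ha] at h2 ⊢
  obtain ⟨q, hq'⟩ := (hP.comp_affine a (b - a) (c - a)).exists_quadratic
  have hq : ∀ (y : Plane) (s t : ℝ), y = a + s • (b - a) + t • (c - a) →
      P y = q 0 + q 1 * s + q 2 * t + q 3 * s ^ 2 + q 4 * (s * t) + q 5 * t ^ 2 := by
    rintro y s t rfl
    simpa using hq' !₂[s, t]
  have e0 := hq x s t (by rw [← h2]; module)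
  have ea := hq a 0 0 (by module)
  have eb := hq b 1 0 (by module)
  have ec := hq c 0 1 (by module)
  have eab := hq (midpoint ℝ a b) (1 / 2) 0 (by rw [midpoint_eq_smul_add, invOf_eq_inv]; module)
  have eac := hq (midpoint ℝ a c) 0 (1 / 2) (by rw [midpoint_eq_smul_add, invOf_eq_inv]; module)
  have ebc := hq (midpoint ℝ b c) (1 / 2) (1 / 2)
    (by rw [midpoint_eq_smul_add, invOf_eq_inv]; module)
  -- The double sum meets every edge in both orders, so the coefficient 2 stands for the usual 4 of
  -- the edge bubble; the diagonal terms vanish.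
  rw [midpoint_comm b a, midpoint_comm c a, midpoint_comm c b]
  simp only [midpoint_self]
  rw [e0, eab, eac, ebc, ea, eb, ec]
  ring

end

noncomputable section

/-! ### Derivatives of the nodal representations -/

/-- The derivative of `dktForm`. -/
def dktDeriv (T : Finset Plane) (W : Plane → ℝ) (α : Plane → Plane → ℝ) (x : Plane) :
    Plane →L[ℝ] ℝ :=
  ∑ a ∈ T, W a • dbary T a +
    ∑ a ∈ T, ∑ b ∈ T, α a b •
      ((2 * (bary T a x * bary T b x)) • dbary T a + bary T a x ^ 2 • dbary T b) +
    (1 / 2 * ∑ a ∈ T, ∑ b ∈ T, α a b) • ∑ a ∈ T, (∏ z ∈ T.erase a, bary T z x) • dbary T a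

/-- The second derivative of `dktForm` in the directions `u` and `v`. -/
def dktDeriv₂ (T : Finset Plane) (α : Plane → Plane → ℝ) (x u v : Plane) : ℝ :=
  ∑ a ∈ T, ∑ b ∈ T, α a b *
      (2 * (bary T a x * dbary T b v + bary T b x * dbary T a v) * dbary T a u +
        2 * bary T a x * dbary T a v * dbary T b u) +
    (1 / 2 * ∑ a ∈ T, ∑ b ∈ T, α a b) *
      ∑ a ∈ T, (∑ z ∈ T.erase a, (∏ y ∈ (T.erase a).erase z, bary T y x) * dbary T z v) *
        dbary T a u

/-- The derivative of `gradForm` in the direction `v`. -/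
def gradFormDeriv (T : Finset Plane) (g : Plane → Plane) (δ : Plane → Plane → ℝ) (x v : Plane) :
    Plane :=
  ∑ a ∈ T, dbary T a v • g a +
    ∑ a ∈ T, ∑ b ∈ T, (3 * δ a b * (‖b - a‖ ^ 2)⁻¹ *
      (bary T a x * dbary T b v + bary T b x * dbary T a v)) • (b - a)

section

variable {T : Finset Plane} {W : Plane → ℝ} {α δ : Plane → Plane → ℝ} {g : Plane → Plane}

lemma polyFun_dktForm (hT : IsTri T) : PolyFun 3 (dktForm T W α) := by
  have hb := fun a => polyFun_bary T a
  refine PolyFun.add (PolyFun.add ?_ ?_) ?_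
  · exact PolyFun.sum _ fun a _ => ((hb a).mono (by norm_num)).const_mul _
  · exact PolyFun.sum _ fun a _ => PolyFun.sum _ fun b _ => (((hb a).pow 2).mul (hb b)).const_mul _
  · refine PolyFun.const_mul _ ?_
    rw [← hT.card]
    exact PolyFun.prod _ fun a _ => hb a

lemma polyFun_gradForm (i : Fin 2) : PolyFun 2 (fun x => gradForm T g δ x i) := by
  have hb := fun a => polyFun_bary T a
  simp only [gradForm, PiLp.add_apply, WithLp.ofLp_sum, WithLp.ofLp_smul, Finset.sum_apply,
    Pi.smul_apply, smul_eq_mul]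
  refine PolyFun.add ?_ ?_
  · exact PolyFun.sum _ fun a _ => ((hb a).mul_const _).mono (by norm_num)
  · exact PolyFun.sum _ fun a _ => PolyFun.sum _ fun b _ =>
      (((hb a).mul (hb b)).const_mul _).mul_const _

lemma hasFDerivAt_dktForm (x : Plane) :
    HasFDerivAt (dktForm T W α) (dktDeriv T W α x) x := by
  classical
  have hb := fun a => hasFDerivAt_bary T a x
  refine HasFDerivAt.add (HasFDerivAt.add ?_ ?_) ?_
  · exact HasFDerivAt.fun_sum fun a _ => (hb a).const_mul _
  · refine HasFDerivAt.fun_sum fun a _ => HasFDerivAt.fun_sum fun b _ => ?_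
    refine ((((hb a).pow 2).mul (hb b)).const_mul (α a b)).congr_fderiv ?_
    ext v
    simp
    ring
  · refine HasFDerivAt.const_mul ?_ _
    exact HasFDerivAt.finsetProd fun a _ => hb a

lemma hasFDerivAt_gradForm (x : Plane) : ∃ L : Plane →L[ℝ] Plane,
    HasFDerivAt (gradForm T g δ) L x ∧ ∀ v, L v = gradFormDeriv T g δ x v := by
  have hb := fun a => hasFDerivAt_bary T a x
  refine ⟨_, HasFDerivAt.add (HasFDerivAt.fun_sum fun a _ => (hb a).smul_const (g a))
    (HasFDerivAt.fun_sum fun a _ => HasFDerivAt.fun_sum fun b _ =>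
      (((hb a).mul (hb b)).const_mul _).smul_const (b - a)), fun v => ?_⟩
  simp [gradFormDeriv, mul_add]

lemma hasFDerivAt_dktDeriv (x u : Plane) : ∃ L : Plane →L[ℝ] ℝ,
    HasFDerivAt (fun y => dktDeriv T W α y u) L x ∧ ∀ v, L v = dktDeriv₂ T α x u v := by
  classical
  have hb := fun a => hasFDerivAt_bary T a x
  have h : (fun y => dktDeriv T W α y u) = fun y => ∑ a ∈ T, W a * dbary T a u +
    ∑ a ∈ T, ∑ b ∈ T, α a b *
      ((2 * (bary T a y * bary T b y)) * dbary T a u + bary T a y ^ 2 * dbary T b u) +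
    (1 / 2 * ∑ a ∈ T, ∑ b ∈ T, α a b) * ∑ a ∈ T, (∏ z ∈ T.erase a, bary T z y) * dbary T a u := by
    funext y
    simp [dktDeriv, mul_add]
  rw [h]
  refine ⟨_, HasFDerivAt.add (HasFDerivAt.add (hasFDerivAt_const _ _)
    (HasFDerivAt.fun_sum fun a _ => HasFDerivAt.fun_sum fun b _ =>
      (((((hb a).mul (hb b)).const_mul 2).mul_const (dbary T a u)).add
        (((hb a).pow 2).mul_const (dbary T b u))).const_mul (α a b)))
    (HasFDerivAt.const_mul (HasFDerivAt.fun_sum fun a _ => (HasFDerivAt.finsetProd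
      fun z _ => hb z).mul_const (dbary T a u)) _), fun v => ?_⟩
  simp only [dktDeriv₂, add_apply, zero_add, sum_apply, smul_apply, smul_eq_mul]
  congr 1
  · refine Finset.sum_congr rfl fun a _ => Finset.sum_congr rfl fun b _ => ?_
    simp [-mul_eq_mul_left_iff]
    ring
  · congr 1
    refine Finset.sum_congr rfl fun a _ => ?_
    rw [mul_comm]

/-- Derivative of the partition of unity. It permits subtracting a constant from nodal data, so that
only their differences enter derivative bounds. -/
lemma sum_dbary (hT : IsTri T) (v : Plane) : ∑ a ∈ T, dbary T a v = 0 := by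
  have h1 := hT.sum_bary 0
  have h2 := hT.sum_bary (0 + v)
  simp only [bary_add, Finset.sum_add_distrib, h1] at h2
  linarith

lemma abs_bary_le (hT : IsTri T) {x : Plane} (hx : x ∈ tri T) (a : Plane) : |bary T a x| ≤ 1 := by
  rw [abs_of_nonneg (hT.bary_nonneg hx a)]
  exact hT.bary_le_one hx a

lemma abs_prod_bary_le (hT : IsTri T) {x : Plane} (hx : x ∈ tri T) (s : Finset Plane) :
    |∏ z ∈ s, bary T z x| ≤ 1 := by
  rw [Finset.abs_prod]
  exact Finset.prod_le_one (fun _ _ => abs_nonneg _) fun z _ => abs_bary_le hT hx z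

lemma norm_sum_tri_le {E : Type*} [SeminormedAddCommGroup E] (hT : IsTri T) {f : Plane → E} {m : ℝ}
    (h : ∀ a ∈ T, ‖f a‖ ≤ m) : ‖∑ a ∈ T, f a‖ ≤ 3 * m := by
  refine (norm_sum_le_of_le T h).trans ?_
  simp [hT.card]

lemma abs_sum_tri_le (hT : IsTri T) {f : Plane → ℝ} {m : ℝ}
    (h : ∀ a ∈ T, |f a| ≤ m) : |∑ a ∈ T, f a| ≤ 3 * m := by
  simpa only [Real.norm_eq_abs] using norm_sum_tri_le hT (f := f) (m := m) h

variable {r m : ℝ} {x : Plane}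

lemma abs_dbary_le (hr : ∀ a, ‖dbary T a‖ ≤ r) (a u : Plane) : |dbary T a u| ≤ r * ‖u‖ :=
  ((dbary T a).le_opNorm u).trans (mul_le_mul_of_nonneg_right (hr a) (norm_nonneg _))

lemma abs_dktDeriv_le (hT : IsTri T) (hr : ∀ a, ‖dbary T a‖ ≤ r) (hx : x ∈ tri T)
    (hW : ∀ a ∈ T, ∀ b ∈ T, |W b - W a| ≤ m) (hα : ∀ a ∈ T, ∀ b ∈ T, |α a b| ≤ m) (u : Plane) :
    |dktDeriv T W α x u| ≤ 44 * m * r * ‖u‖ := by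
  classical
  obtain ⟨o, ho⟩ : T.Nonempty := Finset.card_pos.1 (by simp [hT.card])
  have hm : 0 ≤ m := (abs_nonneg _).trans (hα o ho o ho)
  set R := r * ‖u‖ with hR
  have hd := fun a => abs_dbary_le hr a u
  have hR0 : 0 ≤ R := (abs_nonneg _).trans (hd o)
  have hl := fun a => abs_bary_le hT hx a
  -- Values relative to one fixed vertex `o` may be used, because the derivatives of the barycentric
  -- coordinates sum to zero.
  have e1 : ∑ a ∈ T, W a * dbary T a u = ∑ a ∈ T, (W a - W o) * dbary T a u := by
    simp only [sub_mul, Finset.sum_sub_distrib, ← Finset.mul_sum, sum_dbary hT, mul_zero, sub_zero]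
  have b1 : |∑ a ∈ T, W a * dbary T a u| ≤ 3 * (m * R) := by
    rw [e1]
    refine abs_sum_tri_le hT fun a ha => ?_
    rw [abs_mul]
    exact mul_le_mul (hW o ho a ha) (hd a) (abs_nonneg _) hm
  have b2 : |∑ a ∈ T, ∑ b ∈ T, α a b *
      ((2 * (bary T a x * bary T b x)) * dbary T a u + bary T a x ^ 2 * dbary T b u)| ≤
      3 * (3 * (m * (3 * R))) := by
    refine abs_sum_tri_le hT fun a ha => abs_sum_tri_le hT fun b hb => ?_
    rw [abs_mul]
    refine mul_le_mul (hα a ha b hb) ?_ (abs_nonneg _) hm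
    have t1 : |2 * (bary T a x * bary T b x) * dbary T a u| ≤ 2 * (1 * 1) * R := by
      rw [abs_mul, abs_mul, abs_mul, abs_two]
      gcongr
      exacts [hl a, hl b, hd a]
    have t2 : |bary T a x ^ 2 * dbary T b u| ≤ 1 ^ 2 * R := by
      rw [abs_mul, abs_pow]
      gcongr
      exacts [hl a, hd b]
    refine (abs_add_le _ _).trans ?_
    linarith
  have b3 : |(1 / 2 * ∑ a ∈ T, ∑ b ∈ T, α a b) *
      ∑ a ∈ T, (∏ z ∈ T.erase a, bary T z x) * dbary T a u| ≤ (1 / 2 * (3 * (3 * m))) * (3 * R) := by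
    have t1 : |∑ a ∈ T, ∑ b ∈ T, α a b| ≤ 3 * (3 * m) :=
      abs_sum_tri_le hT fun a ha => abs_sum_tri_le hT fun b hb => hα a ha b hb
    have t2 : |∑ a ∈ T, (∏ z ∈ T.erase a, bary T z x) * dbary T a u| ≤ 3 * R := by
      refine abs_sum_tri_le hT fun a ha => ?_
      rw [abs_mul]
      calc _ ≤ 1 * R := mul_le_mul (abs_prod_bary_le hT hx _) (hd a) (abs_nonneg _) zero_le_one
        _ = R := one_mul R
    rw [abs_mul, abs_mul, abs_of_pos (by norm_num : (0 : ℝ) < 1 / 2)]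
    gcongr
  have e : dktDeriv T W α x u = ∑ a ∈ T, W a * dbary T a u +
    ∑ a ∈ T, ∑ b ∈ T, α a b *
      ((2 * (bary T a x * bary T b x)) * dbary T a u + bary T a x ^ 2 * dbary T b u) +
    (1 / 2 * ∑ a ∈ T, ∑ b ∈ T, α a b) * ∑ a ∈ T, (∏ z ∈ T.erase a, bary T z x) * dbary T a u := by
    simp [dktDeriv, mul_add]
  rw [e]
  have h0 : 0 ≤ m * R := mul_nonneg hm hR0
  -- The three groups contribute 3 + 27 + 27/2, which is below 44.
  calc _ ≤ 3 * (m * R) + 3 * (3 * (m * (3 * R))) + (1 / 2 * (3 * (3 * m))) * (3 * R) :=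
        (abs_add_three _ _ _).trans (by linarith)
    _ ≤ 44 * m * r * ‖u‖ := by rw [mul_assoc _ r, ← hR]; nlinarith

/-- The linear interpolant drops out, so only the excesses matter; each of the two derivatives costs
one factor `r`. The sum 54 + 81/2 is rounded up to 100. -/
lemma abs_dktDeriv₂_le (hT : IsTri T) (hr : ∀ a, ‖dbary T a‖ ≤ r) (hx : x ∈ tri T)
    (hα : ∀ a ∈ T, ∀ b ∈ T, |α a b| ≤ m) {u v : Plane} (hu : ‖u‖ ≤ 1) (hv : ‖v‖ ≤ 1) :
    |dktDeriv₂ T α x u v| ≤ 100 * m * r ^ 2 := by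
  classical
  obtain ⟨o, ho⟩ : T.Nonempty := Finset.card_pos.1 (by simp [hT.card])
  have hm : 0 ≤ m := (abs_nonneg _).trans (hα o ho o ho)
  have hr0 : 0 ≤ r := (norm_nonneg _).trans (hr o)
  have hd : ∀ a {w : Plane}, ‖w‖ ≤ 1 → |dbary T a w| ≤ r := fun a w hw =>
    (abs_dbary_le hr a w).trans (by nlinarith)
  have hl := fun a => abs_bary_le hT hx a
  have b2 : |∑ a ∈ T, ∑ b ∈ T, α a b *
      (2 * (bary T a x * dbary T b v + bary T b x * dbary T a v) * dbary T a u +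
        2 * bary T a x * dbary T a v * dbary T b u)| ≤ 3 * (3 * (m * (6 * (r * r)))) := by
    refine abs_sum_tri_le hT fun a ha => abs_sum_tri_le hT fun b hb => ?_
    rw [abs_mul]
    refine mul_le_mul (hα a ha b hb) ?_ (abs_nonneg _) hm
    have t1 : ∀ p q s : Plane, |bary T p x * dbary T q v * dbary T s u| ≤ 1 * r * r := by
      intro p q s
      rw [abs_mul, abs_mul]
      gcongr
      exacts [hl p, hd q hv, hd s hu]
    have s1 := t1 a b a
    have s2 := t1 b a a
    have s3 := t1 a a b
    rw [abs_le] at *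
    constructor <;> linarith
  have b3 : |(1 / 2 * ∑ a ∈ T, ∑ b ∈ T, α a b) *
      ∑ a ∈ T, (∑ z ∈ T.erase a, (∏ y ∈ (T.erase a).erase z, bary T y x) * dbary T z v) *
        dbary T a u| ≤ (1 / 2 * (3 * (3 * m))) * (3 * (3 * r * r)) := by
    have t1 : |∑ a ∈ T, ∑ b ∈ T, α a b| ≤ 3 * (3 * m) :=
      abs_sum_tri_le hT fun a ha => abs_sum_tri_le hT fun b hb => hα a ha b hb
    have t2 : |∑ a ∈ T, (∑ z ∈ T.erase a, (∏ y ∈ (T.erase a).erase z, bary T y x) * dbary T z v) *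
        dbary T a u| ≤ 3 * (3 * r * r) := by
      refine abs_sum_tri_le hT fun a ha => ?_
      rw [abs_mul]
      refine mul_le_mul ?_ (hd a hu) (abs_nonneg _) (by positivity)
      refine (Finset.abs_sum_le_sum_abs _ _).trans ?_
      calc ∑ z ∈ T.erase a, |(∏ y ∈ (T.erase a).erase z, bary T y x) * dbary T z v|
          ≤ ∑ z ∈ T.erase a, r := Finset.sum_le_sum fun z _ => by
            rw [abs_mul]
            calc _ ≤ 1 * r := mul_le_mul (abs_prod_bary_le hT hx _) (hd z hv) (abs_nonneg _)
                    zero_le_one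
              _ = r := one_mul r
        _ ≤ 3 * r := by
            rw [Finset.sum_const, nsmul_eq_mul]
            gcongr
            rw [Finset.card_erase_of_mem ha, hT.card]
            norm_num
    rw [abs_mul, abs_mul, abs_of_pos (by norm_num : (0 : ℝ) < 1 / 2)]
    gcongr
  have h0 : 0 ≤ m * (r * r) := by positivity
  calc |dktDeriv₂ T α x u v| ≤ 3 * (3 * (m * (6 * (r * r)))) +
        (1 / 2 * (3 * (3 * m))) * (3 * (3 * r * r)) := (abs_add_le _ _).trans (add_le_add b2 b3)
    _ ≤ 100 * m * r ^ 2 := by nlinarith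

/-- An excess proportional to the edge length compensates the inverse square of that length against
the edge vector. Thus no lower bound on edge lengths is needed. -/
lemma norm_edge_smul_le (hm : 0 ≤ m) {a b : Plane} {s q : ℝ} (hs : |s| ≤ q) (hδ : |δ a b| ≤ m * ‖b - a‖) :
    ‖(3 * δ a b * (‖b - a‖ ^ 2)⁻¹ * s) • (b - a)‖ ≤ 3 * m * q := by
  by_cases hab : b = a
  · subst hab
    simpa using mul_nonneg (mul_nonneg zero_le_three hm) ((abs_nonneg _).trans hs)
  have hn : 0 < ‖b - a‖ := norm_pos_iff.2 (sub_ne_zero.2 hab)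
  rw [norm_smul, Real.norm_eq_abs, abs_mul, abs_mul, abs_mul, abs_inv, abs_of_pos (pow_pos hn 2),
    abs_of_pos (by norm_num : (0 : ℝ) < 3)]
  calc 3 * |δ a b| * (‖b - a‖ ^ 2)⁻¹ * |s| * ‖b - a‖
      ≤ 3 * (m * ‖b - a‖) * (‖b - a‖ ^ 2)⁻¹ * q * ‖b - a‖ := by
        gcongr
    _ = 3 * m * q := by field_simp

lemma norm_gradForm_le (hT : IsTri T) (hx : x ∈ tri T) (hg : ∀ a ∈ T, ‖g a‖ ≤ m)
    (hδ : ∀ a ∈ T, ∀ b ∈ T, |δ a b| ≤ m * ‖b - a‖) :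
    ‖gradForm T g δ x‖ ≤ 30 * m := by
  obtain ⟨o, ho⟩ : T.Nonempty := Finset.card_pos.1 (by simp [hT.card])
  have hm : 0 ≤ m := (norm_nonneg _).trans (hg o ho)
  have hl := fun a => abs_bary_le hT hx a
  have b1 : ‖∑ a ∈ T, bary T a x • g a‖ ≤ 3 * (1 * m) := norm_sum_tri_le hT fun a ha => by
    rw [norm_smul]
    exact mul_le_mul (hl a) (hg a ha) (norm_nonneg _) zero_le_one
  have b2 : ‖∑ a ∈ T, ∑ b ∈ T, (3 * δ a b * (‖b - a‖ ^ 2)⁻¹ * (bary T a x * bary T b x)) •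
      (b - a)‖ ≤ 3 * (3 * (3 * m * (1 * 1))) :=
    norm_sum_tri_le hT fun a ha => norm_sum_tri_le hT fun b hb =>
      norm_edge_smul_le hm (by
        rw [abs_mul]; exact mul_le_mul (hl a) (hl b) (abs_nonneg _) zero_le_one) (hδ a ha b hb)
  refine (norm_add_le _ _).trans ?_
  linarith

lemma norm_gradFormDeriv_le (hT : IsTri T) (hr : ∀ a, ‖dbary T a‖ ≤ r) (hx : x ∈ tri T)
    (hg : ∀ a ∈ T, ∀ b ∈ T, ‖g b - g a‖ ≤ m)
    (hδ : ∀ a ∈ T, ∀ b ∈ T, |δ a b| ≤ m * ‖b - a‖) (v : Plane) :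
    ‖gradFormDeriv T g δ x v‖ ≤ 60 * m * r * ‖v‖ := by
  obtain ⟨o, ho⟩ : T.Nonempty := Finset.card_pos.1 (by simp [hT.card])
  have hm : 0 ≤ m := (norm_nonneg _).trans (hg o ho o ho)
  have hl := fun a => abs_bary_le hT hx a
  set R := r * ‖v‖ with hR
  have hd := fun a => abs_dbary_le hr a v
  have hR0 : 0 ≤ R := (abs_nonneg _).trans (hd o)
  -- Again only nodal differences matter, since `dbary` sums to zero over the vertices.
  have e1 : ∑ a ∈ T, dbary T a v • g a = ∑ a ∈ T, dbary T a v • (g a - g o) := by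
    simp only [smul_sub, Finset.sum_sub_distrib, ← Finset.sum_smul, sum_dbary hT, zero_smul,
      sub_zero]
  have b1 : ‖∑ a ∈ T, dbary T a v • g a‖ ≤ 3 * (R * m) := by
    rw [e1]
    refine norm_sum_tri_le hT fun a ha => ?_
    rw [norm_smul]
    exact mul_le_mul (hd a) (hg o ho a ha) (norm_nonneg _) hR0
  have b2 : ‖∑ a ∈ T, ∑ b ∈ T, (3 * δ a b * (‖b - a‖ ^ 2)⁻¹ *
      (bary T a x * dbary T b v + bary T b x * dbary T a v)) • (b - a)‖ ≤
      3 * (3 * (3 * m * (2 * R))) :=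
    norm_sum_tri_le hT fun a ha => norm_sum_tri_le hT fun b hb =>
      norm_edge_smul_le hm (by
        refine (abs_add_le _ _).trans ?_
        rw [abs_mul, abs_mul]
        have := mul_le_mul (hl a) (hd b) (abs_nonneg _) zero_le_one
        have := mul_le_mul (hl b) (hd a) (abs_nonneg _) zero_le_one
        linarith) (hδ a ha b hb)
  have h0 : 0 ≤ m * R := mul_nonneg hm hR0
  refine (norm_add_le _ _).trans ?_
  rw [mul_assoc _ r, ← hR]
  nlinarith

end

end

noncomputable section

/-! ### Discrete Kirchhoff functions and discrete gradients on one triangle -/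

section

variable {T : Finset Plane} {w : Plane → ℝ} {θ : Plane → Plane} {x a b : Plane}

/-- A nondegenerate triangle has unique differentials at all its points, vertices included, so the
one-sided gradient is that of any differentiable extension. -/
lemma gradT_eq (hT : IsTri T) {P : Plane → ℝ} (h : Set.EqOn w P (tri T))
    (hP : Differentiable ℝ P) (hx : x ∈ tri T) : gradT w T x = gradient P x := by
  rw [gradT, gradientWithin, gradient, fderivWithin_congr h (h hx),
    (hP x).fderivWithin (hT.uniqueDiffOn_tri x hx)]

lemma jacT_eq (hT : IsTri T) {F : Plane → Plane} (h : Set.EqOn θ F (tri T)) {L : Plane →L[ℝ] Plane}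
    (hF : HasFDerivAt F L x) (hx : x ∈ tri T) (p : Fin 2 × Fin 2) :
    jacT θ T x p = L (EuclideanSpace.single p.2 1) p.1 := by
  rw [jacT, fderivWithin_congr h (h hx),
    hF.hasFDerivWithinAt.fderivWithin (hT.uniqueDiffOn_tri x hx)]

lemma midpoint_mem_tri (ha : a ∈ T) (hb : b ∈ T) : midpoint ℝ a b ∈ tri T :=
  (IsTri.convex_tri T).midpoint_mem (IsTri.vertex_mem ha) (IsTri.vertex_mem hb)

lemma center_mem_tri (hT : IsTri T) : center T ∈ tri T := by
  rw [tri, Finset.convexHull_eq]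
  refine ⟨fun _ => 1 / 3, fun _ _ => by norm_num, by simp [hT.card], ?_⟩
  rw [Finset.centerMass_eq_of_sum_1 _ _ (by simp [hT.card]), center, Finset.smul_sum]
  rfl

lemma dktForm_congr {W W' : Plane → ℝ} {α α' : Plane → Plane → ℝ}
    (hW : ∀ a ∈ T, W a = W' a) (hα : ∀ a ∈ T, ∀ b ∈ T, α a b = α' a b) (x : Plane) :
    dktForm T W α x = dktForm T W' α' x := by
  rw [dktForm, dktForm, Finset.sum_congr rfl fun a ha => Finset.sum_congr rfl fun b hb => by
    rw [hα a ha b hb], Finset.sum_congr rfl fun a ha => by rw [hW a ha],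
    Finset.sum_congr rfl fun a ha => Finset.sum_congr rfl fun b hb => hα a ha b hb]

lemma hermiteExcess_congr {W W' : Plane → ℝ} {g g' : Plane → Plane}
    (hW : ∀ a ∈ T, W a = W' a) (hg : ∀ a ∈ T, g a = g' a) (ha : a ∈ T) (hb : b ∈ T) :
    hermiteExcess W g a b = hermiteExcess W' g' a b := by
  rw [hermiteExcess, hermiteExcess, hW a ha, hW b hb, hg a ha]

lemma trapezoidExcess_congr {W W' : Plane → ℝ} {g g' : Plane → Plane}
    (hW : ∀ a ∈ T, W a = W' a) (hg : ∀ a ∈ T, g a = g' a) (ha : a ∈ T) (hb : b ∈ T) :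
    trapezoidExcess W g a b = trapezoidExcess W' g' a b := by
  rw [trapezoidExcess, trapezoidExcess, hW a ha, hW b hb, hg a ha, hg b hb]

/-- A function of the reduced cubic space is given by its nodal values and gradients. -/
lemma IsReducedCubicOn.eqOn_dktForm (hT : IsTri T) (hw : IsReducedCubicOn T w) :
    Set.EqOn w (dktForm T w (hermiteExcess w (gradT w T))) (tri T) := by
  obtain ⟨hp, hred⟩ := hw
  obtain ⟨P, hP, h⟩ := hp.exists_polyFun
  have hg := fun {x} (hx : x ∈ tri T) => gradT_eq hT h hP.differentiable hx
  intro x hx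
  have hW : ∀ a ∈ T, P a = w a := fun a ha => (h (IsTri.vertex_mem ha)).symm
  have hG : ∀ a ∈ T, gradient P a = gradT w T a := fun a ha => (hg (IsTri.vertex_mem ha)).symm
  rw [h hx, hP.eq_dktForm hT ?_ x]
  · exact dktForm_congr hW (fun a ha b hb => hermiteExcess_congr hW hG ha hb) x
  · rw [← h (center_mem_tri hT), hred]
    congr 1
    exact Finset.sum_congr rfl fun z hz => by rw [hW z hz, hG z hz]

lemma IsReducedCubicOn.inner_gradT (hT : IsTri T) (hw : IsReducedCubicOn T w) (hx : x ∈ tri T)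
    (u : Plane) :
    inner ℝ (gradT w T x) u = dktDeriv T w (hermiteExcess w (gradT w T)) x u := by
  rw [gradT_eq hT (hw.eqOn_dktForm hT) (polyFun_dktForm hT).differentiable hx, inner_gradient_eq,
    (hasFDerivAt_dktForm x).fderiv]

lemma inner_single_right (v : Plane) (i : Fin 2) :
    inner ℝ v (EuclideanSpace.single i 1) = v i := by
  rw [EuclideanSpace.inner_single_right]
  simp

lemma IsReducedCubicOn.gradT_apply (hT : IsTri T) (hw : IsReducedCubicOn T w) (hx : x ∈ tri T)
    (i : Fin 2) :
    gradT w T x i =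
      dktDeriv T w (hermiteExcess w (gradT w T)) x (EuclideanSpace.single i 1) := by
  rw [← hw.inner_gradT hT hx, inner_single_right]

lemma hasFDerivAt_plane {F : Plane → Plane} {L : Fin 2 → Plane →L[ℝ] ℝ}
    (h : ∀ i, HasFDerivAt (fun y => F y i) (L i) x) :
    ∃ L' : Plane →L[ℝ] Plane, HasFDerivAt F L' x ∧ ∀ v i, L' v i = L i v := by
  refine ⟨(EuclideanSpace.equiv (Fin 2) ℝ).symm.toContinuousLinearMap ∘L ContinuousLinearMap.pi L,
    ?_, fun v i => by simp⟩
  rw [← hasFDerivWithinAt_univ, hasFDerivWithinAt_piLp]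
  intro i
  rw [hasFDerivWithinAt_univ]
  refine (h i).congr_fderiv ?_
  ext v
  simp

lemma IsReducedCubicOn.hasFDerivAt_grad (hT : IsTri T) (hw : IsReducedCubicOn T w) :
    ∃ F : Plane → Plane, Set.EqOn (gradT w T) F (tri T) ∧ ∀ x, ∃ L : Plane →L[ℝ] Plane,
      HasFDerivAt F L x ∧ ∀ v i, L v i =
        dktDeriv₂ T (hermiteExcess w (gradT w T)) x (EuclideanSpace.single i 1) v := by
  refine ⟨fun y => WithLp.toLp 2 fun i =>
    dktDeriv T w (hermiteExcess w (gradT w T)) y (EuclideanSpace.single i 1), fun x hx => ?_,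
    fun x => ?_⟩
  · ext i
    exact hw.gradT_apply hT hx i
  · choose L hL hL' using fun i : Fin 2 => hasFDerivAt_dktDeriv (T := T) (W := w)
      (α := hermiteExcess w (gradT w T)) x (EuclideanSpace.single i 1)
    obtain ⟨L', h1, h2⟩ := hasFDerivAt_plane (F := fun y => WithLp.toLp 2 fun i =>
      dktDeriv T w (hermiteExcess w (gradT w T)) y (EuclideanSpace.single i 1)) hL
    exact ⟨L', h1, fun v i => by rw [h2, hL']⟩

lemma IsReducedCubicOn.hessT_apply (hT : IsTri T) (hw : IsReducedCubicOn T w) (hx : x ∈ tri T)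
    (p : Fin 2 × Fin 2) :
    hessT w T x p = dktDeriv₂ T (hermiteExcess w (gradT w T)) x
      (EuclideanSpace.single p.1 1) (EuclideanSpace.single p.2 1) := by
  obtain ⟨F, hF, h⟩ := hw.hasFDerivAt_grad hT
  obtain ⟨L, hL, hL'⟩ := h x
  rw [hessT, jacT_eq hT hF hL hx, hL']

lemma jacT_gradForm (hT : IsTri T) {g : Plane → Plane} {δ : Plane → Plane → ℝ}
    (hθ : Set.EqOn θ (gradForm T g δ) (tri T)) (hx : x ∈ tri T) (p : Fin 2 × Fin 2) :
    jacT θ T x p = gradFormDeriv T g δ x (EuclideanSpace.single p.2 1) p.1 := by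
  obtain ⟨L, hL, hL'⟩ := hasFDerivAt_gradForm (T := T) (g := g) (δ := δ) x
  rw [jacT_eq hT hθ hL hx, hL']

lemma polyFun_dktDeriv (hT : IsTri T) (W : Plane → ℝ) (α : Plane → Plane → ℝ) (u : Plane) :
    PolyFun 2 (fun x => dktDeriv T W α x u) := by
  classical
  have hb := fun a => polyFun_bary T a
  have h : (fun y => dktDeriv T W α y u) = fun y => ∑ a ∈ T, W a * dbary T a u +
    ∑ a ∈ T, ∑ b ∈ T, α a b *
      ((2 * (bary T a y * bary T b y)) * dbary T a u + bary T a y ^ 2 * dbary T b u) +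
    (1 / 2 * ∑ a ∈ T, ∑ b ∈ T, α a b) * ∑ a ∈ T, (∏ z ∈ T.erase a, bary T z y) * dbary T a u := by
    funext y
    simp [dktDeriv, mul_add]
  rw [h]
  refine ((PolyFun.const _).add ?_).add ?_
  · exact PolyFun.sum _ fun a _ => PolyFun.sum _ fun b _ =>
      (((((hb a).mul (hb b)).const_mul 2).mul_const _).add (((hb a).pow 2).mul_const _)).const_mul _
  · refine PolyFun.const_mul _ (PolyFun.sum _ fun a ha => PolyFun.mul_const _ ?_)
    refine (PolyFun.prod _ fun z _ => hb z).mono ?_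
    rw [Finset.card_erase_of_mem ha, hT.card]

lemma polyFun_dktDeriv₂ (hT : IsTri T) (α : Plane → Plane → ℝ) (u v : Plane) :
    PolyFun 2 (fun x => dktDeriv₂ T α x u v) := by
  classical
  have hb := fun a => polyFun_bary T a
  -- Second derivatives are affine; the degree is raised to two so that one inverse estimate serves
  -- all fields.
  refine PolyFun.mono (PolyFun.add ?_ ?_) one_le_two
  · refine PolyFun.sum _ fun a _ => PolyFun.sum _ fun b _ => PolyFun.const_mul _ ?_
    exact (((((hb a).mul_const _).add ((hb b).mul_const _)).const_mul 2).mul_const _).add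
      ((((hb a).const_mul 2).mul_const _).mul_const _)
  · refine PolyFun.const_mul _ (PolyFun.sum _ fun a ha => PolyFun.mul_const _
      (PolyFun.sum _ fun z hz => PolyFun.mul_const _ ?_))
    refine (PolyFun.prod _ fun z _ => hb z).mono ?_
    simp [Finset.card_erase_of_mem hz, Finset.card_erase_of_mem ha, hT.card]

lemma polyFun_gradFormDeriv (g : Plane → Plane) (δ : Plane → Plane → ℝ) (v : Plane) (i : Fin 2) :
    PolyFun 2 (fun x => gradFormDeriv T g δ x v i) := by
  have hb := fun a => polyFun_bary T a
  simp only [gradFormDeriv, PiLp.add_apply, WithLp.ofLp_sum, WithLp.ofLp_smul, Finset.sum_apply,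
    Pi.smul_apply, smul_eq_mul]
  refine PolyFun.mono ((PolyFun.const _).add ?_) one_le_two
  exact PolyFun.sum _ fun a _ => PolyFun.sum _ fun b _ =>
      ((((hb a).mul_const _).add ((hb b).mul_const _)).const_mul _).mul_const _

/-! ### Characterization of the discrete gradient on a triangle -/

/-- A plane vector with prescribed components along and across `e`. -/
lemma eq_smul_of_inner {u e : Plane} {r : ℝ} (h1 : inner ℝ u e = r * ‖e‖ ^ 2)
    (h2 : ∀ n : Plane, ‖n‖ = 1 → inner ℝ n e = 0 → inner ℝ u n = 0) : u = r • e := by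
  by_contra hne
  set d := u - r • e with hd
  have hd0 : d ≠ 0 := sub_ne_zero.2 hne
  have hde : inner ℝ d e = 0 := by
    rw [hd, inner_sub_left, h1, inner_smul_left, real_inner_self_eq_norm_sq]
    simp
  -- The part of `u` orthogonal to `e`, if nonzero, would itself provide a unit normal on which `u`
  -- does not vanish.
  have hn := h2 (‖d‖⁻¹ • d) (norm_smul_inv_norm hd0) (by rw [inner_smul_left, hde, mul_zero])
  have hud : inner ℝ u d = ‖d‖ ^ 2 := by
    have : u = d + r • e := by rw [hd]; abel
    rw [this, inner_add_left, inner_smul_left, real_inner_self_eq_norm_sq, real_inner_comm, hde]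
    simp
  rw [inner_smul_right, hud] at hn
  have : ‖d‖ ≠ 0 := norm_ne_zero_iff.2 hd0
  field_simp at hn
  exact this hn

lemma gradT_midpoint (hT : IsTri T) (hw : IsPolyOn 3 (tri T) w) (ha : a ∈ T) (hb : b ∈ T) :
    inner ℝ (gradT w T (midpoint ℝ a b)) (b - a) =
      1 / 2 * inner ℝ (gradT w T a + gradT w T b) (b - a) +
        3 / 2 * trapezoidExcess w (gradT w T) a b := by
  obtain ⟨P, hP, h⟩ := hw.exists_polyFun
  have hg := fun {x} (hx : x ∈ tri T) => gradT_eq hT h hP.differentiable hx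
  have hW : ∀ a ∈ T, w a = P a := fun a ha => h (IsTri.vertex_mem ha)
  have hG : ∀ a ∈ T, gradT w T a = gradient P a := fun a ha => hg (IsTri.vertex_mem ha)
  rw [hg (midpoint_mem_tri ha hb), trapezoidExcess_congr hW hG ha hb, hG a ha, hG b hb,
    hP.inner_gradient_midpoint]

/-- A quadratic field with the defining properties of the discrete gradient is given by the
nodal formula. -/
lemma eqOn_gradForm (hT : IsTri T) (hw : IsPolyOn 3 (tri T) w)
    (hθ : ∀ i : Fin 2, IsPolyOn 2 (tri T) (fun x => θ x i))
    (hv : ∀ z ∈ T, θ z = gradT w T z)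
    (ht : ∀ a ∈ T, ∀ b ∈ T, a ≠ b → inner ℝ (θ (midpoint ℝ a b)) (‖b - a‖⁻¹ • (b - a)) =
      inner ℝ (gradT w T (midpoint ℝ a b)) (‖b - a‖⁻¹ • (b - a)))
    (hn : ∀ a ∈ T, ∀ b ∈ T, a ≠ b → ∀ n : Plane, ‖n‖ = 1 → inner ℝ n (b - a) = 0 →
      inner ℝ (θ (midpoint ℝ a b)) n = (1 / 2) * inner ℝ (gradT w T a + gradT w T b) n) :
    Set.EqOn θ (gradForm T (gradT w T) (trapezoidExcess w (gradT w T))) (tri T) := by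
  -- The deviation from the mean of the end point gradients has no normal component by the normal
  -- condition; its tangential component is the midpoint formula for cubics.
  have key : ∀ a ∈ T, ∀ b ∈ T, θ (midpoint ℝ a b) - (1 / 2 : ℝ) • (gradT w T a + gradT w T b) =
      (3 / 2 * trapezoidExcess w (gradT w T) a b * (‖b - a‖ ^ 2)⁻¹) • (b - a) := by
    intro a ha b hb
    by_cases hab : a = b
    · subst hab
      rw [midpoint_self, hv a ha, sub_self a, smul_zero]
      module
    have hne : b - a ≠ 0 := sub_ne_zero.2 (Ne.symm hab)
    have hn0 : ‖b - a‖ ≠ 0 := norm_ne_zero_iff.2 hne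
    refine eq_smul_of_inner ?_ fun n hn1 hn2 => ?_
    · have := ht a ha b hb hab
      rw [inner_smul_right, inner_smul_right] at this
      have := mul_left_cancel₀ (inv_ne_zero hn0) this
      rw [inner_sub_left, this, gradT_midpoint hT hw ha hb, inner_smul_left]
      have h2 : (starRingEnd ℝ) (1 / 2) = 1 / 2 := by simp
      rw [h2]
      field_simp
      ring
    · rw [inner_sub_left, hn a ha b hb hab n hn1 hn2, inner_smul_left]
      simp
  intro x hx
  ext i
  obtain ⟨P, hP, h⟩ := (hθ i).exists_polyFun
  have e : θ x i = P x := h hx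
  rw [e, hP.eq_quadratic_nodal hT x, gradForm]
  simp only [PiLp.add_apply, WithLp.ofLp_sum, WithLp.ofLp_smul, Finset.sum_apply,
    Pi.smul_apply, smul_eq_mul]
  congr 1
  · exact Finset.sum_congr rfl fun a ha => by
      rw [← h (IsTri.vertex_mem ha)]
      simp only [hv a ha]
  · refine Finset.sum_congr rfl fun a ha => Finset.sum_congr rfl fun b hb => ?_
    have := congrArg (fun v : Plane => v i) (key a ha b hb)
    simp only [PiLp.sub_apply, PiLp.smul_apply, PiLp.add_apply, smul_eq_mul] at this
    rw [← h (IsTri.vertex_mem ha), ← h (IsTri.vertex_mem hb), ← h (midpoint_mem_tri ha hb)]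
    simp only []
    rw [hv a ha, hv b hb, this, PiLp.sub_apply]
    ring

lemma IsDiscreteGradient.eqOn_gradForm {ω : Set Plane} {K : SimplicialComplex ℝ Plane}
    (hw : IsDKT ω K w) (hθ : IsDiscreteGradient ω K w θ) (hT : T ∈ triangles K) :
    Set.EqOn θ (gradForm T (gradT w T) (trapezoidExcess w (gradT w T))) (tri T) :=
  _root_.eqOn_gradForm (isTri_of_mem_triangles hT) (hw.reducedCubic T hT).1 (hθ.mem.quadratic T hT)
    (hθ.vertex T hT) (hθ.tangential T hT) (hθ.normal T hT)

section

variable {W : Plane → ℝ} {g : Plane → Plane} {α δ : Plane → Plane → ℝ}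

lemma gradForm_vertex (hT : IsTri T) (ha : a ∈ T) : gradForm T g δ a = g a := by
  classical
  have h : ∀ z ∈ T, bary T z a = if z = a then 1 else 0 := fun z hz => hT.bary_vertex ha hz
  rw [gradForm, Finset.sum_congr rfl fun z hz => by rw [h z hz],
    Finset.sum_congr rfl fun z hz => Finset.sum_congr rfl fun y hy => by rw [h z hz, h y hy]]
  simp only [ite_smul, one_smul, zero_smul, Finset.sum_ite_eq', ha, if_true]
  rw [add_eq_left]
  refine Finset.sum_eq_zero fun y _ => Finset.sum_eq_zero fun z _ => ?_
  by_cases h1 : y = a <;> by_cases h2 : z = a <;> simp [h1, h2]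

/-- Among the cubic terms only the cube of λ_a survives at `a`, and its coefficient is a diagonal
excess, hence zero. -/
lemma dktForm_vertex (hT : IsTri T) (hα : ∀ a, α a a = 0) (ha : a ∈ T) :
    dktForm T W α a = W a := by
  classical
  have h : ∀ z ∈ T, bary T z a = if z = a then 1 else 0 := fun z hz => hT.bary_vertex ha hz
  obtain ⟨c, hc, hca⟩ : ∃ c ∈ T, c ≠ a :=
    Finset.exists_mem_ne (by rw [hT.card]; norm_num) a
  rw [dktForm, Finset.prod_eq_zero hc (by rw [h c hc, if_neg hca]),
    Finset.sum_congr rfl fun z hz => by rw [h z hz],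
    Finset.sum_congr rfl fun z hz => Finset.sum_congr rfl fun y hy => by rw [h z hz, h y hy]]
  simp only [mul_ite, mul_one, mul_zero, Finset.sum_ite_eq', ha, if_true, add_zero]
  rw [add_eq_left]
  refine Finset.sum_eq_zero fun y _ => ?_
  by_cases h1 : y = a <;> simp [h1, hα]

lemma bary_midpoint (T : Finset Plane) (z a b : Plane) :
    bary T z (midpoint ℝ a b) = 1 / 2 * (bary T z a + bary T z b) := by
  rw [AffineMap.map_midpoint, midpoint_eq_smul_add, invOf_eq_inv, smul_eq_mul]
  norm_num

/-- The product of the two barycentric coordinates is 1/4 at the midpoint, and the two orders of the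
edge add up because excess and edge vector both change sign: 2 · 3 · 1/4 = 3/2. -/
lemma gradForm_midpoint (hT : IsTri T) (hδ : ∀ a b, δ b a = -δ a b) (ha : a ∈ T) (hb : b ∈ T) :
    gradForm T g δ (midpoint ℝ a b) = (1 / 2 : ℝ) • (g a + g b) +
      (3 / 2 * δ a b * (‖b - a‖ ^ 2)⁻¹) • (b - a) := by
  classical
  by_cases hab : a = b
  · subst hab
    rw [midpoint_self, gradForm_vertex hT ha, sub_self, smul_zero]
    module
  obtain ⟨c, hc⟩ : ∃ c, T = {a, b, c} ∧ a ≠ c ∧ b ≠ c := by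
    obtain ⟨p, q, r, hpq, hpr, hqr, rfl⟩ := hT.exists_triple
    simp only [Finset.mem_insert, Finset.mem_singleton] at ha hb
    rcases ha with rfl | rfl | rfl <;> rcases hb with rfl | rfl | rfl
    all_goals first
      | exact absurd rfl hab
      | exact ⟨p, by grind⟩
      | exact ⟨q, by grind⟩
      | exact ⟨r, by grind⟩
  obtain ⟨rfl, hac, hbc⟩ := hc
  simp only [gradForm, bary_midpoint, sum_triple hab hac hbc]
  have hcm : c ∈ ({a, b, c} : Finset Plane) := by simp
  rw [hT.bary_vertex ha ha, hT.bary_vertex hb hb, hT.bary_vertex ha hb, hT.bary_vertex hb ha,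
    hT.bary_vertex ha hcm, hT.bary_vertex hb hcm]
  simp only [if_true, hab, hac.symm, hbc.symm, Ne.symm hab, if_false, hδ a b, norm_sub_rev a b]
  simp only [sub_self, smul_zero]
  module

lemma trapezoidExcess_symm (W : Plane → ℝ) (g : Plane → Plane) (a b : Plane) :
    trapezoidExcess W g b a = -trapezoidExcess W g a b := by
  rw [trapezoidExcess_eq, trapezoidExcess_eq]
  ring

lemma sum_dbary_smul (hT : IsTri T) (a v : Plane) : ∑ b ∈ T, dbary T b v • (b - a) = v := by
  have h1 := hT.sum_bary_smul 0
  have h2 := hT.sum_bary_smul (0 + v)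
  simp only [bary_add, add_smul, Finset.sum_add_distrib, h1] at h2
  rw [zero_add, zero_add] at h2
  simp only [smul_sub, Finset.sum_sub_distrib, h2, ← Finset.sum_smul, sum_dbary hT, zero_smul,
    sub_zero]

/-- The vectors from `a` to the vertices span the plane, with the values of `dbary` as coefficients.
-/
lemma eq_of_inner_edges (hT : IsTri T) {p q : Plane} (a : Plane)
    (h : ∀ b ∈ T, inner ℝ p (b - a) = inner ℝ q (b - a)) : p = q := by
  refine ext_inner_right ℝ fun v => ?_
  rw [← sum_dbary_smul hT a v, inner_sum, inner_sum]
  exact Finset.sum_congr rfl fun b hb => by rw [inner_smul_right, inner_smul_right, h b hb]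

/-- Along `b - a` the linear part contributes `W b - W a` and λ_a²λ_b contributes the excess; their
sum is the prescribed derivative. The remaining cubic terms, except the vanishing diagonal one, have
zero derivative at `a` in this direction. -/
lemma gradient_dktForm_vertex (hT : IsTri T) (ha : a ∈ T) :
    gradient (dktForm T W (hermiteExcess W g)) a = g a := by
  classical
  refine eq_of_inner_edges hT a fun b hb => ?_
  rw [inner_gradient_eq, (hasFDerivAt_dktForm a).fderiv]
  by_cases hab : a = b
  · simp [hab]
  obtain ⟨c, hc⟩ : ∃ c, T = {a, b, c} ∧ a ≠ c ∧ b ≠ c := by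
    obtain ⟨p, q, r, hpq, hpr, hqr, rfl⟩ := hT.exists_triple
    simp only [Finset.mem_insert, Finset.mem_singleton] at ha hb
    rcases ha with rfl | rfl | rfl <;> rcases hb with rfl | rfl | rfl
    all_goals first
      | exact absurd rfl hab
      | exact ⟨p, by grind⟩
      | exact ⟨q, by grind⟩
      | exact ⟨r, by grind⟩
  obtain ⟨rfl, hac, hbc⟩ := hc
  have hcm : c ∈ ({a, b, c} : Finset Plane) := by simp
  have e1 : ({a, b, c} : Finset Plane).erase a = {b, c} := by grind
  have e2 : ({a, b, c} : Finset Plane).erase b = {a, c} := by grind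
  have e3 : ({a, b, c} : Finset Plane).erase c = {a, b} := by grind
  simp only [dktDeriv, sum_triple hab hac hbc, e1, e2, e3, Finset.prod_pair hbc,
    Finset.prod_pair hac, Finset.prod_pair hab]
  simp only [add_apply, smul_apply, smul_eq_mul, bary_sub]
  rw [hT.bary_vertex ha ha, hT.bary_vertex hb hb, hT.bary_vertex ha hb, hT.bary_vertex hb ha,
    hT.bary_vertex ha hcm, hT.bary_vertex hb hcm]
  simp only [if_true, hab, hac.symm, hbc.symm, Ne.symm hab, if_false, hermiteExcess_self]
  simp only [hermiteExcess]
  ring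

lemma bary_center (hT : IsTri T) (ha : a ∈ T) : bary T a (center T) = 1 / 3 :=
  hT.bary_eq_of_sum (c := fun _ => 1 / 3) (by simp [hT.card])
    (by rw [center, Finset.smul_sum]) ha

/-- The nodal formula defines an element of the reduced cubic space. -/
lemma isReducedCubicOn_of_eqOn (hT : IsTri T)
    (h : Set.EqOn w (dktForm T W (hermiteExcess W g)) (tri T)) :
    IsReducedCubicOn T w ∧ ∀ z ∈ T, w z = W z ∧ gradT w T z = g z := by
  classical
  have hz : ∀ z ∈ T, w z = W z ∧ gradT w T z = g z := fun z hz =>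
    ⟨(h (IsTri.vertex_mem hz)).trans (dktForm_vertex hT (hermiteExcess_self W g) hz), by
      rw [gradT_eq hT h (polyFun_dktForm hT).differentiable (IsTri.vertex_mem hz),
        gradient_dktForm_vertex hT hz]⟩
  refine ⟨⟨?_, ?_⟩, hz⟩
  · obtain ⟨p, hp, h'⟩ := (polyFun_dktForm hT (W := W) (α := hermiteExcess W g)).isPolyOn (tri T)
    exact ⟨p, hp, fun x hx => (h hx).trans (h' x hx)⟩
  · rw [h (center_mem_tri hT), dktForm, Finset.prod_congr rfl fun z hz => bary_center hT hz,
      Finset.sum_congr rfl fun z hz => by rw [bary_center hT hz],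
      Finset.sum_congr rfl fun z hz => Finset.sum_congr rfl fun y hy => by
        rw [bary_center hT hz, bary_center hT hy]]
    have e : ∑ z ∈ T, (2 * w z - inner ℝ (gradT w T z) (z - center T)) =
        ∑ z ∈ T, (2 * W z - inner ℝ (g z) (z - center T)) :=
      Finset.sum_congr rfl fun z h => by rw [(hz z h).1, (hz z h).2]
    rw [e]
    obtain ⟨a, b, c, hab, hac, hbc, rfl⟩ := hT.exists_triple
    -- In the sum of all excesses the value differences cancel in pairs. What remains matches the
    -- constraint, since `z - center T` is minus one third of the sum of the edges leaving `z`.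
    simp only [center, sum_triple hab hac hbc, prod_triple hab hac hbc, hermiteExcess_self]
    simp only [hermiteExcess, inner_sub_right, inner_smul_right, inner_add_right]
    ring

end

end

end

noncomputable section

/-! ### Uniform estimates on a shape regular triangle -/

/-- A triangle of diameter at most `κ * ρ` which contains a disc of radius `ρ` about `c`. -/
structure IsRegTri (κ : ℝ) (T : Finset Plane) (c : Plane) (ρ : ℝ) : Prop extends IsTri T where
  pos : 0 < ρ
  ball : Metric.closedBall c ρ ⊆ tri T
  diam_le : diamT T ≤ κ * ρ

lemma IsShapeRegular.exists_isRegTri {κ : ℝ} {K : SimplicialComplex ℝ Plane}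
    (h : IsShapeRegular κ K) {T : Finset Plane} (hT : T ∈ triangles K) :
    ∃ c ρ, IsRegTri κ T c ρ := by
  obtain ⟨c, ρ, h1, h2, h3⟩ := h T hT
  exact ⟨c, ρ, isTri_of_mem_triangles hT, h1, h2, h3⟩

section

variable {κ ρ m : ℝ} {T : Finset Plane} {c x y a b : Plane} {w : Plane → ℝ} {θ : Plane → Plane}

namespace IsRegTri

lemma norm_dbary (h : IsRegTri κ T c ρ) (z : Plane) : ‖dbary T z‖ ≤ (2 * ρ)⁻¹ :=
  h.norm_dbary_le h.pos h.ball z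

/-- The triangle is at least as wide as its disc; positivity of `κ` therefore never has to be
assumed. -/
lemma two_le (h : IsRegTri κ T c ρ) : 2 ≤ κ := by
  have h1 := IsTri.two_mul_le_diam h.pos h.ball
  have h2 := h.diam_le
  have h3 := h.pos
  by_contra! hlt
  nlinarith

lemma diam_pos (h : IsRegTri κ T c ρ) : 0 < diamT T := by
  have h1 := IsTri.two_mul_le_diam h.pos h.ball
  have h3 := h.pos
  linarith

lemma norm_sub_le (h : IsRegTri κ T c ρ) (hx : x ∈ tri T) (hy : y ∈ tri T) : ‖x - y‖ ≤ κ * ρ :=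
  (IsTri.norm_sub_le_diam hx hy).trans h.diam_le

lemma center_mem (h : IsRegTri κ T c ρ) : c ∈ tri T :=
  h.ball (Metric.mem_closedBall_self h.pos.le)

lemma subset_closedBall (h : IsRegTri κ T c ρ) : tri T ⊆ Metric.closedBall c (κ * ρ) :=
  fun _ hx => by rw [mem_closedBall_iff_norm]; exact h.norm_sub_le hx h.center_mem

end IsRegTri

lemma norm_le_of_inner_le {v : Plane} (hm : 0 ≤ m) (h : ∀ u, |inner ℝ v u| ≤ m * ‖u‖) : ‖v‖ ≤ m := by
  by_cases hv : v = 0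
  · simpa [hv] using hm
  have h1 := h v
  rw [real_inner_self_eq_norm_sq, abs_of_nonneg (by positivity), pow_two] at h1
  exact le_of_mul_le_mul_right h1 (norm_pos_iff.2 hv)

lemma norm_plane_le {v : Plane} (hm : 0 ≤ m) (h : ∀ i, |v i| ≤ m) : ‖v‖ ≤ 2 * m := by
  rw [EuclideanSpace.norm_eq]
  refine Real.sqrt_le_iff.2 ⟨by positivity, ?_⟩
  have h0 := pow_le_pow_left₀ (abs_nonneg _) (h 0) 2
  have h1 := pow_le_pow_left₀ (abs_nonneg _) (h 1) 2
  simp only [Fin.sum_univ_two, Real.norm_eq_abs]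
  nlinarith

lemma abs_coord_le (v : Plane) (i : Fin 2) : |v i| ≤ ‖v‖ := by
  simpa using PiLp.norm_apply_le v i

lemma norm_clm_le {L : Plane →L[ℝ] Plane} (hm : 0 ≤ m)
    (h : ∀ i j, |L (EuclideanSpace.single j 1) i| ≤ m) : ‖L‖ ≤ 4 * m := by
  refine L.opNorm_le_bound (by positivity) fun v => ?_
  have h1 : ∀ j, ‖L (EuclideanSpace.single j 1)‖ ≤ 2 * m := fun j => norm_plane_le hm fun i => h i j
  conv_lhs => rw [Plane.eq_coord v, map_add, map_smul, map_smul]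
  refine (norm_add_le _ _).trans ?_
  rw [norm_smul, norm_smul, Real.norm_eq_abs, Real.norm_eq_abs]
  have := mul_le_mul (abs_coord_le v 0) (h1 0) (norm_nonneg _) (norm_nonneg _)
  have := mul_le_mul (abs_coord_le v 1) (h1 1) (norm_nonneg _) (norm_nonneg _)
  linarith

/-- The discrete gradient is controlled by the gradient. -/
lemma norm_theta_le (hT : IsTri T) (hw : IsReducedCubicOn T w)
    (hθ : Set.EqOn θ (gradForm T (gradT w T) (trapezoidExcess w (gradT w T))) (tri T))
    (hm : ∀ x ∈ tri T, ‖gradT w T x‖ ≤ m) (hx : x ∈ tri T) : ‖θ x‖ ≤ 60 * m := by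
  have hm0 : 0 ≤ m := (norm_nonneg _).trans (hm x hx)
  -- Mean value inequality on the convex triangle for the polynomial extension of `w`.
  have hW : ∀ a ∈ T, ∀ b ∈ T, |w b - w a| ≤ m * ‖b - a‖ := by
    intro a ha b hb
    have hd := hw.eqOn_dktForm hT
    rw [hd (IsTri.vertex_mem ha), hd (IsTri.vertex_mem hb), ← Real.norm_eq_abs]
    refine (IsTri.convex_tri T).norm_image_sub_le_of_norm_hasFDerivWithin_le
      (fun x _ => (hasFDerivAt_dktForm x).hasFDerivWithinAt) (fun x hx => ?_)
      (IsTri.vertex_mem ha) (IsTri.vertex_mem hb)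
    refine ContinuousLinearMap.opNorm_le_bound _ hm0 fun u => ?_
    rw [← hw.inner_gradT hT hx]
    exact (norm_inner_le_norm _ _).trans (mul_le_mul_of_nonneg_right (hm x hx) (norm_nonneg _))
  rw [hθ hx]
  refine (norm_gradForm_le (m := 2 * m) hT hx (fun a ha => ?_) fun a ha b hb => ?_).trans
    (by linarith)
  · linarith [hm a (IsTri.vertex_mem ha)]
  · have h1 := abs_real_inner_le_norm (gradT w T a + gradT w T b) (b - a)
    have h2 : ‖gradT w T a + gradT w T b‖ ≤ 2 * m := (norm_add_le _ _).trans (by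
      linarith [hm a (IsTri.vertex_mem ha), hm b (IsTri.vertex_mem hb)])
    have h3 := mul_le_mul_of_nonneg_right h2 (norm_nonneg (b - a))
    have h4 := hW a ha b hb
    rw [trapezoidExcess]
    rw [abs_le] at *
    constructor <;> linarith

/-- The gradient is controlled by the discrete gradient. -/
lemma norm_gradT_le (hT : IsRegTri κ T c ρ) (hw : IsReducedCubicOn T w)
    (hθ : Set.EqOn θ (gradForm T (gradT w T) (trapezoidExcess w (gradT w T))) (tri T))
    (hm : ∀ x ∈ tri T, ‖θ x‖ ≤ m) (hx : x ∈ tri T) : ‖gradT w T x‖ ≤ 44 * κ * m := by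
  have hm0 : 0 ≤ m := (norm_nonneg _).trans (hm x hx)
  have hκ := hT.two_le
  have hρ := hT.pos
  set g := gradT w T
  have hv : ∀ a ∈ T, θ a = g a := fun a ha => by
    rw [hθ (IsTri.vertex_mem ha), gradForm_vertex hT.toIsTri ha]
  have hg : ∀ a ∈ T, ‖g a‖ ≤ m := fun a ha => by
    rw [← hv a ha]; exact hm a (IsTri.vertex_mem ha)
  have hW : ∀ a ∈ T, ∀ b ∈ T, |w b - w a| ≤ m * (κ * ρ) := by
    intro a ha b hb
    by_cases hab : a = b
    · subst hab
      simp only [sub_self, abs_zero]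
      positivity
    have hn : ‖b - a‖ ≠ 0 := norm_ne_zero_iff.2 (sub_ne_zero.2 (Ne.symm hab))
    -- Simpson's rule is exact for the quadratic tangential derivative along the edge; this recovers
    -- nodal differences from `θ` alone.
    have h1 : w b - w a = 1 / 6 * (inner ℝ (g a) (b - a) + 4 * inner ℝ (θ (midpoint ℝ a b)) (b - a) +
        inner ℝ (g b) (b - a)) := by
      rw [hθ (midpoint_mem_tri ha hb), gradForm_midpoint hT.toIsTri (trapezoidExcess_symm w g) ha hb,
        inner_add_left, inner_smul_left, inner_smul_left, real_inner_self_eq_norm_sq,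
        trapezoidExcess, inner_add_left]
      simp only [conj_trivial]
      field_simp
      ring
    have h2 : ∀ v : Plane, ‖v‖ ≤ m → |inner ℝ v (b - a)| ≤ m * (κ * ρ) := fun v hv =>
      (abs_real_inner_le_norm _ _).trans (mul_le_mul hv
        (hT.norm_sub_le (IsTri.vertex_mem hb) (IsTri.vertex_mem ha)) (norm_nonneg _) hm0)
    have h3 := h2 _ (hg a ha)
    have h4 := h2 _ (hm _ (midpoint_mem_tri ha hb))
    have h5 := h2 _ (hg b hb)
    rw [h1]
    rw [abs_le] at *
    constructor <;> linarith
  have h0 : 0 ≤ m * (κ * ρ) := by positivity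
  refine norm_le_of_inner_le (by positivity) fun u => ?_
  rw [hw.inner_gradT hT.toIsTri hx]
  refine (abs_dktDeriv_le (m := 2 * (m * (κ * ρ))) hT.toIsTri hT.norm_dbary hx
    (fun a ha b hb => (hW a ha b hb).trans (by linarith)) (fun a ha b hb => ?_) u).trans ?_
  · have h3 := (abs_real_inner_le_norm (g a) (b - a)).trans (mul_le_mul (hg a ha)
        (hT.norm_sub_le (IsTri.vertex_mem hb) (IsTri.vertex_mem ha)) (norm_nonneg _) hm0)
    have h4 := hW a ha b hb
    rw [hermiteExcess]
    change |inner ℝ (g a) (b - a) - (w b - w a)| ≤ _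
    rw [abs_le] at *
    constructor <;> linarith
  -- With `r = (2 * ρ)⁻¹` the factor ρ cancels: 44 · 2κρ / (2ρ) = 44κ.
  · refine mul_le_mul_of_nonneg_right (le_of_eq ?_) (norm_nonneg _)
    field_simp

/-- The Hessian is controlled by the derivative of the discrete gradient. -/
lemma abs_hessT_le (hT : IsRegTri κ T c ρ) (hw : IsReducedCubicOn T w)
    (hθ : Set.EqOn θ (gradForm T (gradT w T) (trapezoidExcess w (gradT w T))) (tri T))
    (hm : ∀ x ∈ tri T, ∀ p, |jacT θ T x p| ≤ m) :
    (∀ x ∈ tri T, ∀ p, |hessT w T x p| ≤ 200 * κ ^ 2 * m) ∧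
      ∀ x ∈ tri T, ∀ y ∈ tri T, ‖θ x - θ y‖ ≤ 4 * m * ‖x - y‖ := by
  have hm0 : 0 ≤ m := (abs_nonneg _).trans (hm c hT.center_mem (0, 0))
  have hκ := hT.two_le
  have hρ := hT.pos
  set g := gradT w T
  have hlip : ∀ x ∈ tri T, ∀ y ∈ tri T, ‖θ x - θ y‖ ≤ 4 * m * ‖x - y‖ := by
    intro x hx y hy
    rw [hθ hx, hθ hy]
    choose L hL hL' using fun x => hasFDerivAt_gradForm (T := T) (g := g)
      (δ := trapezoidExcess w g) x
    refine (IsTri.convex_tri T).norm_image_sub_le_of_norm_hasFDerivWithin_le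
      (fun x _ => (hL x).hasFDerivWithinAt) (fun x hx => ?_) hy hx
    refine norm_clm_le hm0 fun i j => ?_
    rw [hL']
    have := hm x hx (i, j)
    rwa [jacT_gradForm hT.toIsTri hθ hx] at this
  refine ⟨fun x hx p => ?_, hlip⟩
  have hv : ∀ a ∈ T, θ a = g a := fun a ha => by
    rw [hθ (IsTri.vertex_mem ha), gradForm_vertex hT.toIsTri ha]
  -- The Hermite excess splits into a difference of nodal gradients and the trapezoid excess, each
  -- at most 4m(κρ)² by the Lipschitz bound on `θ`.
  have hα : ∀ a ∈ T, ∀ b ∈ T, |hermiteExcess w g a b| ≤ 8 * m * (κ * ρ) ^ 2 := by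
    intro a ha b hb
    by_cases hab : a = b
    · subst hab
      rw [hermiteExcess_self, abs_zero]
      positivity
    have hn : 0 < ‖b - a‖ := norm_pos_iff.2 (sub_ne_zero.2 (Ne.symm hab))
    have ha' := IsTri.vertex_mem ha
    have hb' := IsTri.vertex_mem hb
    have hle : ‖b - a‖ ≤ κ * ρ := hT.norm_sub_le hb' ha'
    have hmid := midpoint_mem_tri ha hb
    have h4 : ∀ x ∈ tri T, ∀ y ∈ tri T, ‖θ x - θ y‖ ≤ 4 * m * (κ * ρ) := fun x hx y hy =>
      (hlip x hx y hy).trans (mul_le_mul_of_nonneg_left (hT.norm_sub_le hx hy) (by positivity))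
    have h5 : |trapezoidExcess w g a b| ≤ 4 * m * (κ * ρ) ^ 2 := by
      -- The trapezoid excess is read off from the second difference of `θ` at the end points and
      -- the midpoint of the edge.
      have e1 : (3 / 2 * trapezoidExcess w g a b * (‖b - a‖ ^ 2)⁻¹) • (b - a) =
          (1 / 2 : ℝ) • ((θ (midpoint ℝ a b) - θ a) + (θ (midpoint ℝ a b) - θ b)) := by
        rw [hv a ha, hv b hb, hθ hmid,
          gradForm_midpoint hT.toIsTri (trapezoidExcess_symm w g) ha hb]
        module
      have e2 : ‖(3 / 2 * trapezoidExcess w g a b * (‖b - a‖ ^ 2)⁻¹) • (b - a)‖ ≤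
          4 * m * (κ * ρ) := by
        rw [e1, norm_smul, Real.norm_of_nonneg (by norm_num)]
        have := norm_add_le (θ (midpoint ℝ a b) - θ a) (θ (midpoint ℝ a b) - θ b)
        have := h4 _ hmid _ ha'
        have := h4 _ hmid _ hb'
        linarith
      rw [norm_smul, Real.norm_eq_abs, abs_mul, abs_mul, abs_inv, abs_of_pos (pow_pos hn 2),
        abs_of_pos (by norm_num : (0 : ℝ) < 3 / 2)] at e2
      have e3 : 3 / 2 * |trapezoidExcess w g a b| * (‖b - a‖ ^ 2)⁻¹ * ‖b - a‖ =
        3 / 2 * |trapezoidExcess w g a b| / ‖b - a‖ := by field_simp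
      rw [e3, div_le_iff₀ hn] at e2
      have e4 : 4 * m * (κ * ρ) * ‖b - a‖ ≤ 4 * m * (κ * ρ) * (κ * ρ) :=
        mul_le_mul_of_nonneg_left hle (by positivity)
      have := abs_nonneg (trapezoidExcess w g a b)
      nlinarith
    have h6 : |inner ℝ (g b - g a) (b - a)| ≤ 4 * m * (κ * ρ) ^ 2 := by
      refine (abs_real_inner_le_norm _ _).trans ?_
      rw [← hv a ha, ← hv b hb, pow_two, ← mul_assoc]
      exact mul_le_mul (h4 _ hb' _ ha') hle (norm_nonneg _) (by positivity)
    have e : hermiteExcess w g a b =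
        -(1 / 2) * inner ℝ (g b - g a) (b - a) - trapezoidExcess w g a b := by
      rw [hermiteExcess, trapezoidExcess, inner_sub_left, inner_add_left]
      ring
    have h0 : 0 ≤ m * (κ * ρ) ^ 2 := by positivity
    rw [e]
    rw [abs_le] at *
    constructor <;> linarith
  rw [hw.hessT_apply hT.toIsTri hx]
  refine (abs_dktDeriv₂_le hT.toIsTri hT.norm_dbary hx hα (by simp) (by simp)).trans
    (le_of_eq ?_)
  field_simp
  ring

/-- The derivative of the discrete gradient is controlled by the Hessian. -/
lemma abs_jacT_le (hT : IsRegTri κ T c ρ) (hw : IsReducedCubicOn T w)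
    (hθ : Set.EqOn θ (gradForm T (gradT w T) (trapezoidExcess w (gradT w T))) (tri T))
    (hm : ∀ x ∈ tri T, ∀ p, |hessT w T x p| ≤ m) :
    (∀ x ∈ tri T, ∀ p, |jacT θ T x p| ≤ 120 * κ * m) ∧
      ∀ x ∈ tri T, ∀ y ∈ tri T, ‖gradT w T x - gradT w T y‖ ≤ 4 * m * ‖x - y‖ := by
  have hm0 : 0 ≤ m := (abs_nonneg _).trans (hm c hT.center_mem (0, 0))
  have hκ := hT.two_le
  have hρ := hT.pos
  have hlip : ∀ x ∈ tri T, ∀ y ∈ tri T, ‖gradT w T x - gradT w T y‖ ≤ 4 * m * ‖x - y‖ := by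
    intro x hx y hy
    obtain ⟨F, hF, h⟩ := hw.hasFDerivAt_grad hT.toIsTri
    choose L hL hL' using h
    rw [hF hx, hF hy]
    refine (IsTri.convex_tri T).norm_image_sub_le_of_norm_hasFDerivWithin_le
      (fun x _ => (hL x).hasFDerivWithinAt) (fun x hx => ?_) hy hx
    refine norm_clm_le hm0 fun i j => ?_
    rw [hL']
    have := hm x hx (i, j)
    rwa [hw.hessT_apply hT.toIsTri hx] at this
  refine ⟨fun x hx p => ?_, hlip⟩
  set g := gradT w T
  have hg : ∀ x ∈ tri T, ∀ y ∈ tri T, ‖g x - g y‖ ≤ 4 * m * (κ * ρ) := fun x hx y hy =>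
    (hlip x hx y hy).trans (mul_le_mul_of_nonneg_left (hT.norm_sub_le hx hy) (by positivity))
  -- The Hermite excess is minus the first order Taylor remainder of `w` at `a`, controlled by the
  -- oscillation of the gradient.
  have hα : ∀ a ∈ T, ∀ b ∈ T, |hermiteExcess w g a b| ≤ 4 * m * (κ * ρ) * ‖b - a‖ := by
    intro a ha b hb
    have ha' := IsTri.vertex_mem ha
    have hb' := IsTri.vertex_mem hb
    have hd := hw.eqOn_dktForm hT.toIsTri
    have h1 := (IsTri.convex_tri T).norm_image_sub_le_of_norm_hasFDerivWithin_le'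
      (f := dktForm T w (hermiteExcess w g)) (φ := dktDeriv T w (hermiteExcess w g) a)
      (C := 4 * m * (κ * ρ))
      (fun x _ => (hasFDerivAt_dktForm x).hasFDerivWithinAt) (fun x hx => by
        refine ContinuousLinearMap.opNorm_le_bound _ (by positivity) fun u => ?_
        rw [sub_apply, ← hw.inner_gradT hT.toIsTri hx, ← hw.inner_gradT hT.toIsTri ha',
          ← inner_sub_left]
        exact (norm_inner_le_norm _ _).trans
          (mul_le_mul_of_nonneg_right (hg x hx a ha') (norm_nonneg _))) ha' hb'
    rw [← hd ha', ← hd hb', ← hw.inner_gradT hT.toIsTri ha', Real.norm_eq_abs, abs_sub_comm] at h1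
    exact h1
  rw [jacT_gradForm hT.toIsTri hθ hx]
  refine (abs_coord_le _ _).trans ((norm_gradFormDeriv_le (m := 4 * m * (κ * ρ)) hT.toIsTri
    hT.norm_dbary hx (fun a ha b hb => hg b (IsTri.vertex_mem hb) a (IsTri.vertex_mem ha))
    (fun a ha b hb => ?_) _).trans (le_of_eq ?_))
  · have h1 := hα a ha b hb
    have h2 := hα b hb a ha
    rw [norm_sub_rev] at h2
    rw [trapezoidExcess_eq]
    rw [abs_le] at *
    constructor <;> linarith
  · simp only [PiLp.norm_single, norm_one]
    field_simp
    ring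

/-! ### From uniform to `L²` estimates -/

lemma l2norm_nonneg {ι : Type} [Fintype ι] (S : Set Plane) (f : Plane → ι → ℝ) : 0 ≤ l2norm S f :=
  Real.sqrt_nonneg _

lemma l2norm_sq {ι : Type} [Fintype ι] (S : Set Plane) (f : Plane → ι → ℝ) :
    l2norm S f ^ 2 = ∫ x in S, ∑ i, f x i ^ 2 :=
  Real.sq_sqrt (integral_nonneg fun _ => Finset.sum_nonneg fun _ _ => sq_nonneg _)

lemma measurableSet_tri (T : Finset Plane) : MeasurableSet (tri T) :=
  (IsTri.isCompact_tri T).measurableSet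

lemma IsRegTri.volume_le (hT : IsRegTri κ T c ρ) :
    volume.real (tri T) ≤ volume.real (Metric.ball (0 : Plane) 1) * (κ * ρ) ^ 2 := by
  have hκ := hT.two_le
  have hρ := hT.pos
  calc volume.real (tri T) ≤ volume.real (Metric.closedBall c (κ * ρ)) :=
        measureReal_mono hT.subset_closedBall measure_closedBall_lt_top.ne
    _ = _ := by
        rw [Measure.real, Measure.addHaar_closedBall _ _ (by positivity), ENNReal.toReal_mul,
          ENNReal.toReal_ofReal (by positivity), finrank_euclideanSpace, Fintype.card_fin, mul_comm]
        rfl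

lemma IsRegTri.le_volume (hT : IsRegTri κ T c ρ) :
    volume.real (Metric.ball (0 : Plane) 1) * ρ ^ 2 ≤ volume.real (tri T) := by
  have hρ := hT.pos
  calc _ = volume.real (Metric.closedBall c ρ) := by
        rw [Measure.real, Measure.real, Measure.addHaar_closedBall _ _ (by positivity),
          ENNReal.toReal_mul,
          ENNReal.toReal_ofReal (by positivity), finrank_euclideanSpace, Fintype.card_fin, mul_comm]
    _ ≤ volume.real (tri T) :=
        measureReal_mono hT.ball (IsTri.isCompact_tri T).measure_lt_top.ne

lemma l2norm_le_of_abs_le {ι : Type} [Fintype ι] (hT : IsRegTri κ T c ρ) {f : Plane → ι → ℝ}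
    (hm0 : 0 ≤ m) (hm : ∀ x ∈ tri T, ∀ i, |f x i| ≤ m) :
    l2norm (tri T) f ≤
      √(Fintype.card ι * volume.real (Metric.ball (0 : Plane) 1)) * (κ * ρ) * m := by
  have hκ := hT.two_le
  have hρ := hT.pos
  rw [l2norm]
  refine Real.sqrt_le_iff.2 ⟨by positivity, ?_⟩
  have h1 : ‖∫ x in tri T, ∑ i, f x i ^ 2‖ ≤ (Fintype.card ι * m ^ 2) * volume.real (tri T) := by
    refine norm_setIntegral_le_of_norm_le_const (IsTri.isCompact_tri T).measure_lt_top fun x hx => ?_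
    rw [Real.norm_of_nonneg (Finset.sum_nonneg fun _ _ => sq_nonneg _)]
    calc ∑ i, f x i ^ 2 ≤ ∑ _i : ι, m ^ 2 := Finset.sum_le_sum fun i _ => by
          rw [← sq_abs]; exact pow_le_pow_left₀ (abs_nonneg _) (hm x hx i) 2
      _ = _ := by simp
  refine (le_abs_self _).trans (h1.trans ?_)
  rw [mul_pow, mul_pow, Real.sq_sqrt (by positivity)]
  have := mul_le_mul_of_nonneg_left hT.volume_le
    (by positivity : (0 : ℝ) ≤ Fintype.card ι * m ^ 2)
  linarith

/-- The inverse estimate for quadratic fields on shape regular triangles. -/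
lemma exists_inverse_estimate (κ : ℝ) : ∃ C : ℝ, 0 < C ∧ ∀ {ι : Type} [Fintype ι]
    (T : Finset Plane) (c : Plane) (ρ : ℝ), IsRegTri κ T c ρ → ∀ f : Plane → ι → ℝ,
    (∀ i, ∃ P, PolyFun 2 P ∧ Set.EqOn (fun x => f x i) P (tri T)) →
    ∀ x ∈ tri T, ∀ i, |f x i| ≤ C * ρ⁻¹ * l2norm (tri T) f := by
  obtain ⟨C, hC, h⟩ := exists_inverse_estimate_ball κ
  refine ⟨√C, Real.sqrt_pos.2 hC, fun {ι} _ T c ρ hT f hf x hx i => ?_⟩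
  choose P hP hfP using hf
  have hρ := hT.pos
  refine abs_le_of_sq_le_sq ?_ (mul_nonneg (by positivity) (l2norm_nonneg _ _))
  have hint : ∀ i, IntegrableOn (fun x => f x i ^ 2) (tri T) := fun i => by
    refine ((((hP i).continuous.pow 2).continuousOn).integrableOn_compact
      (IsTri.isCompact_tri T)).congr_fun (fun x hx => ?_) (measurableSet_tri T)
    have : f x i = P i x := hfP i hx
    simp only [this, Pi.pow_apply]
  -- The triangle lies between the concentric discs of radii ρ and κρ, so its shape plays no further
  -- role.
  have h1 := h (P i) (hP i) c ρ hρ x (hT.subset_closedBall hx)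
  have h2 : ∫ y in Metric.ball c ρ, P i y ^ 2 ≤ ∫ x in tri T, ∑ i, f x i ^ 2 := by
    calc ∫ y in Metric.ball c ρ, P i y ^ 2 = ∫ y in Metric.ball c ρ, f y i ^ 2 :=
          setIntegral_congr_fun measurableSet_ball fun y hy => by
            have : f y i = P i y := hfP i (hT.ball (Metric.ball_subset_closedBall hy))
            simp only [this]
      _ ≤ ∫ y in tri T, f y i ^ 2 := setIntegral_mono_set (hint i)
          (Filter.Eventually.of_forall fun _ => sq_nonneg _)
          (Metric.ball_subset_closedBall.trans hT.ball).eventuallyLE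
      _ ≤ ∫ x in tri T, ∑ i, f x i ^ 2 := by
          refine integral_mono (hint i) (integrable_finsetSum _ fun i _ => hint i) fun x => ?_
          exact Finset.single_le_sum (f := fun i => f x i ^ 2) (fun _ _ => sq_nonneg _)
            (Finset.mem_univ i)
  have h3 : f x i = P i x := hfP i hx
  rw [mul_pow, mul_pow, Real.sq_sqrt hC.le, l2norm_sq, h3, inv_pow]
  exact h1.trans (mul_le_mul_of_nonneg_left h2 (by positivity))

lemma polyFun_theta {g : Plane → Plane} {δ : Plane → Plane → ℝ}
    (hθ : Set.EqOn θ (gradForm T g δ) (tri T)) (i : Fin 2) :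
    ∃ P, PolyFun 2 P ∧ Set.EqOn (fun x => θ x i) P (tri T) :=
  ⟨_, polyFun_gradForm i, fun x hx => by simp only [hθ hx]; rfl⟩

lemma polyFun_gradT (hT : IsTri T) (hw : IsReducedCubicOn T w) (i : Fin 2) :
    ∃ P, PolyFun 2 P ∧ Set.EqOn (fun x => gradT w T x i) P (tri T) :=
  ⟨_, polyFun_dktDeriv hT _ _ _, fun _ hx => hw.gradT_apply hT hx i⟩

lemma polyFun_hessT (hT : IsTri T) (hw : IsReducedCubicOn T w) (p : Fin 2 × Fin 2) :
    ∃ P, PolyFun 2 P ∧ Set.EqOn (fun x => hessT w T x p) P (tri T) :=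
  ⟨_, polyFun_dktDeriv₂ hT _ _ _, fun _ hx => hw.hessT_apply hT hx p⟩

lemma polyFun_jacT (hT : IsTri T) {g : Plane → Plane} {δ : Plane → Plane → ℝ}
    (hθ : Set.EqOn θ (gradForm T g δ) (tri T)) (p : Fin 2 × Fin 2) :
    ∃ P, PolyFun 2 P ∧ Set.EqOn (fun x => jacT θ T x p) P (tri T) :=
  ⟨_, polyFun_gradFormDeriv _ _ _ _, fun _ hx => jacT_gradForm hT hθ hx p⟩

/-- A uniform estimate between quadratic fields on shape regular triangles implies the
corresponding `L²` estimate. -/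
lemma exists_l2norm_le (κ : ℝ) : ∃ C : ℝ, 0 < C ∧ ∀ {ι ι' : Type} [Fintype ι] [Fintype ι']
    (T : Finset Plane) (c : Plane) (ρ : ℝ), IsRegTri κ T c ρ → Fintype.card ι' ≤ 4 →
    ∀ (A : ℝ) (f : Plane → ι → ℝ) (f' : Plane → ι' → ℝ), 0 ≤ A →
    (∀ i, ∃ P, PolyFun 2 P ∧ Set.EqOn (fun x => f x i) P (tri T)) →
    (∀ m, 0 ≤ m → (∀ x ∈ tri T, ∀ i, |f x i| ≤ m) → ∀ x ∈ tri T, ∀ i, |f' x i| ≤ A * m) →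
    l2norm (tri T) f' ≤ C * A * l2norm (tri T) f := by
  obtain ⟨C, hC, h⟩ := exists_inverse_estimate κ
  set V := volume.real (Metric.ball (0 : Plane) 1)
  refine ⟨(√(4 * V) + 1) * (max κ 1) * C, by positivity,
    fun {ι ι'} _ _ T c ρ hT hcard A f f' hA hf hff' => ?_⟩
  have hρ := hT.pos
  have hκ := hT.two_le
  have hl := l2norm_nonneg (tri T) f
  have h1 := h T c ρ hT f hf
  have h2 := hff' (C * ρ⁻¹ * l2norm (tri T) f) (by positivity) h1
  refine (l2norm_le_of_abs_le hT (by positivity) h2).trans ?_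
  have h3 : √(Fintype.card ι' * V) ≤ √(4 * V) + 1 := by
    refine (Real.sqrt_le_sqrt (mul_le_mul_of_nonneg_right
      (Nat.cast_le_ofNat.2 hcard)
      measureReal_nonneg)).trans (by linarith)
  -- The factor ρ from the area of the triangle cancels the inverse ρ of the inverse estimate, which
  -- makes the bound scale invariant.
  calc √(Fintype.card ι' * V) * (κ * ρ) * (A * (C * ρ⁻¹ * l2norm (tri T) f))
      ≤ (√(4 * V) + 1) * (max κ 1 * ρ) * (A * (C * ρ⁻¹ * l2norm (tri T) f)) := by
        gcongr
        exact le_max_left _ _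
    _ = _ := by field_simp

end

end

noncomputable section

section

variable {κ ρ m : ℝ} {T : Finset Plane} {c x y a b : Plane} {w : Plane → ℝ} {θ : Plane → Plane}

/-! ### Local comparison of the discrete gradient with the gradient -/

/-- Passing from components to the Euclidean norm doubles the uniform constants 60 and 44κ; both
results are covered by 120 · max(κ, 1). -/
lemma exists_l2norm_theta_le (κ : ℝ) : ∃ C : ℝ, 0 < C ∧ ∀ (T : Finset Plane) (c : Plane) (ρ : ℝ),
    IsRegTri κ T c ρ → ∀ w θ, IsReducedCubicOn T w →
    Set.EqOn θ (gradForm T (gradT w T) (trapezoidExcess w (gradT w T))) (tri T) →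
    l2norm (tri T) (fun x i => θ x i) ≤ C * l2norm (tri T) (fun x i => gradT w T x i) ∧
    l2norm (tri T) (fun x i => gradT w T x i) ≤ C * l2norm (tri T) (fun x i => θ x i) := by
  obtain ⟨C, hC, h⟩ := exists_l2norm_le κ
  refine ⟨C * (120 * max κ 1), by positivity, fun T c ρ hT w θ hw hθ => ?_⟩
  have hκ : κ ≤ max κ 1 := le_max_left _ _
  have h1 : 1 ≤ max κ 1 := le_max_right _ _
  have hκ2 := hT.two_le
  constructor
  · refine h T c ρ hT (by simp) _ _ _ (by positivity) (polyFun_gradT hT.toIsTri hw)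
      fun m hm hf x hx i => ?_
    refine (abs_coord_le _ i).trans ((norm_theta_le hT.toIsTri hw hθ (m := 2 * m)
      (fun x hx => norm_plane_le hm (hf x hx)) hx).trans ?_)
    nlinarith
  · refine h T c ρ hT (by simp) _ _ _ (by positivity) (polyFun_theta hθ) fun m hm hf x hx i => ?_
    refine (abs_coord_le _ i).trans ((norm_gradT_le hT hw hθ (m := 2 * m)
      (fun x hx => norm_plane_le hm (hf x hx)) hx).trans ?_)
    nlinarith

lemma exists_l2norm_jacT_le (κ : ℝ) : ∃ C : ℝ, 0 < C ∧ ∀ (T : Finset Plane) (c : Plane) (ρ : ℝ),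
    IsRegTri κ T c ρ → ∀ w θ, IsReducedCubicOn T w →
    Set.EqOn θ (gradForm T (gradT w T) (trapezoidExcess w (gradT w T))) (tri T) →
    l2norm (tri T) (jacT θ T) ≤ C * l2norm (tri T) (hessT w T) ∧
    l2norm (tri T) (hessT w T) ≤ C * l2norm (tri T) (jacT θ T) := by
  obtain ⟨C, hC, h⟩ := exists_l2norm_le κ
  refine ⟨C * (200 * max κ 1 ^ 2), by positivity, fun T c ρ hT w θ hw hθ => ?_⟩
  have hκ : κ ≤ max κ 1 := le_max_left _ _
  have h1 : 1 ≤ max κ 1 := le_max_right _ _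
  have hκ2 := hT.two_le
  have h2 : κ ^ 2 ≤ max κ 1 ^ 2 := by gcongr
  constructor
  · refine h T c ρ hT (by simp) _ _ _ (by positivity) (polyFun_hessT hT.toIsTri hw)
      fun m hm hf x hx i => ?_
    refine ((abs_jacT_le hT hw hθ hf).1 x hx i).trans ?_
    gcongr
    · norm_num
    · nlinarith
  · refine h T c ρ hT (by simp) _ _ _ (by positivity) (polyFun_jacT hT.toIsTri hθ)
      fun m hm hf x hx i => ?_
    refine ((abs_hessT_le hT hw hθ hf).1 x hx i).trans ?_
    gcongr

/-- Both fields agree at the vertices. Both are Lipschitz with constants controlled by the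
derivative of `θ`, the gradient through the Hessian bound, and every point is within one diameter of
a vertex. -/
lemma exists_l2norm_theta_sub_le (κ : ℝ) : ∃ C : ℝ, 0 < C ∧
    ∀ (T : Finset Plane) (c : Plane) (ρ : ℝ),
    IsRegTri κ T c ρ → ∀ w θ, IsReducedCubicOn T w →
    Set.EqOn θ (gradForm T (gradT w T) (trapezoidExcess w (gradT w T))) (tri T) →
    l2norm (tri T) (fun x i => θ x i - gradT w T x i) ≤
      C * diamT T * l2norm (tri T) (jacT θ T) := by
  obtain ⟨C, hC, h⟩ := exists_l2norm_le κ
  refine ⟨C * (4 + 800 * κ ^ 2), by positivity, fun T c ρ hT w θ hw hθ => ?_⟩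
  have hκ2 := hT.two_le
  have hd := hT.diam_pos
  rw [mul_assoc C]
  refine h T c ρ hT (by simp) _ _ _ (by positivity) (polyFun_jacT hT.toIsTri hθ)
    fun m hm hf x hx i => ?_
  obtain ⟨h1, h2⟩ := abs_hessT_le hT hw hθ hf
  obtain ⟨-, h3⟩ := abs_jacT_le hT hw hθ h1
  obtain ⟨a, ha⟩ : T.Nonempty := Finset.card_pos.1 (by simp [hT.card])
  have ha' := IsTri.vertex_mem ha
  have hv : θ a = gradT w T a := by rw [hθ ha', gradForm_vertex hT.toIsTri ha]
  have hle := IsTri.norm_sub_le_diam hx ha'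
  have e : θ x - gradT w T x = (θ x - θ a) - (gradT w T x - gradT w T a) := by rw [hv]; abel
  have h4 : ‖θ x - gradT w T x‖ ≤ 4 * m * diamT T + 4 * (200 * κ ^ 2 * m) * diamT T := by
    rw [e]
    refine (norm_sub_le _ _).trans (add_le_add ((h2 x hx a ha').trans ?_) ((h3 x hx a ha').trans ?_))
    · gcongr
    · gcongr
  refine (abs_coord_le (θ x - gradT w T x) i).trans (h4.trans (le_of_eq (by ring)))

end

/-! ### Gluing functions on the triangles of a triangulation -/

section

variable {ω : Set Plane} {K : SimplicialComplex ℝ Plane} {T T' : Finset Plane} {x a b : Plane}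

lemma finite_triangles (hK : IsTriangulation ω K) : (triangles K).Finite :=
  hK.finite.subset fun _ h => h.1

lemma closure_eq_iUnion (hK : IsTriangulation ω K) : closure ω = ⋃ T : triangles K, tri T := by
  rw [← hK.space_eq]
  ext x
  rw [SimplicialComplex.mem_space_iff, Set.mem_iUnion]
  constructor
  · rintro ⟨s, hs, hx⟩
    obtain ⟨T, hT, hsT⟩ := hK.pure s hs
    exact ⟨⟨T, hT⟩, convexHull_mono (Finset.coe_subset.2 hsT) hx⟩
  · rintro ⟨⟨T, hT⟩, hx⟩
    exact ⟨T, hT.1, hx⟩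

lemma mem_closure_iff_exists (hK : IsTriangulation ω K) :
    x ∈ closure ω ↔ ∃ T ∈ triangles K, x ∈ tri T := by
  simp [closure_eq_iUnion hK]

lemma tri_subset_closure (hK : IsTriangulation ω K) (hT : T ∈ triangles K) :
    tri T ⊆ closure ω := fun _ hx => (mem_closure_iff_exists hK).2 ⟨T, hT, hx⟩

lemma continuousOn_closure (hK : IsTriangulation ω K) {E : Type*} [TopologicalSpace E]
    {F : Plane → E} (hF : ∀ T ∈ triangles K, ContinuousOn F (tri T)) :
    ContinuousOn F (closure ω) := by
  have := (finite_triangles hK).to_subtype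
  rw [closure_eq_iUnion hK]
  exact (locallyFinite_of_finite _).continuousOn_iUnion
    (fun T => (IsTri.isCompact_tri T.1).isClosed) fun T => hF T T.2

lemma exists_glue {E : Type*} [TopologicalSpace E] [Inhabited E] (hK : IsTriangulation ω K)
    {F : Finset Plane → Plane → E} (hF : ∀ T ∈ triangles K, ContinuousOn (F T) (tri T))
    (h : ∀ T ∈ triangles K, ∀ T' ∈ triangles K, ∀ x ∈ tri T, x ∈ tri T' → F T x = F T' x) :
    ∃ G : Plane → E, ContinuousOn G (closure ω) ∧ ∀ T ∈ triangles K, Set.EqOn G (F T) (tri T) := by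
  classical
  set G : Plane → E := fun x => if h : ∃ T ∈ triangles K, x ∈ tri T then F h.choose x else default
  have hG : ∀ T ∈ triangles K, Set.EqOn G (F T) (tri T) := by
    intro T hT x hx
    have hex : ∃ T ∈ triangles K, x ∈ tri T := ⟨T, hT, hx⟩
    simp only [G]
    rw [dif_pos hex]
    exact h _ hex.choose_spec.1 T hT x hex.choose_spec.2 hx
  exact ⟨G, continuousOn_closure hK fun T hT => (hF T hT).congr (hG T hT), hG⟩

/-- Barycentric coordinates with respect to two triangles of a triangulation agree on the
intersection, and vanish for vertices which are not common. -/
lemma bary_eq_of_mem (hT : T ∈ triangles K) (hT' : T' ∈ triangles K) (hx : x ∈ tri T)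
    (hx' : x ∈ tri T') (z : Plane) : bary T z x = bary T' z x ∧ (z ∉ T' → bary T z x = 0) :=
  (isTri_of_mem_triangles hT).bary_eq_bary (isTri_of_mem_triangles hT')
    (K.inter_subset_convexHull hT.1 hT'.1 ⟨hx, hx'⟩) z

/-- At a point shared by two triangles, only common vertices have nonzero barycentric coordinates,
so both sums collapse to the intersection. -/
lemma sum_eq_sum_of_mem [DecidableEq Plane] {M : Type*} [AddCommMonoid M]
    (hT : T ∈ triangles K) (hT' : T' ∈ triangles K)
    (hx : x ∈ tri T) (hx' : x ∈ tri T') {f f' : Plane → M}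
    (h0 : ∀ z ∈ T, bary T z x = 0 → f z = 0) (h0' : ∀ z ∈ T', bary T' z x = 0 → f' z = 0)
    (h : ∀ z ∈ T, z ∈ T' → f z = f' z) : ∑ z ∈ T, f z = ∑ z ∈ T', f' z := by
  have e1 : ∑ z ∈ T, f z = ∑ z ∈ T ∩ T', f z :=
    (Finset.sum_subset Finset.inter_subset_left fun z hz hz' =>
      h0 z hz ((bary_eq_of_mem hT hT' hx hx' z).2 fun h => hz' (by simp [hz, h]))).symm
  have e2 : ∑ z ∈ T', f' z = ∑ z ∈ T ∩ T', f' z :=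
    (Finset.sum_subset Finset.inter_subset_right fun z hz hz' =>
      h0' z hz ((bary_eq_of_mem hT' hT hx' hx z).2 fun h => hz' (by simp [hz, h]))).symm
  rw [e1, e2]
  exact Finset.sum_congr rfl fun z hz => h z (Finset.mem_inter.1 hz).1 (Finset.mem_inter.1 hz).2

/-- Conformity of the discrete gradient: on a shared face only nodal and edge data at shared
vertices contribute. -/
lemma gradForm_eq_of_mem (hT : T ∈ triangles K) (hT' : T' ∈ triangles K) (hx : x ∈ tri T)
    (hx' : x ∈ tri T') {g g' : Plane → Plane} {δ δ' : Plane → Plane → ℝ}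
    (hg : ∀ z ∈ T, z ∈ T' → g z = g' z)
    (hδ : ∀ a ∈ T, a ∈ T' → ∀ b ∈ T, b ∈ T' → δ a b = δ' a b) :
    gradForm T g δ x = gradForm T' g' δ' x := by
  classical
  have hb := fun z => (bary_eq_of_mem hT hT' hx hx' z).1
  rw [gradForm, gradForm]
  congr 1
  · refine sum_eq_sum_of_mem hT hT' hx hx' (fun z _ h => by rw [h, zero_smul])
      (fun z _ h => by rw [h, zero_smul]) fun z hz hz' => by rw [hb, hg z hz hz']
  · refine sum_eq_sum_of_mem hT hT' hx hx' (fun z _ h => by simp [h])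
      (fun z _ h => by simp [h]) fun a ha ha' => ?_
    refine sum_eq_sum_of_mem hT hT' hx hx' (fun z _ h => by simp [h])
      (fun z _ h => by simp [h]) fun b hb1 hb2 => ?_
    rw [hb, hb, hδ a ha ha' b hb1 hb2]

/-- For distinct triangles each has a vertex outside the other, so both cubic bubbles vanish at a
common point; the other terms collapse to common vertices. -/
lemma dktForm_eq_of_mem (hT : T ∈ triangles K) (hT' : T' ∈ triangles K) (hx : x ∈ tri T)
    (hx' : x ∈ tri T') {W : Plane → ℝ} {α : Plane → Plane → ℝ} :
    dktForm T W α x = dktForm T' W α x := by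
  classical
  by_cases hTT : T = T'
  · rw [hTT]
  have hb := fun z => (bary_eq_of_mem hT hT' hx hx' z).1
  have h0 : ∀ {U U' : Finset Plane}, U ∈ triangles K → U' ∈ triangles K → x ∈ tri U → x ∈ tri U' →
      U ≠ U' → ∏ a ∈ U, bary U a x = 0 := by
    intro U U' hU hU' hxU hxU' hne
    obtain ⟨z, hz, hz'⟩ : ∃ z ∈ U, z ∉ U' := by
      by_contra! h
      exact hne (Finset.eq_of_subset_of_card_le h (by rw [hU.2, hU'.2]))
    exact Finset.prod_eq_zero hz ((bary_eq_of_mem hU hU' hxU hxU' z).2 hz')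
  rw [dktForm, dktForm, h0 hT hT' hx hx' hTT, h0 hT' hT hx' hx (Ne.symm hTT), mul_zero, mul_zero]
  congr 2
  · refine sum_eq_sum_of_mem hT hT' hx hx' (fun z _ h => by rw [h, mul_zero])
      (fun z _ h => by rw [h, mul_zero]) fun z hz hz' => by rw [hb]
  · refine sum_eq_sum_of_mem hT hT' hx hx' (fun z _ h => by simp [h])
      (fun z _ h => by simp [h]) fun a ha ha' => ?_
    refine sum_eq_sum_of_mem hT hT' hx hx' (fun z _ h => by simp [h])
      (fun z _ h => by simp [h]) fun b hb1 hb2 => ?_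
    rw [hb, hb]

lemma continuous_gradForm (T : Finset Plane) (g : Plane → Plane) (δ : Plane → Plane → ℝ) :
    Continuous (gradForm T g δ) :=
  continuous_iff_continuousAt.2 fun x => by
    obtain ⟨L, hL, -⟩ := hasFDerivAt_gradForm (T := T) (g := g) (δ := δ) x
    exact hL.continuousAt

/-- Existence of the discrete gradient. -/
lemma exists_isDiscreteGradient (hK : IsTriangulation ω K) {w : Plane → ℝ} (hw : IsDKT ω K w) :
    ∃ θ, IsDiscreteGradient ω K w θ := by
  obtain ⟨θ, hθc, hθ⟩ := exists_glue hK
    (F := fun T => gradForm T (gradT w T) (trapezoidExcess w (gradT w T)))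
    (fun T _ => (continuous_gradForm T _ _).continuousOn) fun T hT T' hT' x hx hx' => by
      have hg : ∀ z ∈ T, z ∈ T' → gradT w T z = gradT w T' z := fun z hz hz' =>
        hw.grad_continuous T hT T' hT' z hz hz'
      refine gradForm_eq_of_mem hT hT' hx hx' hg fun a ha ha' b hb hb' => ?_
      rw [trapezoidExcess, trapezoidExcess, hg a ha ha', hg b hb hb']
  refine ⟨θ, ⟨hθc, fun T hT i => ?_⟩, fun T hT z hz => ?_, fun T hT a ha b hb hab => ?_,
    fun T hT a ha b hb hab n hn hnab => ?_⟩
  · obtain ⟨p, hp, h⟩ := (polyFun_gradForm (T := T) (g := gradT w T)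
      (δ := trapezoidExcess w (gradT w T)) i).isPolyOn (tri T)
    exact ⟨p, hp, fun x hx => by rw [← h x hx]; simp only [hθ T hT hx]⟩
  · rw [hθ T hT (IsTri.vertex_mem hz), gradForm_vertex (isTri_of_mem_triangles hT) hz]
  · have hT' := isTri_of_mem_triangles hT
    have hn : ‖b - a‖ ≠ 0 := norm_ne_zero_iff.2 (sub_ne_zero.2 (Ne.symm hab))
    rw [inner_smul_right, inner_smul_right, gradT_midpoint hT' (hw.reducedCubic T hT).1 ha hb,
      hθ T hT (midpoint_mem_tri ha hb), gradForm_midpoint hT' (trapezoidExcess_symm _ _) ha hb,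
      inner_add_left, inner_smul_left, inner_smul_left, real_inner_self_eq_norm_sq]
    simp only [conj_trivial]
    field_simp
  · have hT' := isTri_of_mem_triangles hT
    rw [hθ T hT (midpoint_mem_tri ha hb), gradForm_midpoint hT' (trapezoidExcess_symm _ _) ha hb,
      inner_add_left, inner_smul_left, inner_smul_left, real_inner_comm n (b - a), hnab]
    simp

/-- On each triangle both candidates coincide with the same nodal formula. -/
lemma IsDiscreteGradient.eqOn (hK : IsTriangulation ω K) {w : Plane → ℝ} (hw : IsDKT ω K w)
    {θ θ' : Plane → Plane} (h : IsDiscreteGradient ω K w θ) (h' : IsDiscreteGradient ω K w θ') :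
    Set.EqOn θ θ' (closure ω) := by
  intro x hx
  obtain ⟨T, hT, hxT⟩ := (mem_closure_iff_exists hK).1 hx
  rw [h.eqOn_gradForm hw hT hxT, h'.eqOn_gradForm hw hT hxT]

/-- Existence of the nodal interpolant for given nodal values and gradients. -/
lemma exists_isDKT (hK : IsTriangulation ω K) (W : Plane → ℝ) (g : Plane → Plane) :
    ∃ v, IsDKT ω K v ∧ ∀ T ∈ triangles K, ∀ z ∈ T, v z = W z ∧ gradT v T z = g z := by
  obtain ⟨v, hvc, hv⟩ := exists_glue hK (F := fun T => dktForm T W (hermiteExcess W g))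
    (fun T hT => (polyFun_dktForm (isTri_of_mem_triangles hT)).continuous.continuousOn)
    fun T hT T' hT' x hx hx' => dktForm_eq_of_mem hT hT' hx hx'
  have h := fun T hT => isReducedCubicOn_of_eqOn (isTri_of_mem_triangles hT) (hv T hT)
  refine ⟨v, ⟨hvc, fun T hT => (h T hT).1, fun T hT T' hT' z hz hz' => ?_⟩, fun T hT => (h T hT).2⟩
  rw [((h T hT).2 z hz).2, ((h T' hT').2 z hz').2]

/-- The discrete gradient depends only on the nodal values and gradients. -/
lemma IsDiscreteGradient.eqOn_gradForm_of_nodal {v W : Plane → ℝ} {g : Plane → Plane}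
    {θ : Plane → Plane} (hv : IsDKT ω K v) (hθ : IsDiscreteGradient ω K v θ) (hT : T ∈ triangles K)
    (h : ∀ z ∈ T, v z = W z ∧ gradT v T z = g z) :
    Set.EqOn θ (gradForm T g (trapezoidExcess W g)) (tri T) := by
  intro x hx
  rw [hθ.eqOn_gradForm hv hT hx]
  exact gradForm_eq_of_mem hT hT hx hx (fun z hz _ => (h z hz).2) fun a ha _ b hb _ =>
    trapezoidExcess_congr (fun a ha => (h a ha).1) (fun a ha => (h a ha).2) ha hb

end

end

noncomputable section

/-! ### Averaged Taylor expansion and Poincaré inequality on convex sets -/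

/-- The linear functional with components `p`. -/
def coordForm (p : Fin 2 → ℝ) : Plane →L[ℝ] ℝ := ∑ j, p j • (EuclideanSpace.proj j : Plane →L[ℝ] ℝ)

@[simp] lemma coordForm_apply (p : Fin 2 → ℝ) (v : Plane) : coordForm p v = ∑ j, p j * v j := by
  simp [coordForm]

section

variable {S : Set Plane} {h : ℝ} {x y : Plane}

open scoped Pointwise in
-- A homothety with centre in a convex set and ratio at most one maps the set into itself; its
-- Jacobian in the plane is t².
lemma setIntegral_comp_homothety_le (hS : Convex ℝ S) (hc : IsCompact S) (hx : x ∈ S) {F : Plane → ℝ}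
    (hF : Continuous F) (h0 : ∀ z, 0 ≤ F z) {t : ℝ} (ht : 0 < t) (ht1 : t ≤ 1) :
    t ^ 2 * ∫ y in S, F (t • y + (1 - t) • x) ≤ ∫ y in S, F y := by
  have h1 := Measure.setIntegral_comp_smul_of_pos (volume : Measure Plane)
    (fun y => F (y + (1 - t) • x)) S ht
  simp only [finrank_euclideanSpace, Fintype.card_fin, smul_eq_mul] at h1
  rw [h1, ← mul_assoc, mul_inv_cancel₀ (by positivity), one_mul]
  set A : Set Plane := (fun z => z - (1 - t) • x) ⁻¹' (t • S) with hA
  have h2 := (measurePreserving_add_right (volume : Measure Plane) ((1 - t) • x)).setIntegral_preimage_emb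
    (MeasurableEquiv.addRight ((1 - t) • x)).measurableEmbedding F A
  have h3 : (fun z => z + (1 - t) • x) ⁻¹' A = t • S := by
    ext z
    simp [hA]
  rw [h3] at h2
  rw [h2]
  have hAS : A ⊆ S := by
    rintro z ⟨y, hy, hz⟩
    have : z = t • y + (1 - t) • x := by
      have hz' : t • y = z - (1 - t) • x := hz
      rw [hz']; abel
    rw [this]
    exact hS hy hx ht.le (by linarith) (by ring)
  exact setIntegral_mono_set (hF.continuousOn.integrableOn_compact hc)
    (Filter.Eventually.of_forall h0) hAS.eventuallyLE

/-- The choice `l = V / A` optimises Young's inequality and turns the family of linear bounds into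
one of Cauchy–Schwarz type. -/
lemma sq_le_mul_of_forall_le {A I V : ℝ} (hV : 0 < V) (hI : 0 ≤ I) (hA : 0 ≤ A)
    (h : ∀ l : ℝ, 0 < l → A ≤ 1 / 2 * (l * I + V / l)) : A ^ 2 ≤ V * I := by
  rcases hA.eq_or_lt with rfl | hA
  · simpa using mul_nonneg hV.le hI
  have := h (V / A) (by positivity)
  have e : V / (V / A) = A := by field_simp
  rw [e] at this
  have h2 : A * A ≤ V / A * I * A := by nlinarith
  have e2 : V / A * I * A = V * I := by field_simp
  nlinarith

/-- Nonnegativity of the variance on an interval of length one. -/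
lemma sq_intervalIntegral_le {φ : ℝ → ℝ} (hφ : Continuous φ) :
    (∫ s in (0 : ℝ)..1, φ s) ^ 2 ≤ ∫ s in (0 : ℝ)..1, φ s ^ 2 := by
  set m := ∫ s in (0 : ℝ)..1, φ s with hm
  have h0 : 0 ≤ ∫ s in (0 : ℝ)..1, (φ s - m) ^ 2 :=
    intervalIntegral.integral_nonneg zero_le_one fun _ _ => sq_nonneg _
  have h1 : ∫ s in (0 : ℝ)..1, (φ s - m) ^ 2 =
      (∫ s in (0 : ℝ)..1, φ s ^ 2) - 2 * m * m + m ^ 2 := by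
    have e : (fun s => (φ s - m) ^ 2) = fun s => φ s ^ 2 - 2 * m * φ s + m ^ 2 := by
      funext s; ring
    rw [e, intervalIntegral.integral_add, intervalIntegral.integral_sub,
      intervalIntegral.integral_const_mul, intervalIntegral.integral_const, ← hm]
    · simp
    all_goals exact Continuous.intervalIntegrable (by fun_prop) _ _
  nlinarith

lemma integral_swap_compact {A B : Set Plane} (hA : IsCompact A) (hB : IsCompact B)
    {F : Plane → Plane → ℝ} (hF : Continuous (Function.uncurry F)) :
    ∫ y in A, ∫ s in B, F y s = ∫ s in B, ∫ y in A, F y s := by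
  refine integral_integral_swap ?_
  rw [Measure.prod_restrict]
  exact hF.continuousOn.integrableOn_compact (hA.prod hB)

lemma integral_swap_interval {A : Set Plane} (hA : IsCompact A)
    {F : Plane → ℝ → ℝ} (hF : Continuous (Function.uncurry F)) :
    ∫ y in A, ∫ s in (0 : ℝ)..1, F y s = ∫ s in (0 : ℝ)..1, ∫ y in A, F y s := by
  simp only [intervalIntegral.integral_of_le zero_le_one, ← integral_Icc_eq_integral_Ioc]
  refine integral_integral_swap ?_
  rw [Measure.prod_restrict]
  exact hF.continuousOn.integrableOn_compact (hA.prod isCompact_Icc)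

lemma hasDerivAt_segment {u : Plane → ℝ} {u' : Fin 2 → Plane → ℝ} (y v : Plane) (s : ℝ)
    (h : HasFDerivAt u (coordForm fun j => u' j (y + s • v)) (y + s • v)) :
    HasDerivAt (fun s : ℝ => u (y + s • v)) (∑ j, u' j (y + s • v) * v j) s := by
  have h1 : HasDerivAt (fun s : ℝ => y + s • v) v s := by
    simpa using ((hasDerivAt_id s).smul_const v).const_add y
  have h2 := h.comp_hasDerivAt s h1
  rwa [coordForm_apply] at h2

lemma sum_mul_sq_le (p v : Fin 2 → ℝ) : (∑ j, p j * v j) ^ 2 ≤ (∑ j, p j ^ 2) * ∑ j, v j ^ 2 :=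
  Finset.sum_mul_sq_le_sq_mul_sq _ _ _

lemma sum_sq_eq_norm_sq (v : Plane) : ∑ j, v j ^ 2 = ‖v‖ ^ 2 := by
  rw [EuclideanSpace.norm_sq_eq]
  simp

/-- The first order averaged Taylor polynomial. -/
def avgTaylor (S : Set Plane) (u : Plane → ℝ) (u' : Fin 2 → Plane → ℝ) (x : Plane) : ℝ :=
  (volume.real S)⁻¹ * ∫ y in S, (u y + ∑ j, u' j y * (x j - y j))

/-- The uniform error of the averaged Taylor polynomial is controlled by the `L²` norm of the second
derivatives. -/
lemma sq_sub_avgTaylor_le (hS : Convex ℝ S) (hc : IsCompact S) (hV : 0 < volume.real S)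
    (hh : ∀ x ∈ S, ∀ y ∈ S, ‖x - y‖ ≤ h)
    {u : Plane → ℝ} {u' : Fin 2 → Plane → ℝ} {u'' : Fin 2 → Fin 2 → Plane → ℝ}
    (hu : Continuous u) (hu' : ∀ j, Continuous (u' j)) (hu'' : ∀ j k, Continuous (u'' j k))
    (hd : ∀ x ∈ S, HasFDerivAt u (coordForm fun j => u' j x) x)
    (hd' : ∀ j, ∀ x ∈ S, HasFDerivAt (u' j) (coordForm fun k => u'' j k x) x) (hx : x ∈ S) :
    (u x - avgTaylor S u u' x) ^ 2 ≤
      h ^ 4 * (volume.real S)⁻¹ * ∫ y in S, ∑ j, ∑ k, u'' j k y ^ 2 := by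
  set V := volume.real S
  set G : Plane → ℝ := fun y => ∑ j, ∑ k, u'' j k y ^ 2 with hG
  have hGc : Continuous G := by fun_prop
  have hG0 : ∀ z, 0 ≤ G z := fun z => Finset.sum_nonneg fun _ _ =>
    Finset.sum_nonneg fun _ _ => sq_nonneg _
  set I := ∫ y in S, G y
  have hI : 0 ≤ I := integral_nonneg hG0
  have hh0 : 0 ≤ h := (norm_nonneg _).trans (hh x hx x hx)
  have hseg : ∀ y ∈ S, ∀ s ∈ Set.Icc (0 : ℝ) 1, y + s • (x - y) ∈ S := fun y hy s hs => by
    have := hS hy hx (a := 1 - s) (b := s) (by linarith [hs.2]) hs.1 (by ring)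
    convert this using 1
    module
  -- the remainder
  have hrem : ∀ y ∈ S, ∀ l : ℝ, 0 < l → |u x - (u y + ∑ j, u' j y * (x j - y j))| ≤
      h ^ 2 * (1 / 2 * (∫ s in (0 : ℝ)..1, (l * ((1 - s) ^ 2 * G (y + s • (x - y))) + 1 / l))) := by
    intro y hy l hl
    set v := x - y with hv
    set φ'' : ℝ → ℝ := fun s => ∑ j, (∑ k, u'' j k (y + s • v) * v k) * v j with hφ''
    have hφc : Continuous φ'' := by
      simp only [hφ'']
      fun_prop
    -- The first order terms cancel in the derivative of this auxiliary function; the fundamental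
    -- theorem then gives the integral form of the Taylor remainder.
    have hder : ∀ s ∈ Set.uIcc (0 : ℝ) 1, HasDerivAt
        (fun s : ℝ => u (y + s • v) + (1 - s) * ∑ j, u' j (y + s • v) * v j)
        ((1 - s) * φ'' s) s := by
      intro s hs
      rw [Set.uIcc_of_le zero_le_one] at hs
      have hm := hseg y hy s hs
      have d0 := hasDerivAt_segment y v s (hd _ hm)
      have d1 : HasDerivAt (fun s : ℝ => ∑ j, u' j (y + s • v) * v j) (φ'' s) s := by
        refine HasDerivAt.fun_sum fun j _ => ?_
        exact (hasDerivAt_segment y v s (hd' j _ hm)).mul_const (v j)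
      have d2 : HasDerivAt (fun s : ℝ => 1 - s) (-1) s := by
        simpa using (hasDerivAt_id s).const_sub 1
      refine (d0.add (d2.mul d1)).congr_deriv ?_
      ring
    have hint := intervalIntegral.integral_eq_sub_of_hasDerivAt hder
      (Continuous.intervalIntegrable (by fun_prop) _ _)
    have e1 : u x - (u y + ∑ j, u' j y * (x j - y j)) = ∫ s in (0 : ℝ)..1, (1 - s) * φ'' s := by
      rw [hint]
      simp [hv]
    have hφb : ∀ s, φ'' s ^ 2 ≤ (h ^ 2) ^ 2 * G (y + s • v) := by
      intro s
      have b1 := sum_mul_sq_le (fun j => ∑ k, u'' j k (y + s • v) * v k) v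
      have b2 : ∑ j, (∑ k, u'' j k (y + s • v) * v k) ^ 2 ≤ G (y + s • v) * ∑ k, v k ^ 2 := by
        rw [hG, Finset.sum_mul]
        exact Finset.sum_le_sum fun j _ => sum_mul_sq_le _ _
      have hvn : ∑ k, v k ^ 2 ≤ h ^ 2 := by
        rw [sum_sq_eq_norm_sq]
        exact pow_le_pow_left₀ (norm_nonneg _) (hh x hx y hy) 2
      have hv0 : 0 ≤ ∑ k, v k ^ 2 := Finset.sum_nonneg fun _ _ => sq_nonneg _
      calc φ'' s ^ 2 ≤ _ := b1
        _ ≤ (G (y + s • v) * ∑ k, v k ^ 2) * ∑ k, v k ^ 2 := by gcongr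
        _ ≤ (G (y + s • v) * h ^ 2) * h ^ 2 := by
          have := hG0 (y + s • v)
          gcongr
        _ = _ := by ring
    have hpt : ∀ s, |(1 - s) * φ'' s| ≤
        h ^ 2 * (1 / 2 * (l * ((1 - s) ^ 2 * G (y + s • v)) + 1 / l)) := by
      intro s
      set q := √(G (y + s • v))
      have hq : q ^ 2 = G (y + s • v) := Real.sq_sqrt (hG0 _)
      have hφa : |φ'' s| ≤ h ^ 2 * q := by
        refine abs_le_of_sq_le_sq ?_ (by positivity)
        rw [mul_pow, hq]
        exact hφb s
      rw [abs_mul]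
      have a1 : |1 - s| * |φ'' s| ≤ h ^ 2 * (|1 - s| * q) := by
        calc |1 - s| * |φ'' s| ≤ |1 - s| * (h ^ 2 * q) := by gcongr
          _ = _ := by ring
      refine a1.trans (mul_le_mul_of_nonneg_left ?_ (by positivity))
      rw [← hq, ← sq_abs (1 - s), ← mul_pow]
      -- Young's inequality with parameter `l`, obtained from a nonnegative square.
      set r := |1 - s| * q
      have : 0 ≤ (l * r - 1) ^ 2 / l := by positivity
      have e : (l * r - 1) ^ 2 / l = l * r ^ 2 - 2 * r + 1 / l := by field_simp; ring
      linarith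
    rw [e1, ← intervalIntegral.integral_const_mul, ← intervalIntegral.integral_const_mul,
      ← Real.norm_eq_abs]
    refine (intervalIntegral.norm_integral_le_integral_norm zero_le_one).trans ?_
    refine intervalIntegral.integral_mono_on zero_le_one
      (Continuous.intervalIntegrable (by fun_prop) _ _)
      (Continuous.intervalIntegrable (by fun_prop) _ _) fun s _ => ?_
    rw [Real.norm_eq_abs]
    exact hpt s
  have hci : ∀ {F : Plane → ℝ}, Continuous F → IntegrableOn F S := fun hF =>
    hF.continuousOn.integrableOn_compact hc
  -- averaging
  have havg : u x - avgTaylor S u u' x =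
      V⁻¹ * ∫ y in S, (u x - (u y + ∑ j, u' j y * (x j - y j))) := by
    rw [integral_sub (hci (by fun_prop)) (hci (by fun_prop)), avgTaylor, mul_sub,
      setIntegral_const, smul_eq_mul, ← mul_assoc, inv_mul_cancel₀ hV.ne', one_mul]
  set D := |∫ y in S, (u x - (u y + ∑ j, u' j y * (x j - y j)))| with hD
  have hDl : ∀ l : ℝ, 0 < l → D ≤ h ^ 2 * (1 / 2 * (l * I + V / l)) := by
    intro l hl
    have hcont : Continuous (Function.uncurry fun (y : Plane) (s : ℝ) =>
        l * ((1 - s) ^ 2 * G (y + s • (x - y))) + 1 / l) := by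
      have : Continuous fun p : Plane × ℝ => G (p.1 + p.2 • (x - p.1)) := hGc.comp (by fun_prop)
      simp only [Function.uncurry_def]
      fun_prop
    have hcont' : Continuous fun y : Plane => ∫ s in (0 : ℝ)..1,
        (l * ((1 - s) ^ 2 * G (y + s • (x - y))) + 1 / l) :=
      intervalIntegral.continuous_parametric_intervalIntegral_of_continuous' hcont 0 1
    have b1 : D ≤ ∫ y in S, h ^ 2 * (1 / 2 * (∫ s in (0 : ℝ)..1,
        (l * ((1 - s) ^ 2 * G (y + s • (x - y))) + 1 / l))) := by
      rw [hD, ← Real.norm_eq_abs]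
      refine (norm_integral_le_integral_norm _).trans ?_
      refine setIntegral_mono_on (hci (by fun_prop)) (hci (by fun_prop)) hc.measurableSet
        fun y hy => ?_
      rw [Real.norm_eq_abs]
      exact hrem y hy l hl
    refine b1.trans ?_
    rw [integral_const_mul, integral_const_mul, integral_swap_interval hc hcont]
    refine mul_le_mul_of_nonneg_left (mul_le_mul_of_nonneg_left ?_ (by norm_num)) (by positivity)
    -- The weight (1 - s)² of the remainder is exactly the Jacobian of the homothety towards `x`
    -- with ratio 1 - s, so the degeneration as s tends to 1 does no harm.
    have b2 : ∀ s ∈ Set.Ioo (0 : ℝ) 1, ∫ y in S, (l * ((1 - s) ^ 2 * G (y + s • (x - y))) + 1 / l) ≤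
        l * I + V / l := by
      intro s hs
      rw [integral_add (hci (by fun_prop)) (hci (by fun_prop)), setIntegral_const,
        integral_const_mul, integral_const_mul]
      have := setIntegral_comp_homothety_le hS hc hx hGc hG0 (t := 1 - s) (by linarith [hs.2])
        (by linarith [hs.1])
      have e : ∀ y : Plane, y + s • (x - y) = (1 - s) • y + (1 - (1 - s)) • x := fun y => by module
      simp only [e]
      have e2 : V • (1 / l) = V / l := by rw [smul_eq_mul]; ring
      have e3 : volume.real S • (1 / l) = V / l := e2
      rw [e3]
      gcongr
    calc ∫ s in (0 : ℝ)..1, ∫ y in S, (l * ((1 - s) ^ 2 * G (y + s • (x - y))) + 1 / l)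
        ≤ ∫ s in (0 : ℝ)..1, (l * I + V / l) := by
          refine intervalIntegral.integral_mono_on_of_le_Ioo zero_le_one ?_
            (Continuous.intervalIntegrable (by fun_prop) _ _) b2
          refine Continuous.intervalIntegrable ?_ _ _
          refine continuous_parametric_integral_of_continuous ?_ hc
          exact hcont.comp continuous_swap
      _ = l * I + V / l := by simp
  have hfin : D ^ 2 ≤ V * (h ^ 4 * I) := by
    rcases hh0.eq_or_lt with h0 | hpos
    · have := hDl 1 one_pos
      rw [← h0] at this ⊢
      have hD0 : D = 0 := le_antisymm (by simpa using this) (abs_nonneg _)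
      rw [hD0]; simp
    have := sq_le_mul_of_forall_le (A := D / h ^ 2) hV hI (by positivity) fun l hl => by
      rw [div_le_iff₀ (by positivity), mul_comm]
      exact hDl l hl
    rw [div_pow, div_le_iff₀ (by positivity)] at this
    calc D ^ 2 ≤ _ := this
      _ = _ := by ring
  rw [havg, mul_pow, ← sq_abs (∫ y in S, _), ← hD]
  calc V⁻¹ ^ 2 * D ^ 2 ≤ V⁻¹ ^ 2 * (V * (h ^ 4 * I)) := by gcongr
    _ = _ := by field_simp

/-- The Poincaré inequality on convex sets, for the mean value `m` of `f`. -/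
lemma poincare_convex (hS : Convex ℝ S) (hc : IsCompact S) (hV : 0 < volume.real S)
    (hh : ∀ x ∈ S, ∀ y ∈ S, ‖x - y‖ ≤ h)
    {f : Plane → ℝ} {f' : Fin 2 → Plane → ℝ} (hf : Continuous f) (hf' : ∀ j, Continuous (f' j))
    (hd : ∀ x ∈ S, HasFDerivAt f (coordForm fun j => f' j x) x) :
    ∫ x in S, (f x - (volume.real S)⁻¹ * ∫ y in S, f y) ^ 2 ≤
      2 * h ^ 2 * ∫ x in S, ∑ j, f' j x ^ 2 := by
  set V := volume.real S
  set J : Plane → ℝ := fun y => ∑ j, f' j y ^ 2 with hJ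
  have hJc : Continuous J := by fun_prop
  have hJ0 : ∀ z, 0 ≤ J z := fun z => Finset.sum_nonneg fun _ _ => sq_nonneg _
  set I := ∫ y in S, J y
  have hI : 0 ≤ I := integral_nonneg hJ0
  have hci : ∀ {F : Plane → ℝ}, Continuous F → IntegrableOn F S := fun hF =>
    hF.continuousOn.integrableOn_compact hc
  set mid : Plane → Plane → Plane := fun x y => (1 / 2 : ℝ) • (x + y) with hmid
  -- half segments, integrated over the near end point
  have hhalf : ∀ y ∈ S, ∫ x in S, (f x - f (mid x y)) ^ 2 ≤ h ^ 2 * I := by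
    intro y hy
    have hpt : ∀ x ∈ S, (f x - f (mid x y)) ^ 2 ≤
        h ^ 2 / 4 * ∫ s in (0 : ℝ)..1, J (x + s • ((1 / 2 : ℝ) • (y - x))) := by
      intro x hx
      set v : Plane := (1 / 2 : ℝ) • (y - x) with hv
      have hseg : ∀ s ∈ Set.Icc (0 : ℝ) 1, x + s • v ∈ S := fun s hs => by
        have := hS hx hy (a := 1 - s / 2) (b := s / 2) (by linarith [hs.2]) (by linarith [hs.1])
          (by ring)
        convert this using 1
        rw [hv]
        module
      have hint := intervalIntegral.integral_eq_sub_of_hasDerivAt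
        (fun s hs => hasDerivAt_segment (u := f) (u' := f') x v s
          (hd _ (hseg s (by rwa [Set.uIcc_of_le zero_le_one] at hs))))
        (Continuous.intervalIntegrable (by fun_prop) 0 1)
      have e : x + (1 : ℝ) • v = mid x y := by simp only [hv, hmid]; module
      rw [e, zero_smul, add_zero] at hint
      have e2 : (f x - f (mid x y)) ^ 2 = (f (mid x y) - f x) ^ 2 := by ring
      rw [e2, ← hint]
      refine (sq_intervalIntegral_le (by fun_prop)).trans ?_
      rw [← intervalIntegral.integral_const_mul]
      refine intervalIntegral.integral_mono_on zero_le_one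
        (Continuous.intervalIntegrable (by fun_prop) _ _)
        (Continuous.intervalIntegrable (by fun_prop) _ _) fun s _ => ?_
      refine (sum_mul_sq_le (fun j => f' j (x + s • v)) v).trans ?_
      have hvn : ∑ k, v k ^ 2 ≤ h ^ 2 / 4 := by
        rw [sum_sq_eq_norm_sq, hv, norm_smul, mul_pow]
        have := pow_le_pow_left₀ (norm_nonneg _) (hh y hy x hx) 2
        norm_num
        linarith
      rw [mul_comm]
      exact mul_le_mul_of_nonneg_right hvn (hJ0 _)
    have hcont : Continuous (Function.uncurry fun (x : Plane) (s : ℝ) =>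
        J (x + s • ((1 / 2 : ℝ) • (y - x)))) := by
      simp only [Function.uncurry_def]
      fun_prop
    have hcont' : Continuous fun x : Plane => ∫ s in (0 : ℝ)..1,
        J (x + s • ((1 / 2 : ℝ) • (y - x))) :=
      intervalIntegral.continuous_parametric_intervalIntegral_of_continuous' hcont 0 1
    calc ∫ x in S, (f x - f (mid x y)) ^ 2
        ≤ ∫ x in S, h ^ 2 / 4 * ∫ s in (0 : ℝ)..1, J (x + s • ((1 / 2 : ℝ) • (y - x))) :=
          setIntegral_mono_on (hci (by fun_prop)) (hci (by fun_prop)) hc.measurableSet hpt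
      _ = h ^ 2 / 4 * ∫ s in (0 : ℝ)..1, ∫ x in S, J (x + s • ((1 / 2 : ℝ) • (y - x))) := by
          rw [integral_const_mul, integral_swap_interval hc hcont]
      _ ≤ h ^ 2 / 4 * ∫ s in (0 : ℝ)..1, 4 * I := by
          refine mul_le_mul_of_nonneg_left ?_ (by positivity)
          refine intervalIntegral.integral_mono_on zero_le_one ?_
            (Continuous.intervalIntegrable (by fun_prop) _ _) fun s hs => ?_
          · refine Continuous.intervalIntegrable ?_ _ _
            refine continuous_parametric_integral_of_continuous ?_ hc
            exact hcont.comp continuous_swap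
          · have e : ∀ x : Plane, x + s • ((1 / 2 : ℝ) • (y - x)) =
                (1 - s / 2) • x + (1 - (1 - s / 2)) • y := fun x => by module
            simp only [e]
            have h1 := setIntegral_comp_homothety_le hS hc hy hJc hJ0 (t := 1 - s / 2)
              (by linarith [hs.2]) (by linarith [hs.1])
            have h2 : 0 ≤ ∫ x in S, J ((1 - s / 2) • x + (1 - (1 - s / 2)) • y) :=
              integral_nonneg fun _ => hJ0 _
            -- Only half of the segment is traversed, so the homothety ratio stays at least 1/2 and
            -- its Jacobian at least 1/4.
            have h3 : (1 / 4 : ℝ) ≤ (1 - s / 2) ^ 2 := by nlinarith [hs.1, hs.2]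
            have h4 := mul_le_mul_of_nonneg_right h3 h2
            change _ ≤ 4 * I
            linarith
      _ = h ^ 2 * I := by simp; ring
  have hmidc : Continuous (Function.uncurry mid) := by
    simp only [hmid, Function.uncurry_def]
    fun_prop
  have hmidc1 : ∀ y, Continuous fun x => mid x y := fun y => by
    simp only [hmid]; fun_prop
  -- The segment from `x` to `y` is cut at its midpoint, and each half is integrated first over its
  -- own end point; exchanging `x` and `y` relates the two halves.
  have hfull : ∫ y in S, ∫ x in S, (f x - f y) ^ 2 ≤ 4 * V * (h ^ 2 * I) := by
    have c1 : Continuous (Function.uncurry fun y x : Plane => (f x - f (mid x y)) ^ 2) := by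
      simp only [Function.uncurry_def]
      have : Continuous fun p : Plane × Plane => mid p.2 p.1 := hmidc.comp continuous_swap
      fun_prop
    have c2 : Continuous (Function.uncurry fun y x : Plane => (f y - f (mid x y)) ^ 2) := by
      simp only [Function.uncurry_def]
      have : Continuous fun p : Plane × Plane => mid p.2 p.1 := hmidc.comp continuous_swap
      fun_prop
    have c3 : Continuous (Function.uncurry fun y x : Plane => (f x - f y) ^ 2) := by
      simp only [Function.uncurry_def]
      fun_prop
    have k1 := continuous_parametric_integral_of_continuous (μ := (volume : Measure Plane)) c1 hc
    have k2 := continuous_parametric_integral_of_continuous (μ := (volume : Measure Plane)) c2 hc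
    have k3 := continuous_parametric_integral_of_continuous (μ := (volume : Measure Plane)) c3 hc
    have b1 : ∫ y in S, ∫ x in S, (f x - f (mid x y)) ^ 2 ≤ V * (h ^ 2 * I) := by
      calc _ ≤ ∫ y in S, h ^ 2 * I :=
            setIntegral_mono_on (hci k1) (hci continuous_const) hc.measurableSet hhalf
        _ = _ := by rw [setIntegral_const, smul_eq_mul]
    have b2 : ∫ y in S, ∫ x in S, (f y - f (mid x y)) ^ 2 ≤ V * (h ^ 2 * I) := by
      rw [integral_swap_compact hc hc c2]
      refine le_trans (le_of_eq ?_) b1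
      have : ∀ x y, mid x y = mid y x := fun x y => by simp only [hmid, add_comm]
      simp only [this]
    calc ∫ y in S, ∫ x in S, (f x - f y) ^ 2
        ≤ ∫ y in S, (2 * (∫ x in S, (f x - f (mid x y)) ^ 2) +
            2 * ∫ x in S, (f y - f (mid x y)) ^ 2) := by
          refine setIntegral_mono_on (hci k3) (hci (by fun_prop)) hc.measurableSet fun y _ => ?_
          have := hmidc1 y
          rw [← integral_const_mul, ← integral_const_mul,
            ← integral_add (hci (by fun_prop)) (hci (by fun_prop))]
          refine setIntegral_mono_on (hci (by fun_prop)) (hci (by fun_prop)) hc.measurableSet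
            fun x _ => ?_
          nlinarith [sq_nonneg ((f x - f (mid x y)) + (f y - f (mid x y)))]
      _ ≤ 4 * V * (h ^ 2 * I) := by
          rw [integral_add (hci (by fun_prop)) (hci (by fun_prop)), integral_const_mul,
            integral_const_mul]
          linarith
  set A := ∫ y in S, f y with hA
  set B := ∫ y in S, f y ^ 2 with hB
  -- The double integral is 2V times the squared distance from the mean value, so the bound on
  -- differences is the Poincaré inequality.
  have e1 : ∫ y in S, ∫ x in S, (f x - f y) ^ 2 = 2 * V * B - 2 * A ^ 2 := by
    have : ∀ y, ∫ x in S, (f x - f y) ^ 2 = B - 2 * f y * A + V * f y ^ 2 := fun y => by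
      have e : (fun x => (f x - f y) ^ 2) = fun x => f x ^ 2 - 2 * f y * f x + f y ^ 2 := by
        funext x; ring
      rw [e, integral_add (hci (by fun_prop)) (hci (by fun_prop)),
        integral_sub (hci (by fun_prop)) (hci (by fun_prop)), integral_const_mul,
        setIntegral_const, smul_eq_mul]
    simp only [this]
    rw [integral_add (hci (by fun_prop)) (hci (by fun_prop)),
        integral_sub (hci (by fun_prop)) (hci (by fun_prop)), integral_const_mul,
        setIntegral_const, smul_eq_mul, integral_mul_const, integral_const_mul, ← hA, ← hB]
    change V * B - 2 * A * A + V * B = _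
    ring
  have e2 : ∫ x in S, (f x - V⁻¹ * A) ^ 2 = B - V⁻¹ * A ^ 2 := by
    have e : (fun x => (f x - V⁻¹ * A) ^ 2) =
        fun x => f x ^ 2 - 2 * (V⁻¹ * A) * f x + (V⁻¹ * A) ^ 2 := by
      funext x; ring
    rw [e, integral_add (hci (by fun_prop)) (hci (by fun_prop)),
        integral_sub (hci (by fun_prop)) (hci (by fun_prop)), integral_const_mul,
        setIntegral_const, smul_eq_mul, ← hA, ← hB]
    change B - 2 * (V⁻¹ * A) * A + V * (V⁻¹ * A) ^ 2 = _
    field_simp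
    ring
  rw [e1] at hfull
  rw [e2]
  have h5 : V * (B - V⁻¹ * A ^ 2) ≤ V * (2 * h ^ 2 * I) := by
    have : V * (B - V⁻¹ * A ^ 2) = V * B - A ^ 2 := by field_simp
    rw [this]
    linarith
  exact le_of_mul_le_mul_left h5 hV

end

end

noncomputable section

/-! ### The scalar `L²` norm -/

/-- The `L²` norm of a real function. -/
def l2n {X : Type*} [MeasurableSpace X] (μ : Measure X) (f : X → ℝ) : ℝ := (eLpNorm f 2 μ).toReal

section

variable {X : Type*} [MeasurableSpace X] {μ : Measure X} {f g : X → ℝ}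

lemma l2n_nonneg : 0 ≤ l2n μ f := ENNReal.toReal_nonneg

/-- Link between `eLpNorm`, which supplies the triangle inequality, and the integrals of squares in
the inequalities for smooth functions. -/
lemma l2n_sq (hf : MemLp f 2 μ) : l2n μ f ^ 2 = ∫ x, f x ^ 2 ∂μ := by
  rw [l2n, hf.eLpNorm_eq_integral_rpow_norm (by norm_num) (by norm_num),
    ENNReal.toReal_ofReal (by positivity), ← Real.rpow_natCast, ← Real.rpow_mul (by positivity)]
  simp

lemma l2n_add_le (hf : MemLp f 2 μ) (hg : MemLp g 2 μ) :
    l2n μ (fun x => f x + g x) ≤ l2n μ f + l2n μ g := by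
  rw [l2n, l2n, l2n, ← ENNReal.toReal_add hf.2.ne hg.2.ne]
  exact ENNReal.toReal_mono (ENNReal.add_ne_top.2 ⟨hf.2.ne, hg.2.ne⟩)
    (eLpNorm_add_le hf.1 hg.1 (by norm_num))

lemma l2n_const_mul (c : ℝ) (f : X → ℝ) : l2n μ (fun x => c * f x) = |c| * l2n μ f := by
  have : (fun x => c * f x) = c • f := rfl
  rw [l2n, l2n, this, eLpNorm_const_smul, ENNReal.toReal_mul]
  simp

lemma l2n_congr (h : f =ᵐ[μ] g) : l2n μ f = l2n μ g := by
  rw [l2n, l2n, eLpNorm_congr_ae h]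

lemma l2n_sub_comm (f g : X → ℝ) : l2n μ (fun x => f x - g x) = l2n μ (fun x => g x - f x) := by
  have : (fun x => f x - g x) = fun x => (-1) * (g x - f x) := by funext x; ring
  rw [this, l2n_const_mul]
  simp

lemma l2n_sub_le {k : X → ℝ} (hf : MemLp f 2 μ) (hg : MemLp g 2 μ) (hk : MemLp k 2 μ) :
    l2n μ (fun x => f x - k x) ≤ l2n μ (fun x => f x - g x) + l2n μ (fun x => g x - k x) := by
  have : (fun x => f x - k x) = fun x => (f x - g x) + (g x - k x) := by funext x; ring
  rw [this]
  exact l2n_add_le (hf.sub hg) (hg.sub hk)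

lemma abs_l2n_sub_le (hf : MemLp f 2 μ) (hg : MemLp g 2 μ) :
    |l2n μ f - l2n μ g| ≤ l2n μ (fun x => f x - g x) := by
  have h1 : l2n μ f ≤ l2n μ (fun x => f x - g x) + l2n μ g := by
    have : f = fun x => (f x - g x) + g x := by funext x; ring
    conv_lhs => rw [this]
    exact l2n_add_le (hf.sub hg) hg
  have h2 : l2n μ g ≤ l2n μ (fun x => f x - g x) + l2n μ f := by
    have : g = fun x => (g x - f x) + f x := by funext x; ring
    conv_lhs => rw [this]
    rw [l2n_sub_comm f g]
    exact l2n_add_le (hg.sub hf) hf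
  rw [abs_le]
  constructor <;> linarith

/-- The mean value is controlled by the `L²` norm. -/
lemma abs_integral_le_l2n [IsFiniteMeasure μ] (hf : MemLp f 2 μ) :
    |∫ x, f x ∂μ| ≤ √(μ.real Set.univ) * l2n μ f := by
  refine Real.abs_le_sqrt (x := ∫ x, f x ∂μ) (y := μ.real Set.univ * l2n μ f ^ 2) ?_ |>.trans
    (le_of_eq ?_)
  · rw [l2n_sq hf]
    set m := ∫ x, f x ∂μ
    set V := μ.real Set.univ
    have hfi : Integrable f μ := hf.integrable (by norm_num)
    have hV : 0 ≤ V := measureReal_nonneg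
    have key : 0 ≤ ∫ x, (V * f x - m) ^ 2 ∂μ := integral_nonneg fun _ => sq_nonneg _
    have e : (fun x => (V * f x - m) ^ 2) = fun x => V ^ 2 * f x ^ 2 - 2 * V * m * f x + m ^ 2 := by
      funext x; ring
    have i1 : Integrable (fun x => V ^ 2 * f x ^ 2 - 2 * V * m * f x) μ :=
      (hf.integrable_sq.const_mul _).sub (hfi.const_mul _)
    rw [e, integral_add i1 (integrable_const _), integral_sub (hf.integrable_sq.const_mul _) (hfi.const_mul _),
      integral_const_mul, integral_const_mul, integral_const, smul_eq_mul] at key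
    change 0 ≤ V ^ 2 * (∫ x, f x ^ 2 ∂μ) - 2 * V * m * m + V * m ^ 2 at key
    -- The square gives the estimate multiplied by the total mass; the zero measure is treated apart
    -- before cancelling.
    rcases hV.eq_or_lt with h0 | hpos
    · have : μ = 0 := by
        rw [← Measure.measure_univ_eq_zero]
        exact (measureReal_eq_zero_iff).1 h0.symm
      have hm : m = 0 := by simp only [m, this, integral_zero_measure]
      rw [hm, ← h0]; simp
    · have : 0 ≤ V * (V * (∫ x, f x ^ 2 ∂μ) - m ^ 2) := by linarith
      linarith [nonneg_of_mul_nonneg_right this hpos]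
  · rw [Real.sqrt_mul measureReal_nonneg, Real.sqrt_sq l2n_nonneg]

end

/-! ### Mollification -/

/-- Mollification of `f` with the bump function `φ`. -/
def moll (φ : ContDiffBump (0 : Plane)) (f : Plane → ℝ) : Plane → ℝ :=
  convolution (φ.normed volume) f (ContinuousLinearMap.lsmul ℝ ℝ) volume

section

variable {φ : ContDiffBump (0 : Plane)} {f g : Plane → ℝ}

lemma moll_apply (φ : ContDiffBump (0 : Plane)) (f : Plane → ℝ) (x : Plane) :
    moll φ f x = ∫ t, φ.normed volume t * f (x - t) := rfl

lemma continuous_moll (hf : LocallyIntegrable f) : Continuous (moll φ f) :=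
  φ.hasCompactSupport_normed.continuous_convolution_left _ φ.continuous_normed hf

lemma integrable_moll (hf : LocallyIntegrable f) (x : Plane) :
    Integrable fun t => φ.normed volume t * f (x - t) :=
  φ.hasCompactSupport_normed.convolutionExists_left (ContinuousLinearMap.lsmul ℝ ℝ)
    φ.continuous_normed hf x

lemma moll_sub (hf : LocallyIntegrable f) (hg : LocallyIntegrable g) (x : Plane) :
    moll φ (fun y => f y - g y) x = moll φ f x - moll φ g x := by
  simp only [moll_apply]
  rw [← integral_sub (integrable_moll hf x) (integrable_moll hg x)]
  simp only [mul_sub]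

lemma memLp_locallyIntegrable (hf : MemLp f 2 (volume : Measure Plane)) : LocallyIntegrable f :=
  hf.locallyIntegrable (by norm_num)

/-- Jensen's inequality for the probability density `φ.normed volume`, in the form that a variance
is nonnegative. -/
lemma sq_moll_le (hf : MemLp f 2 (volume : Measure Plane)) (x : Plane) :
    moll φ f x ^ 2 ≤ moll φ (fun y => f y ^ 2) x := by
  have hfl := memLp_locallyIntegrable hf
  have hfl2 : LocallyIntegrable fun y => f y ^ 2 := hf.integrable_sq.locallyIntegrable
  have i1 := integrable_moll (φ := φ) hfl x
  have i2 := integrable_moll (φ := φ) hfl2 x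
  have i3 := φ.integrable_normed (μ := volume)
  set m := moll φ f x with hm
  have key : 0 ≤ ∫ t, φ.normed volume t * (f (x - t) - m) ^ 2 :=
    integral_nonneg fun t => mul_nonneg (φ.nonneg_normed t) (sq_nonneg _)
  have e : (fun t => φ.normed volume t * (f (x - t) - m) ^ 2) = fun t =>
      φ.normed volume t * f (x - t) ^ 2 - 2 * m * (φ.normed volume t * f (x - t)) +
        φ.normed volume t * m ^ 2 := by funext t; ring
  have i4 : Integrable fun t => φ.normed volume t * f (x - t) ^ 2 -
      2 * m * (φ.normed volume t * f (x - t)) := i2.sub (i1.const_mul _)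
  rw [e, integral_add i4 (i3.mul_const _), integral_sub i2 (i1.const_mul _),
    integral_const_mul, integral_mul_const, φ.integral_normed, ← moll_apply φ f x, ← hm] at key
  rw [moll_apply φ (fun y => f y ^ 2)]
  linarith

/-- The pointwise Jensen inequality integrates to an L² contraction, because convolution with a
kernel of mass one preserves integrals. -/
lemma integral_sq_moll_le (hf : MemLp f 2 (volume : Measure Plane)) :
    ∫ x, moll φ f x ^ 2 ≤ ∫ x, f x ^ 2 := by
  have h1 : Integrable (moll φ fun y => f y ^ 2) :=
    φ.integrable_normed.integrable_convolution _ hf.integrable_sq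
  refine (integral_mono_of_nonneg (Filter.Eventually.of_forall fun x => sq_nonneg _) h1
    (Filter.Eventually.of_forall fun x => sq_moll_le hf x)).trans (le_of_eq ?_)
  rw [moll, integral_convolution _ φ.integrable_normed hf.integrable_sq, φ.integral_normed]
  simp

lemma memLp_moll (hf : MemLp f 2 (volume : Measure Plane)) :
    MemLp (moll φ f) 2 (volume : Measure Plane) := by
  have hc := continuous_moll (φ := φ) (memLp_locallyIntegrable hf)
  refine (memLp_two_iff_integrable_sq hc.aestronglyMeasurable).2 ?_
  refine (φ.integrable_normed.integrable_convolution (ContinuousLinearMap.lsmul ℝ ℝ)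
    hf.integrable_sq).mono' (hc.pow 2).aestronglyMeasurable (Filter.Eventually.of_forall fun x => ?_)
  rw [Real.norm_of_nonneg (sq_nonneg _)]
  exact sq_moll_le hf x

/-- A test function of the smaller set is one of the larger set, and both integrands vanish off its
support. -/
lemma hasWeakPartial_mono {U V : Set Plane} (hU : IsOpen U) (hVU : V ⊆ U) {i : Fin 2}
    (h : HasWeakPartial U i f g) : HasWeakPartial V i f g := by
  intro ψ hψ hψc hψV
  have h0 : ∀ x, x ∉ tsupport ψ → ψ x = 0 ∧ fderiv ℝ ψ x = 0 := fun x hx =>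
    ⟨image_eq_zero_of_notMem_tsupport hx, image_eq_zero_of_notMem_tsupport fun h =>
      hx (tsupport_fderiv_subset ℝ h)⟩
  have key : ∀ F : Plane → ℝ, (∀ x, x ∉ tsupport ψ → F x = 0) → ∫ x in V, F x = ∫ x in U, F x :=
    fun F hF => (setIntegral_eq_of_subset_of_forall_sdiff_eq_zero hU.measurableSet hVU
      fun x hx => hF x fun h => hx.2 (hψV h)).symm
  rw [key _ fun x hx => by rw [(h0 x hx).2]; simp, key _ fun x hx => by rw [(h0 x hx).1]; simp]
  exact h ψ hψ hψc (hψV.trans hVU)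

/-- The derivative of a mollification in terms of the weak derivatives. -/
lemma hasFDerivAt_moll {S : Set Plane} {g : Fin 2 → Plane → ℝ}
    (hf : LocallyIntegrable (S.indicator f))
    (hw : ∀ j, HasWeakPartial (interior S) j f (g j)) {z : Plane}
    (hz : Metric.closedBall z φ.rOut ⊆ interior S) :
    HasFDerivAt (moll φ (S.indicator f))
      (coordForm fun j => moll φ (S.indicator (g j)) z) z := by
  have hφ : ContDiff ℝ (⊤ : ℕ∞) (φ.normed volume) := φ.contDiff_normed
  have h1 := φ.hasCompactSupport_normed.hasFDerivAt_convolution_left (𝕜 := ℝ) (μ := volume)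
    (ContinuousLinearMap.lsmul ℝ ℝ) (hφ.of_le (by simp)) hf z
  refine h1.congr_fderiv ?_
  have hint := (φ.hasCompactSupport_normed (μ := volume).fderiv ℝ).convolutionExists_left
    ((ContinuousLinearMap.lsmul ℝ ℝ).precompL Plane) (hφ.continuous_fderiv (by simp)) hf z
  -- the test function
  set ψ : Plane → ℝ := fun y => φ.normed volume (z - y) with hψ
  have hψs : ContDiff ℝ (⊤ : ℕ∞) ψ := hφ.comp (contDiff_const.sub contDiff_id)
  have hsup : tsupport ψ ⊆ Metric.closedBall z φ.rOut := by
    refine closure_minimal (fun y hy => ?_) Metric.isClosed_closedBall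
    have : z - y ∈ Function.support (φ.normed volume) := hy
    rw [φ.support_normed_eq, mem_ball_zero_iff] at this
    rw [mem_closedBall_iff_norm, norm_sub_rev]
    exact this.le
  have hψc : HasCompactSupport ψ := (isCompact_closedBall z φ.rOut).of_isClosed_subset
    (isClosed_tsupport ψ) hsup
  have hψd : ∀ y v, fderiv ℝ ψ y v = -fderiv ℝ (φ.normed volume) (z - y) v := by
    intro y v
    have hd : HasFDerivAt (φ.normed volume) (fderiv ℝ (φ.normed volume) (z - y)) (z - y) :=
      (hφ.differentiable (by simp) _).hasFDerivAt
    have h2 : HasFDerivAt (fun y => z - y) (-ContinuousLinearMap.id ℝ Plane) y := by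
      simpa using! (hasFDerivAt_id y).const_sub z
    have := (hd.comp y h2).fderiv
    change (fderiv ℝ ((φ.normed volume) ∘ fun y => z - y) y) v = _
    rw [this]
    simp
  have hind : ∀ F G : Plane → ℝ, (∀ y, y ∉ tsupport ψ → G y = 0) →
      ∫ y, G y * S.indicator F y = ∫ y in interior S, F y * G y := by
    intro F G hG
    rw [← integral_indicator isOpen_interior.measurableSet]
    refine integral_congr_ae (Filter.Eventually.of_forall fun y => ?_)
    simp only
    by_cases hy : y ∈ tsupport ψ
    · have hyS := hz (hsup hy)
      rw [Set.indicator_of_mem hyS, Set.indicator_of_mem (interior_subset hyS), mul_comm]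
    · rw [hG y hy, zero_mul]
      by_cases hyS : y ∈ interior S
      · rw [Set.indicator_of_mem hyS, hG y hy, mul_zero]
      · rw [Set.indicator_of_notMem hyS]
  -- The derivative falls on the mollifier; the weak derivative identity moves it back to `f`.
  -- Reflection and the minus sign of integration by parts cancel.
  have key : ∀ j, (convolution (fderiv ℝ (φ.normed volume)) (S.indicator f)
      ((ContinuousLinearMap.lsmul ℝ ℝ).precompL Plane) volume z) (EuclideanSpace.single j 1) =
      moll φ (S.indicator (g j)) z := by
    intro j
    have hw' := hw j ψ hψs hψc (hsup.trans hz)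
    rw [convolution_def, ContinuousLinearMap.integral_apply hint]
    have e1 : ∀ t, (((ContinuousLinearMap.lsmul ℝ ℝ).precompL Plane) (fderiv ℝ (φ.normed volume) t)
        (S.indicator f (z - t))) (EuclideanSpace.single j 1) =
        fderiv ℝ (φ.normed volume) t (EuclideanSpace.single j 1) * S.indicator f (z - t) := by
      intro t
      simp [ContinuousLinearMap.precompL_apply]
    simp only [e1]
    rw [← integral_sub_left_eq_self _ volume z]
    simp only [sub_sub_cancel]
    have e2 : ∀ y, fderiv ℝ (φ.normed volume) (z - y) (EuclideanSpace.single j 1) *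
        S.indicator f y = -(fderiv ℝ ψ y (EuclideanSpace.single j 1) * S.indicator f y) := by
      intro y
      rw [hψd]; ring
    simp only [e2]
    rw [integral_neg, hind f (fun y => fderiv ℝ ψ y (EuclideanSpace.single j 1)) fun y hy => by
      rw [image_eq_zero_of_notMem_tsupport fun h => hy (tsupport_fderiv_subset ℝ h)]; simp]
    rw [hw', neg_neg, moll_apply, ← integral_sub_left_eq_self _ volume z]
    simp only [sub_sub_cancel]
    rw [← hind (g j) ψ fun y hy => image_eq_zero_of_notMem_tsupport hy]
  refine ContinuousLinearMap.ext fun v => ?_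
  conv_lhs => rw [Plane.eq_coord v, map_add, map_smul, map_smul, key, key]
  rw [coordForm_apply, Fin.sum_univ_two]
  simp [mul_comm]

end

end

noncomputable section

/-! ### Approximation of Sobolev functions on convex bodies -/

open Filter Topology

/-- `S` is a compact convex set containing the disc of radius `r` about `c`. -/
structure IsBody (S : Set Plane) (c : Plane) (r : ℝ) : Prop where
  convex : Convex ℝ S
  isCompact : IsCompact S
  pos : 0 < r
  ball : Metric.closedBall c r ⊆ S

/-- The bump functions used for mollification at distance `r`. -/
def mollBump {r : ℝ} (hr : 0 < r) (n : ℕ) : ContDiffBump (0 : Plane) where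
  rIn := r / (4 * (n + 2))
  rOut := r / (2 * (n + 2))
  rIn_pos := by positivity
  rIn_lt_rOut := by
    apply div_lt_div_of_pos_left hr (by positivity)
    have : (0 : ℝ) < n + 2 := by positivity
    linarith

/-- The contraction factors used for mollification. -/
def mollFactor (n : ℕ) : ℝ := 1 - 1 / ((n : ℝ) + 2)

lemma mollFactor_pos (n : ℕ) : 0 < mollFactor n := by
  rw [mollFactor, sub_pos, div_lt_one (by positivity)]
  have : (0 : ℝ) ≤ n := by positivity
  linarith

lemma mollFactor_le_one (n : ℕ) : mollFactor n ≤ 1 := by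
  rw [mollFactor]
  have : (0 : ℝ) ≤ 1 / (n + 2) := by positivity
  linarith

lemma tendsto_mollFactor : Tendsto mollFactor atTop (𝓝 1) := by
  have h : Tendsto (fun n : ℕ => 1 / ((n : ℝ) + 2)) atTop (𝓝 0) :=
    tendsto_const_nhds.div_atTop (tendsto_atTop_add_const_right _ _ tendsto_natCast_atTop_atTop)
  have h2 := h.const_sub 1
  rw [sub_zero] at h2
  exact h2

/-- Mollifications of `f`, contracted towards `c`, which are smooth up to the boundary of `S`. -/
def mollSeq (S : Set Plane) (c : Plane) {r : ℝ} (hr : 0 < r) (n : ℕ) (f : Plane → ℝ) (x : Plane) :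
    ℝ :=
  moll (mollBump hr n) (S.indicator f) (mollFactor n • x + (1 - mollFactor n) • c)

namespace IsBody

variable {S : Set Plane} {c : Plane} {r : ℝ} {f : Plane → ℝ} {x : Plane}

lemma center_mem (hS : IsBody S c r) : c ∈ S := hS.ball (Metric.mem_closedBall_self hS.pos.le)

lemma measurableSet (hS : IsBody S c r) : MeasurableSet S := hS.isCompact.measurableSet

lemma volume_pos (hS : IsBody S c r) : 0 < volume.real S := by
  refine ENNReal.toReal_pos ?_ hS.isCompact.measure_lt_top.ne
  refine (lt_of_lt_of_le ?_ (measure_mono hS.ball)).ne'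
  exact Metric.measure_closedBall_pos _ _ hS.pos

lemma memLp_indicator (hS : IsBody S c r) (hf : MemLp f 2 (volume.restrict S)) :
    MemLp (S.indicator f) 2 (volume : Measure Plane) :=
  (memLp_indicator_iff_restrict hS.measurableSet).2 hf

/-- With ε = 1/(n+2), contraction towards `c` by 1 - ε leaves around the image of `x` a disc of
radius εr inside `S`, by convexity. The mollifier uses half this radius and therefore never sees the
outside of `S`. -/
lemma closedBall_subset_interior (hS : IsBody S c r) (n : ℕ) (hx : x ∈ S) :
    Metric.closedBall (mollFactor n • x + (1 - mollFactor n) • c) (mollBump hS.pos n).rOut ⊆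
      interior S := by
  intro y hy
  rw [mem_closedBall_iff_norm] at hy
  set p := mollFactor n • x + (1 - mollFactor n) • c with hp
  have hn : (0 : ℝ) < n + 2 := by positivity
  have e1 : 1 - mollFactor n = 1 / ((n : ℝ) + 2) := by rw [mollFactor]; ring
  have hq : c + ((n : ℝ) + 2) • (y - p) ∈ interior S := by
    refine (interior_mono hS.ball) ?_
    rw [interior_closedBall _ hS.pos.ne', mem_ball_iff_norm, add_sub_cancel_left, norm_smul,
      Real.norm_of_nonneg hn.le]
    calc ((n : ℝ) + 2) * ‖y - p‖ ≤ ((n : ℝ) + 2) * (r / (2 * (n + 2))) := by gcongr; exact hy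
      _ = r / 2 := by field_simp
      _ < r := by linarith [hS.pos]
  have := hS.convex.combo_interior_closure_mem_interior hq (subset_closure hx)
    (a := 1 - mollFactor n) (b := mollFactor n) (by rw [e1]; positivity) (mollFactor_pos n).le
    (by ring)
  convert this using 1
  rw [smul_add, smul_smul, e1, one_div, inv_mul_cancel₀ hn.ne', hp, e1, one_div]
  module

lemma continuous_mollSeq (hS : IsBody S c r) (hf : MemLp f 2 (volume.restrict S)) (n : ℕ) :
    Continuous (mollSeq S c hS.pos n f) :=
  (continuous_moll (memLp_locallyIntegrable (hS.memLp_indicator hf))).comp (by fun_prop)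

lemma memLp_of_continuousOn (hS : IsBody S c r) (hf : ContinuousOn f S) :
    MemLp f 2 (volume.restrict S) := by
  refine (memLp_two_iff_integrable_sq (hf.aestronglyMeasurable hS.measurableSet)).2 ?_
  exact (hf.pow 2).integrableOn_compact hS.isCompact

/-- The chain rule for the contraction adds the factor `mollFactor n`, which tends to one and is
carried along in all later limits. -/
lemma hasFDerivAt_mollSeq (hS : IsBody S c r) (hf : MemLp f 2 (volume.restrict S))
    {g : Fin 2 → Plane → ℝ} (hw : ∀ j, HasWeakPartial (interior S) j f (g j)) (n : ℕ)
    (hx : x ∈ S) : HasFDerivAt (mollSeq S c hS.pos n f)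
      (coordForm fun j => mollFactor n * mollSeq S c hS.pos n (g j) x) x := by
  have h1 := hasFDerivAt_moll (memLp_locallyIntegrable (hS.memLp_indicator hf)) hw
    (hS.closedBall_subset_interior n hx)
  have h2 : HasFDerivAt (fun x : Plane => mollFactor n • x + (1 - mollFactor n) • c)
      (mollFactor n • ContinuousLinearMap.id ℝ Plane) x :=
    ((hasFDerivAt_id x).const_smul (mollFactor n)).add_const _
  refine (h1.comp x h2).congr_fderiv ?_
  ext v
  simp only [ContinuousLinearMap.comp_apply, coordForm_apply, smul_apply,
    ContinuousLinearMap.id_apply, PiLp.smul_apply, smul_eq_mul, mollSeq]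
  exact Finset.sum_congr rfl fun j _ => by ring

/-- Mollification is an L² contraction and the homothety has Jacobian at least 1/4, since its ratio
is at least 1/2. The uniform bound is what the density argument needs. -/
lemma l2n_mollSeq_le (hS : IsBody S c r) (hf : MemLp f 2 (volume : Measure Plane)) (n : ℕ) :
    l2n (volume.restrict S) (fun x => moll (mollBump hS.pos n) f
      (mollFactor n • x + (1 - mollFactor n) • c)) ≤ 2 * l2n volume f := by
  have hc := continuous_moll (φ := mollBump hS.pos n) (memLp_locallyIntegrable hf)
  have hm : MemLp (fun x => moll (mollBump hS.pos n) f
      (mollFactor n • x + (1 - mollFactor n) • c)) 2 (volume.restrict S) :=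
    hS.memLp_of_continuousOn (hc.comp (by fun_prop)).continuousOn
  refine le_of_sq_le_sq ?_ (mul_nonneg zero_le_two l2n_nonneg)
  rw [mul_pow, l2n_sq hf, l2n_sq hm]
  have h1 := setIntegral_comp_homothety_le hS.convex hS.isCompact hS.center_mem (hc.pow 2)
    (fun z => sq_nonneg _) (mollFactor_pos n) (mollFactor_le_one n)
  have h2 : ∫ y in S, moll (mollBump hS.pos n) f y ^ 2 ≤ ∫ y, f y ^ 2 :=
    (setIntegral_le_integral (memLp_moll hf).integrable_sq
      (Eventually.of_forall fun _ => sq_nonneg _)).trans (integral_sq_moll_le hf)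
  have h3 : (1 : ℝ) / 4 ≤ mollFactor n ^ 2 := by
    have : (1 : ℝ) / 2 ≤ mollFactor n := by
      rw [mollFactor, le_sub_comm, div_le_iff₀ (by positivity)]
      have : (0 : ℝ) ≤ n := by positivity
      linarith
    nlinarith
  have h4 : 0 ≤ ∫ y in S, moll (mollBump hS.pos n) f
      (mollFactor n • y + (1 - mollFactor n) • c) ^ 2 := integral_nonneg fun _ => sq_nonneg _
  have h5 := mul_le_mul_of_nonneg_right h3 h4
  simp only [Pi.pow_apply] at h1
  linarith

lemma l2n_le_of_abs_le (hS : IsBody S c r) {m : ℝ} (hf : ContinuousOn f S) (hm0 : 0 ≤ m)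
    (hm : ∀ x ∈ S, |f x| ≤ m) : l2n (volume.restrict S) f ≤ √(volume.real S) * m := by
  refine le_of_sq_le_sq ?_ (by positivity)
  have hf2 := hS.memLp_of_continuousOn hf
  rw [mul_pow, Real.sq_sqrt measureReal_nonneg, l2n_sq hf2]
  calc ∫ x in S, f x ^ 2 ≤ ∫ x in S, m ^ 2 :=
        setIntegral_mono_on hf2.integrable_sq (integrableOn_const hS.isCompact.measure_lt_top.ne)
          hS.measurableSet fun x hx => by
            rw [← sq_abs]; exact pow_le_pow_left₀ (abs_nonneg _) (hm x hx) 2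
    _ = volume.real S * m ^ 2 := by rw [setIntegral_const, smul_eq_mul]

/-- Density argument: for a continuous compactly supported approximation `g` the convergence is
uniform, and the uniform L² bound controls the mollified difference. -/
lemma tendsto_mollSeq (hS : IsBody S c r) (hf : MemLp f 2 (volume.restrict S)) :
    Tendsto (fun n => l2n (volume.restrict S) fun x => mollSeq S c hS.pos n f x - f x) atTop
      (𝓝 0) := by
  set F := S.indicator f with hF
  have hFm : MemLp F 2 (volume : Measure Plane) := hS.memLp_indicator hf
  rw [Metric.tendsto_atTop]
  intro ε hε
  have hV := hS.volume_pos
  set V := volume.real S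
  obtain ⟨g, hgs, hgF, hgc, hgm⟩ := hFm.exists_hasCompactSupport_eLpNorm_sub_le (by norm_num)
    (ε := ENNReal.ofReal (ε / 8)) (by simpa using hε)
  have hFg : l2n volume (fun x => F x - g x) ≤ ε / 8 := ENNReal.toReal_le_of_le_ofReal (by positivity) hgF
  -- Two uniform errors of size η cost at most ε/4 in L²; with the approximation errors ε/4 and ε/8
  -- the total remains below ε.
  set η := ε / (8 * (√V + 1)) with hη
  have hη0 : 0 < η := by positivity
  obtain ⟨δ, hδ, hgu⟩ := Metric.uniformContinuous_iff.1
    (hgs.uniformContinuous_of_continuous hgc) η hη0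
  obtain ⟨D, hD⟩ := hS.isCompact.isBounded.subset_closedBall c
  have hD0 : 0 ≤ D := by
    have := hD hS.center_mem
    rw [Metric.mem_closedBall, dist_self] at this
    exact this
  have hlim : Tendsto (fun n : ℕ => (r + D) / ((n : ℝ) + 2)) atTop (𝓝 0) :=
    tendsto_const_nhds.div_atTop (tendsto_atTop_add_const_right _ _ tendsto_natCast_atTop_atTop)
  obtain ⟨N, hN⟩ := eventually_atTop.1 (hlim.eventually (gt_mem_nhds hδ))
  refine ⟨N, fun n hn => ?_⟩
  have hnδ := hN n hn
  have hn0 : (0 : ℝ) < n + 2 := by positivity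
  rw [Real.dist_eq, sub_zero, abs_of_nonneg l2n_nonneg]
  have hrle : r / (2 * ((n : ℝ) + 2)) ≤ (r + D) / ((n : ℝ) + 2) := by
    rw [div_le_div_iff₀ (by positivity) hn0]
    nlinarith [hS.pos, mul_pos hS.pos hn0, mul_nonneg hD0 hn0.le]
  have hDle : D / ((n : ℝ) + 2) ≤ (r + D) / ((n : ℝ) + 2) := by
    gcongr; linarith [hS.pos]
  set p : Plane → Plane := fun x => mollFactor n • x + (1 - mollFactor n) • c with hp
  have hpc : Continuous p := by simp only [hp]; fun_prop
  set φ := mollBump hS.pos n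
  have hpt : ∀ x ∈ S, |moll φ g (p x) - g x| ≤ 2 * η := by
    intro x hx
    have h1 : dist (moll φ g (p x)) (g (p x)) ≤ η := by
      refine φ.dist_normed_convolution_le hgc.aestronglyMeasurable fun y hy => (hgu ?_).le
      exact lt_of_lt_of_le hy (hrle.trans hnδ.le)
    have h2 : dist (g (p x)) (g x) ≤ η := by
      refine (hgu ?_).le
      have e : p x - x = (-(1 / ((n : ℝ) + 2))) • (x - c) := by
        simp only [hp, mollFactor]; module
      rw [dist_eq_norm, e, norm_smul, norm_neg, Real.norm_of_nonneg (by positivity)]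
      have hxD := hD hx
      rw [mem_closedBall_iff_norm] at hxD
      calc 1 / ((n : ℝ) + 2) * ‖x - c‖ ≤ 1 / ((n : ℝ) + 2) * D := by gcongr
        _ = D / ((n : ℝ) + 2) := by ring
        _ < δ := hDle.trans_lt hnδ
    rw [← Real.dist_eq]
    linarith [dist_triangle (moll φ g (p x)) (g (p x)) (g x)]
  have cF := continuous_moll (φ := φ) (memLp_locallyIntegrable hFm)
  have cg := continuous_moll (φ := φ) (memLp_locallyIntegrable hgm)
  have mF : MemLp (fun x => moll φ F (p x)) 2 (volume.restrict S) :=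
    hS.memLp_of_continuousOn (cF.comp hpc).continuousOn
  have mg : MemLp (fun x => moll φ g (p x)) 2 (volume.restrict S) :=
    hS.memLp_of_continuousOn (cg.comp hpc).continuousOn
  have mg' : MemLp g 2 (volume.restrict S) := hgm.restrict S
  have mF' : MemLp F 2 (volume.restrict S) := hFm.restrict S
  have s1 : l2n (volume.restrict S) (fun x => moll φ F (p x) - moll φ g (p x)) ≤ 2 * (ε / 8) := by
    have := hS.l2n_mollSeq_le (hFm.sub hgm) n
    have e : (fun x => moll φ F (p x) - moll φ g (p x)) =
        fun x => moll φ (F - g) (mollFactor n • x + (1 - mollFactor n) • c) := by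
      funext x
      exact (moll_sub (memLp_locallyIntegrable hFm) (memLp_locallyIntegrable hgm) _).symm
    rw [e]
    refine this.trans ?_
    gcongr
    exact hFg
  have s2 : l2n (volume.restrict S) (fun x => moll φ g (p x) - g x) ≤ √V * (2 * η) :=
    hS.l2n_le_of_abs_le ((cg.comp hpc).sub hgc).continuousOn (by positivity) hpt
  have s3 : l2n (volume.restrict S) (fun x => g x - F x) ≤ ε / 8 := by
    rw [l2n_sub_comm]
    refine le_trans ?_ hFg
    exact ENNReal.toReal_mono (hFm.sub hgm).2.ne (eLpNorm_mono_measure _ Measure.restrict_le_self)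
  have s4 : √V * (2 * η) ≤ ε / 4 := by
    rw [hη]
    have : √V ≤ √V + 1 := by linarith
    calc √V * (2 * (ε / (8 * (√V + 1)))) ≤ (√V + 1) * (2 * (ε / (8 * (√V + 1)))) := by gcongr
      _ = ε / 4 := by field_simp; ring
  have e : l2n (volume.restrict S) (fun x => mollSeq S c hS.pos n f x - f x) =
      l2n (volume.restrict S) (fun x => moll φ F (p x) - F x) := by
    refine l2n_congr ?_
    filter_upwards [ae_restrict_mem hS.measurableSet] with x hx
    rw [hF, Set.indicator_of_mem hx]
    rfl
  rw [e]
  have t1 := l2n_sub_le mF mg mF'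
  have t2 := l2n_sub_le mg mg' mF'
  linarith

lemma tendsto_const_mul_mollSeq (hS : IsBody S c r) (hf : MemLp f 2 (volume.restrict S)) {a : ℕ → ℝ}
    (ha : Tendsto a atTop (𝓝 1)) :
    Tendsto (fun n => l2n (volume.restrict S) fun x => a n * mollSeq S c hS.pos n f x - f x) atTop
      (𝓝 0) := by
  have h1 := (ha.abs.mul (hS.tendsto_mollSeq hf)).add
    ((ha.sub_const 1).abs.mul_const (l2n (volume.restrict S) f))
  simp only [sub_self, abs_zero, zero_mul, mul_zero, add_zero] at h1
  refine squeeze_zero (fun n => l2n_nonneg) (fun n => ?_) h1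
  have hm := hS.memLp_of_continuousOn (hS.continuous_mollSeq hf n).continuousOn
  have e : (fun x => a n * mollSeq S c hS.pos n f x - f x) = fun x =>
      a n * (mollSeq S c hS.pos n f x - f x) + (a n - 1) * f x := by funext x; ring
  rw [e]
  refine (l2n_add_le ((hm.sub hf).const_mul _) (hf.const_mul _)).trans ?_
  rw [l2n_const_mul, l2n_const_mul]
  exact le_rfl

end IsBody

end

noncomputable section

/-! ### Sobolev functions on convex bodies -/

open Filter Topology

/-- `u` is square integrable on `S`, with weak derivatives `u'` in the interior of `S`. -/
structure IsSobolev (S : Set Plane) (u : Plane → ℝ) (u' : Fin 2 → Plane → ℝ) : Prop where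
  memLp : MemLp u 2 (volume.restrict S)
  memLp_deriv : ∀ j, MemLp (u' j) 2 (volume.restrict S)
  weak : ∀ j, HasWeakPartial (interior S) j u (u' j)

lemma l2n_abs {X : Type*} [MeasurableSpace X] (μ : Measure X) (f : X → ℝ) :
    l2n μ (fun x => |f x|) = l2n μ f := by
  rw [l2n, l2n, ← eLpNorm_norm f]
  rfl

lemma abs_coord_sub_le (x y : Plane) (j : Fin 2) : |x j - y j| ≤ ‖x - y‖ := by
  have := abs_coord_le (x - y) j
  simpa using this

lemma abs_mul_coord_integral_le {S : Set Plane} {h : ℝ} (hc : IsCompact S)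
    (hh : ∀ x ∈ S, ∀ y ∈ S, ‖x - y‖ ≤ h) {f : Plane → ℝ} (hf : MemLp f 2 (volume.restrict S))
    (j : Fin 2) {x : Plane} (hx : x ∈ S) :
    Integrable (fun y => f y * (x j - y j)) (volume.restrict S) ∧
    |∫ y in S, f y * (x j - y j)| ≤ √(volume.real S) * (h * l2n (volume.restrict S) f) := by
  have : IsFiniteMeasure (volume.restrict S) := ⟨by
    rw [Measure.restrict_apply_univ]; exact hc.measure_lt_top⟩
  have h0 : 0 ≤ h := (norm_nonneg _).trans (hh x hx x hx)
  have hfi : Integrable f (volume.restrict S) := hf.integrable (by norm_num)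
  have hb : ∀ᵐ y ∂(volume.restrict S), ‖f y * (x j - y j)‖ ≤ h * |f y| := by
    filter_upwards [ae_restrict_mem hc.measurableSet] with y hy
    rw [norm_mul, Real.norm_eq_abs, Real.norm_eq_abs, mul_comm]
    gcongr
    exact (abs_coord_sub_le x y j).trans (hh x hx y hy)
  have hi : Integrable (fun y => f y * (x j - y j)) (volume.restrict S) := by
    refine (hfi.abs.const_mul h).mono' (hfi.aestronglyMeasurable.mul ?_) hb
    exact Continuous.aestronglyMeasurable (by fun_prop)
  refine ⟨hi, ?_⟩
  calc |∫ y in S, f y * (x j - y j)| ≤ ∫ y in S, h * |f y| :=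
        norm_integral_le_of_norm_le (hfi.abs.const_mul h) hb
    _ = h * ∫ y in S, |f y| := by rw [integral_const_mul]
    _ ≤ h * (√(volume.real S) * l2n (volume.restrict S) f) := by
        gcongr
        have := abs_integral_le_l2n (μ := volume.restrict S) hf.abs
        rw [measureReal_restrict_apply_univ] at this
        refine ((le_abs_self _).trans this).trans (le_of_eq ?_)
        exact congrArg _ (l2n_abs _ f)
    _ = _ := by ring

section

variable {S : Set Plane} {h : ℝ} {x : Plane} {u v : Plane → ℝ} {u' v' : Fin 2 → Plane → ℝ}

lemma avgTaylor_eq (hc : IsCompact S) (hh : ∀ x ∈ S, ∀ y ∈ S, ‖x - y‖ ≤ h)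
    (hu : MemLp u 2 (volume.restrict S)) (hu' : ∀ j, MemLp (u' j) 2 (volume.restrict S))
    (hx : x ∈ S) : avgTaylor S u u' x =
      (volume.real S)⁻¹ * ((∫ y in S, u y) + ∑ j, ∫ y in S, u' j y * (x j - y j)) := by
  have : IsFiniteMeasure (volume.restrict S) := ⟨by
    rw [Measure.restrict_apply_univ]; exact hc.measure_lt_top⟩
  have hi := fun j => (abs_mul_coord_integral_le hc hh (hu' j) j hx).1
  rw [avgTaylor, integral_add (hu.integrable (by norm_num)) (integrable_finsetSum _ fun j _ => hi j),
    integral_finsetSum _ fun j _ => hi j]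

/-- Continuity of the averaged Taylor polynomial in L², pointwise in `x`; it enters the Sobolev
inequality and the passage to the limit. -/
lemma abs_avgTaylor_le (hc : IsCompact S) (hh : ∀ x ∈ S, ∀ y ∈ S, ‖x - y‖ ≤ h)
    (hu : MemLp u 2 (volume.restrict S)) (hu' : ∀ j, MemLp (u' j) 2 (volume.restrict S))
    (hx : x ∈ S) : |avgTaylor S u u' x| ≤ (volume.real S)⁻¹ * √(volume.real S) *
      (l2n (volume.restrict S) u + h * ∑ j, l2n (volume.restrict S) (u' j)) := by
  have : IsFiniteMeasure (volume.restrict S) := ⟨by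
    rw [Measure.restrict_apply_univ]; exact hc.measure_lt_top⟩
  rw [avgTaylor_eq hc hh hu hu' hx, abs_mul, abs_of_nonneg (by positivity), mul_assoc]
  gcongr
  have h1 := abs_integral_le_l2n (μ := volume.restrict S) hu
  rw [measureReal_restrict_apply_univ] at h1
  refine (abs_add_le (∫ y in S, u y) _).trans ?_
  rw [mul_add]
  refine add_le_add h1 ?_
  refine (Finset.abs_sum_le_sum_abs _ _).trans ?_
  rw [Finset.mul_sum, Finset.mul_sum]
  exact Finset.sum_le_sum fun j _ => (abs_mul_coord_integral_le hc hh (hu' j) j hx).2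

lemma avgTaylor_sub (hc : IsCompact S) (hh : ∀ x ∈ S, ∀ y ∈ S, ‖x - y‖ ≤ h)
    (hu : MemLp u 2 (volume.restrict S)) (hu' : ∀ j, MemLp (u' j) 2 (volume.restrict S))
    (hv : MemLp v 2 (volume.restrict S)) (hv' : ∀ j, MemLp (v' j) 2 (volume.restrict S))
    (hx : x ∈ S) : avgTaylor S (fun y => u y - v y) (fun j y => u' j y - v' j y) x =
      avgTaylor S u u' x - avgTaylor S v v' x := by
  have : IsFiniteMeasure (volume.restrict S) := ⟨by
    rw [Measure.restrict_apply_univ]; exact hc.measure_lt_top⟩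
  have hi := fun j => (abs_mul_coord_integral_le hc hh (hu' j) j hx).1
  have hi' := fun j => (abs_mul_coord_integral_le hc hh (hv' j) j hx).1
  have e := avgTaylor_eq hc hh (hu.sub hv) (fun j => (hu' j).sub (hv' j)) hx
  simp only [Pi.sub_apply] at e
  refine e.trans ?_
  rw [avgTaylor_eq hc hh hu hu' hx, avgTaylor_eq hc hh hv hv' hx, ← mul_sub,
    integral_sub (hu.integrable (by norm_num)) (hv.integrable (by norm_num))]
  simp only [sub_mul]
  simp only [integral_sub (hi _) (hi' _), Finset.sum_sub_distrib]
  ring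

end

namespace IsBody

variable {S : Set Plane} {c : Plane} {r h : ℝ} {x : Plane} {u : Plane → ℝ}
  {u' : Fin 2 → Plane → ℝ} {u'' : Fin 2 → Fin 2 → Plane → ℝ}

lemma subset_closure_interior (hS : IsBody S c r) : S ⊆ closure (interior S) := by
  have h1 : (interior S).Nonempty := ⟨c, (interior_mono hS.ball)
    (by rw [interior_closedBall _ hS.pos.ne']; exact Metric.mem_ball_self hS.pos)⟩
  rw [hS.convex.closure_interior_eq_closure_of_nonempty_interior h1]
  exact subset_closure

lemma _root_.integral_sum_sq (hu'' : ∀ j k, MemLp (u'' j k) 2 (volume.restrict S)) :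
    ∫ y in S, ∑ j, ∑ k, u'' j k y ^ 2 = ∑ j, ∑ k, l2n (volume.restrict S) (u'' j k) ^ 2 := by
  rw [integral_finsetSum _ fun j _ => integrable_finsetSum _ fun k _ => (hu'' j k).integrable_sq]
  refine Finset.sum_congr rfl fun j _ => ?_
  rw [integral_finsetSum _ fun k _ => (hu'' j k).integrable_sq]
  exact Finset.sum_congr rfl fun k _ => (l2n_sq (hu'' j k)).symm

/-- The Sobolev inequality for smooth functions. -/
lemma abs_le_of_smooth (hS : IsBody S c r) (hh : ∀ x ∈ S, ∀ y ∈ S, ‖x - y‖ ≤ h)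
    (hu : Continuous u) (hu' : ∀ j, Continuous (u' j)) (hu'' : ∀ j k, Continuous (u'' j k))
    (hd : ∀ x ∈ S, HasFDerivAt u (coordForm fun j => u' j x) x)
    (hd' : ∀ j, ∀ x ∈ S, HasFDerivAt (u' j) (coordForm fun k => u'' j k x) x) (hx : x ∈ S) :
    |u x| ≤ (volume.real S)⁻¹ * √(volume.real S) *
      (l2n (volume.restrict S) u + h * ∑ j, l2n (volume.restrict S) (u' j)) +
      √(h ^ 4 * (volume.real S)⁻¹) * ∑ j, ∑ k, l2n (volume.restrict S) (u'' j k) := by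
  have m := hS.memLp_of_continuousOn hu.continuousOn
  have m' := fun j => hS.memLp_of_continuousOn (hu' j).continuousOn
  have m'' := fun j k => hS.memLp_of_continuousOn (hu'' j k).continuousOn
  have h1 := sq_sub_avgTaylor_le hS.convex hS.isCompact hS.volume_pos hh hu hu' hu'' hd hd' hx
  have h2 := abs_avgTaylor_le hS.isCompact hh m m' hx
  have h3 : |u x - avgTaylor S u u' x| ≤
      √(h ^ 4 * (volume.real S)⁻¹) * ∑ j, ∑ k, l2n (volume.restrict S) (u'' j k) := by
    have hV := hS.volume_pos
    refine abs_le_of_sq_le_sq (h1.trans ?_) (mul_nonneg (Real.sqrt_nonneg _)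
      (Finset.sum_nonneg fun j _ => Finset.sum_nonneg fun k _ => l2n_nonneg))
    rw [mul_pow, Real.sq_sqrt (by positivity), integral_sum_sq m'']
    gcongr
    calc ∑ j, ∑ k, l2n (volume.restrict S) (u'' j k) ^ 2
        ≤ ∑ j, (∑ k, l2n (volume.restrict S) (u'' j k)) ^ 2 :=
          Finset.sum_le_sum fun j _ => Finset.sum_sq_le_sq_sum_of_nonneg fun k _ => l2n_nonneg
      _ ≤ _ := Finset.sum_sq_le_sq_sum_of_nonneg fun j _ => Finset.sum_nonneg fun k _ => l2n_nonneg
  have h4 := abs_add_le (u x - avgTaylor S u u' x) (avgTaylor S u u' x)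
  rw [sub_add_cancel] at h4
  linarith

lemma tendsto_mollFactor_mul (hS : IsBody S c r) {f : Plane → ℝ}
    (hf : MemLp f 2 (volume.restrict S)) :
    Tendsto (fun n => l2n (volume.restrict S) fun x => mollFactor n * mollSeq S c hS.pos n f x - f x)
      atTop (𝓝 0) :=
  hS.tendsto_const_mul_mollSeq hf tendsto_mollFactor

lemma tendsto_mollFactor_sq_mul (hS : IsBody S c r) {f : Plane → ℝ}
    (hf : MemLp f 2 (volume.restrict S)) :
    Tendsto (fun n => l2n (volume.restrict S) fun x =>
      mollFactor n * (mollFactor n * mollSeq S c hS.pos n f x) - f x) atTop (𝓝 0) := by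
  have := hS.tendsto_const_mul_mollSeq hf (a := fun n => mollFactor n * mollFactor n)
    (by simpa using tendsto_mollFactor.mul tendsto_mollFactor)
  simpa only [mul_assoc] using this

lemma hasFDerivAt_mollFactor_mul (hS : IsBody S c r) {f : Plane → ℝ} {g : Fin 2 → Plane → ℝ}
    (hf : IsSobolev S f g) (n : ℕ) (hx : x ∈ S) :
    HasFDerivAt (fun x => mollFactor n * mollSeq S c hS.pos n f x)
      (coordForm fun j => mollFactor n * (mollFactor n * mollSeq S c hS.pos n (g j) x)) x := by
  refine ((hS.hasFDerivAt_mollSeq hf.memLp hf.weak n hx).const_mul (mollFactor n)).congr_fderiv ?_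
  ext v
  simp only [coordForm_apply, smul_apply, smul_eq_mul, Finset.mul_sum, mul_assoc]

lemma exists_diam_le (hS : IsBody S c r) : ∃ h : ℝ, ∀ x ∈ S, ∀ y ∈ S, ‖x - y‖ ≤ h :=
  ⟨Metric.diam S, fun x hx y hy => by
    rw [← dist_eq_norm]; exact Metric.dist_le_diam_of_mem hS.isCompact.isBounded hx hy⟩

/-- The Sobolev inequality for the difference of two mollifications bounds it uniformly by L²
distances of derivatives up to order two, all of which tend to zero. -/
lemma uniformCauchySeqOn_mollSeq (hS : IsBody S c r) (hu : IsSobolev S u u')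
    (hu' : ∀ j, IsSobolev S (u' j) (u'' j)) :
    UniformCauchySeqOn (fun n => mollSeq S c hS.pos n u) atTop S := by
  obtain ⟨h, hh⟩ := hS.exists_diam_le
  have h0 : 0 ≤ h := (norm_nonneg _).trans (hh c hS.center_mem c hS.center_mem)
  set μ := volume.restrict S
  set V := volume.real S
  set U := fun n => mollSeq S c hS.pos n u with hU
  set U' := fun n j x => mollFactor n * mollSeq S c hS.pos n (u' j) x with hU'
  set U'' := fun n j k x => mollFactor n * (mollFactor n * mollSeq S c hS.pos n (u'' j k) x) with hU''
  have c0 : ∀ n, Continuous (U n) := fun n => hS.continuous_mollSeq hu.memLp n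
  have c1 : ∀ n j, Continuous (U' n j) := fun n j =>
    continuous_const.mul (hS.continuous_mollSeq (hu.memLp_deriv j) n)
  have c2 : ∀ n j k, Continuous (U'' n j k) := fun n j k => continuous_const.mul
    (continuous_const.mul (hS.continuous_mollSeq ((hu' j).memLp_deriv k) n))
  have t0 : Tendsto (fun n => l2n μ fun x => U n x - u x) atTop (𝓝 0) := hS.tendsto_mollSeq hu.memLp
  have t1 : ∀ j, Tendsto (fun n => l2n μ fun x => U' n j x - u' j x) atTop (𝓝 0) := fun j =>
    hS.tendsto_mollFactor_mul (hu.memLp_deriv j)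
  have t2 : ∀ j k, Tendsto (fun n => l2n μ fun x => U'' n j k x - u'' j k x) atTop (𝓝 0) :=
    fun j k => hS.tendsto_mollFactor_sq_mul ((hu' j).memLp_deriv k)
  set E : ℕ → ℝ := fun n => V⁻¹ * √V * ((l2n μ fun x => U n x - u x) +
      h * ∑ j, l2n μ fun x => U' n j x - u' j x) +
      √(h ^ 4 * V⁻¹) * ∑ j, ∑ k, l2n μ fun x => U'' n j k x - u'' j k x with hE
  have tE : Tendsto E atTop (𝓝 0) := by
    have := ((t0.add ((tendsto_finsetSum Finset.univ fun j _ => t1 j).const_mul h)).const_mul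
      (V⁻¹ * √V)).add ((tendsto_finsetSum Finset.univ fun j _ =>
        tendsto_finsetSum Finset.univ fun k _ => t2 j k).const_mul (√(h ^ 4 * V⁻¹)))
    simpa only [Finset.sum_const_zero, mul_zero, add_zero] using this
  have tri : ∀ {f g k : Plane → ℝ}, Continuous f → Continuous g → MemLp k 2 μ →
      l2n μ (fun x => f x - g x) ≤ l2n μ (fun x => f x - k x) + l2n μ (fun x => g x - k x) := by
    intro f g k hf hg hk
    rw [l2n_sub_comm g k]
    exact l2n_sub_le (hS.memLp_of_continuousOn hf.continuousOn) hk
      (hS.memLp_of_continuousOn hg.continuousOn)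
  have key : ∀ n m, ∀ x ∈ S, |U n x - U m x| ≤ E n + E m := by
    intro n m x hx
    refine (hS.abs_le_of_smooth (u := fun x => U n x - U m x)
      (u' := fun j x => U' n j x - U' m j x) (u'' := fun j k x => U'' n j k x - U'' m j k x) hh
      ((c0 n).sub (c0 m)) (fun j => (c1 n j).sub (c1 m j)) (fun j k => (c2 n j k).sub (c2 m j k))
      ?_ ?_ hx).trans ?_
    · intro x hx
      refine ((hS.hasFDerivAt_mollSeq hu.memLp hu.weak n hx).sub
        (hS.hasFDerivAt_mollSeq hu.memLp hu.weak m hx)).congr_fderiv ?_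
      ext v
      simp [hU', sub_mul]
    · intro j x hx
      refine ((hS.hasFDerivAt_mollFactor_mul (hu' j) n hx).sub
        (hS.hasFDerivAt_mollFactor_mul (hu' j) m hx)).congr_fderiv ?_
      ext v
      simp [hU'', sub_mul]
    · have b0 := tri (c0 n) (c0 m) hu.memLp
      have b1 := Finset.sum_le_sum fun j (_ : j ∈ Finset.univ) =>
        tri (c1 n j) (c1 m j) (hu.memLp_deriv j)
      have b2 := Finset.sum_le_sum fun j (_ : j ∈ Finset.univ) =>
        Finset.sum_le_sum fun k (_ : k ∈ Finset.univ) =>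
          tri (c2 n j k) (c2 m j k) ((hu' j).memLp_deriv k)
      simp only [Finset.sum_add_distrib] at b1 b2
      have := add_le_add (mul_le_mul_of_nonneg_left (add_le_add b0
        (mul_le_mul_of_nonneg_left b1 h0)) (show 0 ≤ V⁻¹ * √V by positivity))
        (mul_le_mul_of_nonneg_left b2 (Real.sqrt_nonneg (h ^ 4 * V⁻¹)))
      refine this.trans (le_of_eq ?_)
      simp only [hE]
      ring
  rw [Metric.uniformCauchySeqOn_iff]
  intro ε hε
  obtain ⟨N, hN⟩ := eventually_atTop.1 (tE.eventually (gt_mem_nhds (half_pos hε)))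
  refine ⟨N, fun m hm n hn x hx => ?_⟩
  rw [Real.dist_eq]
  exact (key m n x hx).trans_lt (by linarith [hN m hm, hN n hn])

/-- A function with two weak derivatives in `L²` has a continuous representative, which is the
uniform limit of its mollifications. -/
lemma exists_tendstoUniformlyOn (hS : IsBody S c r) (hu : IsSobolev S u u')
    (hu' : ∀ j, IsSobolev S (u' j) (u'' j)) :
    ∃ U : Plane → ℝ, TendstoUniformlyOn (fun n => mollSeq S c hS.pos n u) U atTop S ∧
      ContinuousOn U S ∧ U =ᵐ[volume.restrict S] u := by
  have hC := hS.uniformCauchySeqOn_mollSeq hu hu'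
  have hlim : ∀ x, ∃ y, x ∈ S → Tendsto (fun n => mollSeq S c hS.pos n u x) atTop (𝓝 y) := by
    intro x
    by_cases hx : x ∈ S
    · obtain ⟨y, hy⟩ := cauchySeq_tendsto_of_complete (hC.cauchySeq hx)
      exact ⟨y, fun _ => hy⟩
    · exact ⟨0, fun h => absurd h hx⟩
  choose U hU using hlim
  have hT := hC.tendstoUniformlyOn_of_tendsto fun x hx => hU x hx
  have hUc : ContinuousOn U S := hT.continuousOn (Frequently.of_forall fun n =>
    (hS.continuous_mollSeq hu.memLp n).continuousOn)
  refine ⟨U, hT, hUc, ?_⟩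
  have hm := hS.memLp_of_continuousOn hUc
  -- The mollifications converge to `U` uniformly and to `u` in L², so the two limits agree almost
  -- everywhere.
  have h0 : l2n (volume.restrict S) (fun x => U x - u x) = 0 := by
    refine le_antisymm (le_of_forall_pos_le_add fun ε hε => ?_) l2n_nonneg
    rw [zero_add]
    set V := volume.real S
    set η := ε / (2 * (√V + 1)) with hη
    have hη0 : 0 < η := by positivity
    rw [Metric.tendstoUniformlyOn_iff] at hT
    obtain ⟨n, hn1, hn2⟩ := ((hT η hη0).and ((hS.tendsto_mollSeq hu.memLp).eventually
      (gt_mem_nhds (half_pos hε)))).exists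
    have hmn := hS.memLp_of_continuousOn (hS.continuous_mollSeq hu.memLp n).continuousOn
    have h1 := l2n_sub_le hm hmn hu.memLp
    have h2 : l2n (volume.restrict S) (fun x => U x - mollSeq S c hS.pos n u x) ≤ √V * η :=
      hS.l2n_le_of_abs_le (hUc.sub (hS.continuous_mollSeq hu.memLp n).continuousOn) hη0.le
        fun x hx => by rw [← Real.dist_eq]; exact (hn1 x hx).le
    have h3 : √V * η ≤ ε / 2 := by
      have : √V ≤ √V + 1 := by linarith
      calc √V * η ≤ (√V + 1) * (ε / (2 * (√V + 1))) := by rw [hη]; gcongr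
        _ = ε / 2 := by field_simp
    linarith
  have h1 : eLpNorm (fun x => U x - u x) 2 (volume.restrict S) = 0 :=
    ((ENNReal.toReal_eq_zero_iff _).1 h0).resolve_right (hm.sub hu.memLp).2.ne
  have h2 := (eLpNorm_eq_zero_iff (hm.sub hu.memLp).1 (by norm_num)).1 h1
  filter_upwards [h2] with x hx
  exact sub_eq_zero.1 hx

end IsBody

end

noncomputable section

/-! ### Limits of the smooth inequalities -/

open Filter Topology

lemma tendsto_l2n {S : Set Plane} {f : Plane → ℝ} {F : ℕ → Plane → ℝ}
    (hf : MemLp f 2 (volume.restrict S)) (hF : ∀ n, MemLp (F n) 2 (volume.restrict S))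
    (h : Tendsto (fun n => l2n (volume.restrict S) fun x => F n x - f x) atTop (𝓝 0)) :
    Tendsto (fun n => l2n (volume.restrict S) (F n)) atTop (𝓝 (l2n (volume.restrict S) f)) := by
  rw [tendsto_iff_dist_tendsto_zero]
  exact squeeze_zero (fun n => dist_nonneg) (fun n => abs_l2n_sub_le (hF n) hf) h

lemma norm_coordForm_sub_le (p q : Fin 2 → ℝ) :
    ‖coordForm p - coordForm q‖ ≤ |p 0 - q 0| + |p 1 - q 1| := by
  refine ContinuousLinearMap.opNorm_le_bound _ (by positivity) fun v => ?_
  have e : (coordForm p - coordForm q) v = (p 0 - q 0) * v 0 + (p 1 - q 1) * v 1 := by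
    simp; ring
  rw [e, Real.norm_eq_abs, add_mul]
  refine (abs_add_le _ _).trans ?_
  rw [abs_mul, abs_mul]
  gcongr <;> exact abs_coord_le v _

lemma toDual_eq_coordForm (g : Plane) : InnerProductSpace.toDual ℝ Plane g = coordForm fun j => g j := by
  ext v
  simp [PiLp.inner_apply, mul_comm]

namespace IsBody

variable {S : Set Plane} {c : Plane} {r h : ℝ} {x : Plane} {u : Plane → ℝ}
  {u' : Fin 2 → Plane → ℝ} {u'' : Fin 2 → Fin 2 → Plane → ℝ}

lemma eqOn_of_ae_eq (hS : IsBody S c r) {U V : Plane → ℝ} (hU : ContinuousOn U S)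
    (hV : ContinuousOn V S) (h : U =ᵐ[volume.restrict S] V) : Set.EqOn U V S :=
  Measure.eqOn_of_ae_eq h hU hV hS.subset_closure_interior

/-- The uniform error of the averaged Taylor polynomial of a Sobolev function. -/
lemma sq_sub_avgTaylor_le_of_isSobolev (hS : IsBody S c r) (hh : ∀ x ∈ S, ∀ y ∈ S, ‖x - y‖ ≤ h)
    (hu : IsSobolev S u u') (hu' : ∀ j, IsSobolev S (u' j) (u'' j)) {U : Plane → ℝ}
    (hU : ContinuousOn U S) (hUu : U =ᵐ[volume.restrict S] u) (hx : x ∈ S) :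
    (U x - avgTaylor S u u' x) ^ 2 ≤
      h ^ 4 * (volume.real S)⁻¹ * ∑ j, ∑ k, l2n (volume.restrict S) (u'' j k) ^ 2 := by
  obtain ⟨U₀, hT, hU₀, hU₀u⟩ := hS.exists_tendstoUniformlyOn hu hu'
  rw [hS.eqOn_of_ae_eq hU hU₀ (hUu.trans hU₀u.symm) hx]
  have h0 : 0 ≤ h := (norm_nonneg _).trans (hh x hx x hx)
  set F := fun n => mollSeq S c hS.pos n u with hF
  set F' := fun n j x => mollFactor n * mollSeq S c hS.pos n (u' j) x with hF'
  set F'' := fun n j k x => mollFactor n * (mollFactor n * mollSeq S c hS.pos n (u'' j k) x) with hF''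
  have c0 : ∀ n, Continuous (F n) := fun n => hS.continuous_mollSeq hu.memLp n
  have c1 : ∀ n j, Continuous (F' n j) := fun n j =>
    continuous_const.mul (hS.continuous_mollSeq (hu.memLp_deriv j) n)
  have c2 : ∀ n j k, Continuous (F'' n j k) := fun n j k => continuous_const.mul
    (continuous_const.mul (hS.continuous_mollSeq ((hu' j).memLp_deriv k) n))
  have m0 := fun n => hS.memLp_of_continuousOn (c0 n).continuousOn
  have m1 := fun n j => hS.memLp_of_continuousOn (c1 n j).continuousOn
  have m2 := fun n j k => hS.memLp_of_continuousOn (c2 n j k).continuousOn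
  have hpt := hT.tendsto_at hx
  have hav : Tendsto (fun n => avgTaylor S (F n) (F' n) x) atTop (𝓝 (avgTaylor S u u' x)) := by
    rw [tendsto_iff_dist_tendsto_zero]
    have hlim := (((hS.tendsto_mollSeq hu.memLp).add ((tendsto_finsetSum Finset.univ
      fun j _ => hS.tendsto_mollFactor_mul (hu.memLp_deriv j)).const_mul h)).const_mul
        ((volume.real S)⁻¹ * √(volume.real S)))
    simp only [Finset.sum_const_zero, mul_zero, add_zero] at hlim
    refine squeeze_zero (fun n => dist_nonneg) (fun n => ?_) hlim
    rw [Real.dist_eq, ← avgTaylor_sub hS.isCompact hh (m0 n) (m1 n) hu.memLp hu.memLp_deriv hx]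
    exact abs_avgTaylor_le hS.isCompact hh ((m0 n).sub hu.memLp)
      (fun j => (m1 n j).sub (hu.memLp_deriv j)) hx
  have hr : Tendsto (fun n => h ^ 4 * (volume.real S)⁻¹ *
      ∑ j, ∑ k, l2n (volume.restrict S) (F'' n j k) ^ 2) atTop (𝓝 (h ^ 4 * (volume.real S)⁻¹ *
      ∑ j, ∑ k, l2n (volume.restrict S) (u'' j k) ^ 2)) :=
    (tendsto_finsetSum _ fun j _ => tendsto_finsetSum _ fun k _ =>
      (tendsto_l2n ((hu' j).memLp_deriv k) (fun n => m2 n j k)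
        (hS.tendsto_mollFactor_sq_mul ((hu' j).memLp_deriv k))).pow 2).const_mul _
  refine le_of_tendsto_of_tendsto' ((hpt.sub hav).pow 2) hr fun n => ?_
  rw [← integral_sum_sq (m2 n)]
  exact sq_sub_avgTaylor_le hS.convex hS.isCompact hS.volume_pos hh (c0 n) (c1 n) (c2 n)
    (fun y hy => hS.hasFDerivAt_mollSeq hu.memLp hu.weak n hy)
    (fun j y hy => hS.hasFDerivAt_mollFactor_mul (hu' j) n hy) hx

/-- The Poincaré inequality on a convex set. -/
lemma l2n_sub_average_le (hS : IsBody S c r) (hh : ∀ x ∈ S, ∀ y ∈ S, ‖x - y‖ ≤ h)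
    (hu : IsSobolev S u u') :
    l2n (volume.restrict S) (fun x => u x - (volume.real S)⁻¹ * ∫ y in S, u y) ^ 2 ≤
      2 * h ^ 2 * ∑ j, l2n (volume.restrict S) (u' j) ^ 2 := by
  have : IsFiniteMeasure (volume.restrict S) := ⟨by
    rw [Measure.restrict_apply_univ]; exact hS.isCompact.measure_lt_top⟩
  set F := fun n => mollSeq S c hS.pos n u with hF
  set F' := fun n j x => mollFactor n * mollSeq S c hS.pos n (u' j) x with hF'
  have c0 : ∀ n, Continuous (F n) := fun n => hS.continuous_mollSeq hu.memLp n
  have c1 : ∀ n j, Continuous (F' n j) := fun n j =>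
    continuous_const.mul (hS.continuous_mollSeq (hu.memLp_deriv j) n)
  have m0 := fun n => hS.memLp_of_continuousOn (c0 n).continuousOn
  have m1 := fun n j => hS.memLp_of_continuousOn (c1 n j).continuousOn
  have t0 := hS.tendsto_mollSeq hu.memLp
  set av : (Plane → ℝ) → ℝ := fun f => (volume.real S)⁻¹ * ∫ y in S, f y with hav
  have hint : ∀ {f : Plane → ℝ}, MemLp f 2 (volume.restrict S) → Integrable f (volume.restrict S) :=
    fun hf => hf.integrable (by norm_num)
  have tav : Tendsto (fun n => av (F n)) atTop (𝓝 (av u)) := by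
    refine Tendsto.const_mul _ ?_
    rw [tendsto_iff_dist_tendsto_zero]
    have hlim := t0.const_mul √((volume.restrict S).real Set.univ)
    rw [mul_zero] at hlim
    refine squeeze_zero (fun n => dist_nonneg) (fun n => ?_) hlim
    rw [Real.dist_eq, ← integral_sub (hint (m0 n)) (hint hu.memLp)]
    exact abs_integral_le_l2n ((m0 n).sub hu.memLp)
  have mc : ∀ {f : Plane → ℝ} (a : ℝ), MemLp f 2 (volume.restrict S) →
      MemLp (fun x => f x - a) 2 (volume.restrict S) := fun a hf => hf.sub (memLp_const a)
  have tl : Tendsto (fun n => l2n (volume.restrict S) fun x => F n x - av (F n)) atTop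
      (𝓝 (l2n (volume.restrict S) fun x => u x - av u)) := by
    refine tendsto_l2n (mc _ hu.memLp) (fun n => mc _ (m0 n)) ?_
    have hlim := t0.add ((tav.sub_const (av u)).abs.mul_const (l2n (volume.restrict S) fun _ => 1))
    simp only [sub_self, abs_zero, zero_mul, add_zero] at hlim
    refine squeeze_zero (fun n => l2n_nonneg) (fun n => ?_) hlim
    have e : (fun x => F n x - av (F n) - (u x - av u)) =
        fun x => (F n x - u x) + (-(av (F n) - av u)) * 1 := by funext x; ring
    rw [e]
    refine (l2n_add_le ((m0 n).sub hu.memLp) (memLp_const _)).trans ?_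
    rw [l2n_const_mul _ fun _ => 1, abs_neg]
    exact le_rfl
  have tr : Tendsto (fun n => 2 * h ^ 2 * ∑ j, l2n (volume.restrict S) (F' n j) ^ 2) atTop
      (𝓝 (2 * h ^ 2 * ∑ j, l2n (volume.restrict S) (u' j) ^ 2)) :=
    (tendsto_finsetSum _ fun j _ => (tendsto_l2n (hu.memLp_deriv j) (fun n => m1 n j)
      (hS.tendsto_mollFactor_mul (hu.memLp_deriv j))).pow 2).const_mul _
  refine le_of_tendsto_of_tendsto' (tl.pow 2) tr fun n => ?_
  rw [l2n_sq (mc _ (m0 n))]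
  have h1 := poincare_convex hS.convex hS.isCompact hS.volume_pos hh (c0 n) (c1 n)
    (fun y hy => hS.hasFDerivAt_mollSeq hu.memLp hu.weak n hy)
  rw [integral_finsetSum _ fun j _ => (m1 n j).integrable_sq] at h1
  refine h1.trans (le_of_eq ?_)
  congr 1
  exact Finset.sum_congr rfl fun j _ => (l2n_sq (m1 n j)).symm

/-- A function with three weak derivatives in `L²` is continuously differentiable up to the
boundary. -/
lemma exists_hasGradientAt (hS : IsBody S c r) {w : Plane → ℝ} {G : Fin 2 → Plane → ℝ}
    {H : Fin 2 → Fin 2 → Plane → ℝ} {D : Fin 2 → Fin 2 → Fin 2 → Plane → ℝ}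
    (hw : IsSobolev S w G) (hG : ∀ i, IsSobolev S (G i) (H i))
    (hH : ∀ i j, IsSobolev S (H i j) (D i j)) :
    ∃ (W : Plane → ℝ) (g : Plane → Plane), ContinuousOn W S ∧ ContinuousOn g S ∧
      (∀ x ∈ interior S, HasGradientAt W (g x) x) ∧ W =ᵐ[volume.restrict S] w ∧
      ∀ i, (fun x => g x i) =ᵐ[volume.restrict S] G i := by
  obtain ⟨W, hWT, hWc, hWw⟩ := hS.exists_tendstoUniformlyOn hw hG
  choose g hgT hgc hgG using fun i => hS.exists_tendstoUniformlyOn (hG i) (hH i)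
  refine ⟨W, fun x => WithLp.toLp 2 fun i => g i x, hWc, ?_, ?_, hWw, hgG⟩
  · exact (PiLp.continuous_toLp 2 _).comp_continuousOn (continuousOn_pi.2 hgc)
  -- The contraction factor in the derivatives tends to one and the limits are bounded on the
  -- compact set, so uniform convergence survives it.
  have hlim : ∀ i, TendstoUniformlyOn
      (fun n x => mollFactor n * mollSeq S c hS.pos n (G i) x) (g i) atTop S := by
    intro i
    obtain ⟨M, hM⟩ := hS.isCompact.exists_bound_of_continuousOn (hgc i)
    have hM0 : 0 ≤ M := (norm_nonneg _).trans (hM c hS.center_mem)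
    rw [Metric.tendstoUniformlyOn_iff]
    intro ε hε
    have h1 := (Metric.tendstoUniformlyOn_iff.1 (hgT i)) (ε / 2) (half_pos hε)
    have h2 : Tendsto (fun n => |mollFactor n - 1| * M) atTop (𝓝 0) := by
      simpa using (tendsto_mollFactor.sub_const 1).abs.mul_const M
    filter_upwards [h1, h2.eventually (gt_mem_nhds (half_pos hε))] with n hn1 hn2 x hx
    have k1 := hn1 x hx
    have k2 : |mollFactor n - 1| * |g i x| ≤ |mollFactor n - 1| * M := by
      gcongr; exact hM x hx
    rw [dist_comm, Real.dist_eq] at k1 ⊢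
    have e : mollFactor n * mollSeq S c hS.pos n (G i) x - g i x =
        mollFactor n * (mollSeq S c hS.pos n (G i) x - g i x) + (mollFactor n - 1) * g i x := by ring
    rw [e]
    refine (abs_add_le _ _).trans_lt ?_
    rw [abs_mul, abs_mul, abs_of_pos (mollFactor_pos n)]
    have k3 := mul_le_mul_of_nonneg_right (mollFactor_le_one n)
      (abs_nonneg (mollSeq S c hS.pos n (G i) x - g i x))
    linarith
  intro x hx
  rw [hasGradientAt_iff_hasFDerivAt, toDual_eq_coordForm]
  -- Uniform convergence of the derivatives identifies the limit field as the classical gradient.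
  refine hasFDerivAt_of_tendstoUniformlyOn isOpen_interior
    (f' := fun n x => coordForm fun j => mollFactor n * mollSeq S c hS.pos n (G j) x)
    (g' := fun x => coordForm fun j => g j x) (l := atTop) ?_
    (fun n y hy => hS.hasFDerivAt_mollSeq hw.memLp hw.weak n (interior_subset hy))
    (fun y hy => hWT.tendsto_at (interior_subset hy)) hx
  rw [Metric.tendstoUniformlyOn_iff]
  intro ε hε
  filter_upwards [Metric.tendstoUniformlyOn_iff.1 (hlim 0) _ (half_pos hε),
    Metric.tendstoUniformlyOn_iff.1 (hlim 1) _ (half_pos hε)] with n h0 h1 y hy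
  have k0 := h0 y (interior_subset hy)
  have k1 := h1 y (interior_subset hy)
  rw [Real.dist_eq] at k0 k1
  rw [dist_eq_norm]
  exact (norm_coordForm_sub_le _ _).trans_lt (by linarith)

end IsBody

end

noncomputable section

/-! ### Representatives in `C¹` -/

open Filter Topology

/-- `W`, with gradient `g`, is the representative in `C¹(S)` of the class of `w`. -/
structure IsC1On (S : Set Plane) (w W : Plane → ℝ) (g : Plane → Plane) : Prop where
  continuousOn : ContinuousOn W S
  continuousOn_grad : ContinuousOn g S
  hasGradientAt : ∀ x ∈ interior S, HasGradientAt W (g x) x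
  ae_eq : W =ᵐ[volume.restrict S] w

namespace IsC1On

variable {S S' : Set Plane} {w W W' : Plane → ℝ} {g g' : Plane → Plane}

lemma mono (h : IsC1On S w W g) (hS : S' ⊆ S) : IsC1On S' w W g :=
  ⟨h.continuousOn.mono hS, h.continuousOn_grad.mono hS,
    fun x hx => h.hasGradientAt x (interior_mono hS hx), ae_restrict_of_ae_restrict_of_subset hS h.ae_eq⟩

/-- Continuous functions equal almost everywhere agree up to the closure of the interior; equal
functions have equal gradients inside, and continuity carries this to `S`. -/
lemma eqOn (h : IsC1On S w W g) (h' : IsC1On S w W' g') (hS : S ⊆ closure (interior S)) :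
    Set.EqOn W W' S ∧ Set.EqOn g g' S := by
  have h1 : Set.EqOn W W' S :=
    Measure.eqOn_of_ae_eq (h.ae_eq.trans h'.ae_eq.symm) h.continuousOn h'.continuousOn hS
  have h2 : Set.EqOn g g' (interior S) := fun x hx => by
    refine (h.hasGradientAt x hx).unique ((h'.hasGradientAt x hx).congr_of_eventuallyEq ?_)
    filter_upwards [isOpen_interior.mem_nhds hx] with y hy using h1 (interior_subset hy)
  exact ⟨h1, h2.of_subset_closure h.continuousOn_grad h'.continuousOn_grad interior_subset hS⟩

end IsC1On

namespace IsBody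

variable {S : Set Plane} {c : Plane} {r : ℝ} {ω : Set Plane}

/-- The boundary of a convex set is a null set. Hence it is enough that the open triangle lies in ω.
-/
lemma restrict_interior (hS : IsBody S c r) :
    (volume.restrict (interior S) : Measure Plane) = volume.restrict S :=
  Measure.restrict_congr_set (interior_ae_eq_of_null_frontier (hS.convex.addHaar_frontier _))

lemma memLp_of_interior_subset (hS : IsBody S c r) (hω : interior S ⊆ ω) {f : Plane → ℝ}
    (hf : MemLp f 2 (volume.restrict ω)) : MemLp f 2 (volume.restrict S) := by
  rw [← hS.restrict_interior]
  exact hf.mono_measure (Measure.restrict_mono hω le_rfl)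

end IsBody

section

variable {S : Set Plane} {c : Plane} {r : ℝ} {ω : Set Plane} {w W : Plane → ℝ} {G : Fin 2 → Plane → ℝ}
  {H : Fin 2 → Fin 2 → Plane → ℝ} {D : Fin 2 → Fin 2 → Fin 2 → Plane → ℝ} {g : Plane → Plane}

lemma IsSobolevH3.isSobolev (h : IsSobolevH3 ω w G H D) (hω : IsOpen ω) (hS : IsBody S c r)
    (hSω : interior S ⊆ ω) : IsSobolev S w G ∧ (∀ i, IsSobolev S (G i) (H i)) ∧
      ∀ i j, IsSobolev S (H i j) (D i j) := by
  have hm : ∀ {f : Plane → ℝ}, MemLp f 2 (volume.restrict ω) → MemLp f 2 (volume.restrict S) :=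
    fun hf => hS.memLp_of_interior_subset hSω hf
  exact ⟨⟨hm h.memLp_zero, fun j => hm (h.memLp_one j),
      fun j => hasWeakPartial_mono hω hSω (h.weak_one j)⟩,
    fun i => ⟨hm (h.memLp_one i), fun j => hm (h.memLp_two i j),
      fun j => hasWeakPartial_mono hω hSω (h.weak_two i j)⟩,
    fun i j => ⟨hm (h.memLp_two i j), fun k => hm (h.memLp_three i j k),
      fun k => hasWeakPartial_mono hω hSω (h.weak_three i j k)⟩⟩

lemma IsSobolevH3.exists_isC1On (h : IsSobolevH3 ω w G H D) (hω : IsOpen ω) (hS : IsBody S c r)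
    (hSω : interior S ⊆ ω) : ∃ W g, IsC1On S w W g ∧
      ∀ i, (fun x => g x i) =ᵐ[volume.restrict S] G i := by
  obtain ⟨hw, hG, hH⟩ := h.isSobolev hω hS hSω
  obtain ⟨W, g, h1, h2, h3, h4, h5⟩ := hS.exists_hasGradientAt hw hG hH
  exact ⟨W, g, ⟨h1, h2, h3, h4⟩, h5⟩

lemma IsC1Representative.isC1On (h : IsC1Representative ω w W g) (hS : IsBody S c r)
    (hSω : interior S ⊆ ω) : IsC1On S w W g := by
  have hc : S ⊆ closure ω := hS.subset_closure_interior.trans (closure_mono hSω)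
  refine ⟨h.continuousOn.mono hc, h.continuousOn_grad.mono hc,
    fun x hx => h.hasGradientAt x (hSω hx), ?_⟩
  rw [← hS.restrict_interior]
  exact ae_restrict_of_ae_restrict_of_subset hSω h.ae_eq

lemma isBody_closedBall (x : Plane) (hr : 0 < r) : IsBody (Metric.closedBall x r) x r :=
  ⟨convex_closedBall x r, isCompact_closedBall x r, hr, subset_rfl⟩

lemma IsTri.exists_isBody {T : Finset Plane} (hT : IsTri T) : ∃ c r, IsBody (tri T) c r := by
  obtain ⟨c, hc⟩ := hT.interior_tri_nonempty
  obtain ⟨r, hr, hcr⟩ := Metric.nhds_basis_closedBall.mem_iff.1 (mem_interior_iff_mem_nhds.1 hc)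
  exact ⟨c, r, IsTri.convex_tri T, IsTri.isCompact_tri T, hr, hcr⟩

end

section

variable {ω : Set Plane} {K : SimplicialComplex ℝ Plane} {T T' : Finset Plane} {x : Plane}

lemma exists_isBody (hT : T ∈ triangles K) : ∃ c r, IsBody (tri T) c r :=
  (isTri_of_mem_triangles hT).exists_isBody

/-- A Lipschitz domain is locally connected at its boundary. -/
lemma HasLipschitzBoundary.exists_isPreconnected (h : HasLipschitzBoundary ω)
    (hx : x ∈ frontier ω) {V : Set Plane} (hV : V ∈ 𝓝 x) :
    ∃ N ∈ 𝓝 x, N ⊆ V ∧ IsPreconnected (ω ∩ N) := by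
  obtain ⟨Φ, γ, L, U, hγ, hU, hUω⟩ := h x hx
  set a := Φ x 0 with ha
  set b := Φ x 1 with hb
  have hc0 : Continuous fun y : Plane => Φ y 0 := by fun_prop
  have hc1 : Continuous fun y : Plane => Φ y 1 := by fun_prop
  -- Were `x` above the graph, a whole neighbourhood would miss ω.
  have hab : b ≤ γ a := by
    by_contra! hlt
    have h1 : ∀ᶠ y in 𝓝 x, γ (Φ y 0) < Φ y 1 :=
      ((hγ.continuous.comp hc0).continuousAt).eventually_lt hc1.continuousAt hlt
    obtain ⟨y, ⟨hy1, hyU⟩, hyω⟩ := mem_closure_iff_nhds.1 (frontier_subset_closure hx) _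
      (inter_mem h1 hU)
    exact absurd ((hUω y hyU).1 hyω) (not_lt.2 (le_of_lt hy1))
  obtain ⟨ε, hε, hεV⟩ := Metric.mem_nhds_iff.1 (inter_mem hU hV)
  set η := ε / 2 with hη
  have hη0 : 0 < η := half_pos hε
  -- Over a base interval of this half-width the graph stays above `b - η / 2`, so the box contains
  -- a horizontal segment lying entirely below the graph.
  set δ := min η (η / (2 * (L + 1))) with hδ
  have hδ0 : 0 < δ := lt_min hη0 (by positivity)
  have hγδ : ∀ s, |s - a| < δ → b - η / 2 ≤ γ s := by
    intro s hs
    have h1 := hγ.dist_le_mul s a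
    rw [Real.dist_eq, Real.dist_eq] at h1
    have h2 : (L : ℝ) * |s - a| ≤ η / 2 := by
      have h3 : |s - a| ≤ η / (2 * (L + 1)) := hs.le.trans (min_le_right _ _)
      calc (L : ℝ) * |s - a| ≤ (L + 1) * (η / (2 * (L + 1))) := by
            gcongr; linarith
        _ = η / 2 := by field_simp
    have := neg_abs_le (γ s - γ a)
    linarith
  set N : Set Plane := {y | |Φ y 0 - a| < δ ∧ |Φ y 1 - b| < η} with hN
  have hNx : N ∈ 𝓝 x := by
    refine IsOpen.mem_nhds ?_ ⟨by simpa [ha] using hδ0, by simpa [hb] using hη0⟩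
    exact (isOpen_lt (hc0.sub continuous_const).abs continuous_const).inter
      (isOpen_lt (hc1.sub continuous_const).abs continuous_const)
  have hNV : N ⊆ U ∩ V := by
    intro y hy
    refine hεV ?_
    rw [mem_ball_iff_norm, ← Φ.norm_map, map_sub]
    have e := sum_sq_eq_norm_sq (Φ y - Φ x)
    rw [Fin.sum_univ_two] at e
    have h1 : |(Φ y - Φ x) 0| < η := hy.1.trans_le (min_le_left _ _)
    have h2 : |(Φ y - Φ x) 1| < η := hy.2
    rw [← sq_abs ((Φ y - Φ x) 0), ← sq_abs ((Φ y - Φ x) 1)] at e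
    refine lt_of_pow_lt_pow_left₀ 2 hε.le ?_
    rw [← e, show ε = 2 * η by rw [hη]; ring]
    nlinarith [abs_nonneg ((Φ y - Φ x) 0), abs_nonneg ((Φ y - Φ x) 1)]
  refine ⟨N, hNx, hNV.trans Set.inter_subset_right, ?_⟩
  set M : Set Plane := {z | |z 0 - a| < δ ∧ |z 1 - b| < η ∧ z 1 < γ (z 0)} with hM
  have hMN : ω ∩ N = Φ.symm '' M := by
    rw [Φ.symm.image_eq_preimage_symm]
    ext y
    constructor
    · rintro ⟨h1, h2⟩
      exact ⟨h2.1, h2.2, (hUω y (hNV h2).1).1 h1⟩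
    · rintro ⟨h1, h2, h3⟩
      have hy : y ∈ N := ⟨h1, h2⟩
      exact ⟨(hUω y (hNV hy).1).2 h3, hy⟩
  rw [hMN]
  refine IsPreconnected.image ?_ _ Φ.symm.continuous.continuousOn
  set t := b - η * (3 / 4) with ht
  set P : Set Plane := {z | |z 0 - a| < δ ∧ z 1 = t} with hP
  have hPM : P ⊆ M := by
    rintro z ⟨h1, h2⟩
    refine ⟨h1, ?_, ?_⟩
    · rw [h2, ht, abs_lt]; constructor <;> linarith
    · rw [h2, ht]; linarith [hγδ _ h1]
  have lin : ∀ (i : Fin 2) {A : Set ℝ}, Convex ℝ A → Convex ℝ {z : Plane | z i ∈ A} := fun i A hA =>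
    hA.linear_preimage (EuclideanSpace.proj i : Plane →L[ℝ] ℝ).toLinearMap
  have hPc : Convex ℝ P := by
    have : P = {z : Plane | z 0 ∈ Set.Ioo (a - δ) (a + δ)} ∩ {z : Plane | z 1 ∈ ({t} : Set ℝ)} := by
      ext z
      simp only [hP, Set.mem_inter_iff, Set.mem_ofPred_eq, Set.mem_Ioo, abs_lt, Set.mem_singleton_iff]
      constructor <;> rintro ⟨⟨h1, h2⟩, h3⟩ <;> exact ⟨⟨by linarith, by linarith⟩, h3⟩
    rw [this]
    exact (lin 0 (convex_Ioo _ _)).inter (lin 1 (convex_singleton _))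
  -- Comb argument: each point descends vertically, staying below the graph, to the common
  -- horizontal segment at height `t`.
  refine isPreconnected_of_forall (WithLp.toLp 2 ![a, t]) fun y hy => ?_
  set Q : Set Plane := {z | z 0 ∈ ({y 0} : Set ℝ)} ∩
    {z | z 1 ∈ Set.Ioo (b - η) (min (b + η) (γ (y 0)))} with hQ
  have hQc : Convex ℝ Q := (lin 0 (convex_singleton _)).inter (lin 1 (convex_Ioo _ _))
  have hy2 := abs_lt.1 hy.2.1
  refine ⟨P ∪ Q, Set.union_subset hPM ?_, Or.inl ⟨by simpa using hδ0, by simp⟩, Or.inr ⟨rfl, ?_⟩, ?_⟩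
  · rintro z ⟨h1, h2, h3⟩
    rw [Set.mem_ofPred_eq, Set.mem_singleton_iff] at h1
    rw [lt_min_iff] at h3
    refine ⟨by rw [h1]; exact hy.1, abs_lt.2 ⟨by linarith, by linarith⟩, by rw [h1]; exact h3.2⟩
  · exact ⟨by linarith, lt_min (by linarith) hy.2.2⟩
  · refine hPc.isPreconnected.union (WithLp.toLp 2 ![y 0, t]) ⟨by simpa using hy.1, by simp⟩ ⟨by simp, ?_⟩
      hQc.isPreconnected
    have := hγδ _ hy.1
    refine ⟨?_, lt_min ?_ ?_⟩ <;> simp only [ht, Matrix.cons_val_one, Matrix.cons_val_fin_one] <;>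
      linarith

/-- Piecewise continuous functions which are continuous in a Lipschitz domain are continuous up to
its boundary. -/
lemma HasLipschitzBoundary.eq_of_mem (h : HasLipschitzBoundary ω) (hK : IsTriangulation ω K)
    {E : Type*} [TopologicalSpace E] [T2Space E] {F : Finset Plane → Plane → E}
    (hF : ∀ T ∈ triangles K, ContinuousOn (F T) (tri T))
    (hin : ∀ T ∈ triangles K, ∀ T' ∈ triangles K, ∀ y ∈ ω, y ∈ tri T → y ∈ tri T' → F T y = F T' y)
    (hT : T ∈ triangles K) (hT' : T' ∈ triangles K) (hx : x ∈ tri T) (hx' : x ∈ tri T') :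
    F T x = F T' x := by
  by_cases hxω : x ∈ ω
  · exact hin T hT T' hT' x hxω hx hx'
  have hxf : x ∈ frontier ω :=
    ⟨tri_subset_closure hK hT hx, fun h => hxω (interior_subset h)⟩
  by_contra hne
  have hfin := finite_triangles hK
  -- Finitely many closed triangles: near `x` only those containing `x` occur.
  have e1 : ∀ᶠ y in 𝓝 x, ∀ A ∈ triangles K, y ∈ tri A → x ∈ tri A := by
    refine (eventually_all_finite hfin).2 fun A _ => ?_
    by_cases hA : x ∈ tri A
    · exact Eventually.of_forall fun _ _ => hA
    · filter_upwards [(IsTri.isCompact_tri A).isClosed.isOpen_compl.mem_nhds hA] with y hy hy'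
      exact absurd hy' hy
  -- Two pieces with different values at `x` keep different values at nearby common points.
  have e2 : ∀ᶠ y in 𝓝 x, ∀ A ∈ triangles K, ∀ B ∈ triangles K, x ∈ tri A → x ∈ tri B →
      F A x ≠ F B x → y ∈ tri A → y ∈ tri B → F A y ≠ F B y := by
    refine (eventually_all_finite hfin).2 fun A hA => (eventually_all_finite hfin).2 fun B hB => ?_
    by_cases hAB : x ∈ tri A ∧ x ∈ tri B ∧ F A x ≠ F B x
    · obtain ⟨hxA, hxB, hneq⟩ := hAB
      obtain ⟨O, O', hO, hO', hOx, hOx', hd⟩ := t2_separation hneq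
      filter_upwards [eventually_nhdsWithin_iff.1 ((hF A hA x hxA).eventually (hO.mem_nhds hOx)),
        eventually_nhdsWithin_iff.1 ((hF B hB x hxB).eventually (hO'.mem_nhds hOx'))]
        with y h1 h2 _ _ _ hyA hyB heq
      exact Set.disjoint_left.1 hd (h1 hyA) (heq ▸ h2 hyB)
    · exact Eventually.of_forall fun y h1 h2 h3 => absurd ⟨h1, h2, h3⟩ hAB
  obtain ⟨N, hN, hNV, hNc⟩ := h.exists_isPreconnected hxf (e1.and e2)
  -- The triangles at `x` are sorted by whether their value there is that of `T`. Both unions are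
  -- closed and meet the connected set `ω ∩ N`, which they cover, so they share a point of it; there
  -- the pieces must agree and must differ.
  set P : Set (Finset Plane) := {A | A ∈ triangles K ∧ x ∈ tri A ∧ F A x = F T x} with hP
  set Q : Set (Finset Plane) := {A | A ∈ triangles K ∧ x ∈ tri A ∧ F A x ≠ F T x} with hQ
  have cl : ∀ R : Set (Finset Plane), R ⊆ triangles K → IsClosed (⋃ A ∈ R, tri A) := fun R hR =>
    (hfin.subset hR).isClosed_biUnion fun A _ => (IsTri.isCompact_tri A).isClosed
  have ne : ∀ A ∈ triangles K, x ∈ tri A → ((ω ∩ N) ∩ tri A).Nonempty := by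
    intro A hA hxA
    obtain ⟨c, r, hb⟩ := exists_isBody hA
    obtain ⟨y, hyN, hyA⟩ := mem_closure_iff_nhds.1 (hb.subset_closure_interior hxA) N hN
    exact ⟨y, ⟨hK.interior_subset A hA hyA, hyN⟩, interior_subset hyA⟩
  have hcov : ω ∩ N ⊆ (⋃ A ∈ P, tri A) ∪ ⋃ A ∈ Q, tri A := by
    rintro y ⟨hyω, hyN⟩
    obtain ⟨A, hA, hyA⟩ := (mem_closure_iff_exists hK).1 (subset_closure hyω)
    have hxA := (hNV hyN).1 A hA hyA
    by_cases hAT : F A x = F T x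
    · exact Or.inl (Set.mem_biUnion (show A ∈ P from ⟨hA, hxA, hAT⟩) hyA)
    · exact Or.inr (Set.mem_biUnion (show A ∈ Q from ⟨hA, hxA, hAT⟩) hyA)
  obtain ⟨y, ⟨hyω, hyN⟩, hy1, hy2⟩ := isPreconnected_closed_iff.1 hNc _ _ (cl P fun A hA => hA.1)
    (cl Q fun A hA => hA.1) hcov
    ((ne T hT hx).mono (Set.inter_subset_inter_right _
      (Set.subset_biUnion_of_mem (u := tri) (show T ∈ P from ⟨hT, hx, rfl⟩))))
    ((ne T' hT' hx').mono (Set.inter_subset_inter_right _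
      (Set.subset_biUnion_of_mem (u := tri) (show T' ∈ Q from ⟨hT', hx', Ne.symm hne⟩))))
  obtain ⟨A, hA, hyA⟩ := Set.mem_iUnion₂.1 hy1
  obtain ⟨B, hB, hyB⟩ := Set.mem_iUnion₂.1 hy2
  exact (hNV hyN).2 A hA.1 B hB.1 hA.2.1 hB.2.1 (fun h => hB.2.2 (h.symm.trans hA.2.2)) hyA hyB
    (hin A hA.1 B hB.1 y hyω hyA hyB)

variable {w : Plane → ℝ} {G : Fin 2 → Plane → ℝ} {H : Fin 2 → Fin 2 → Plane → ℝ}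
  {D : Fin 2 → Fin 2 → Fin 2 → Plane → ℝ}

/-- In a Lipschitz domain, functions in `H³` have a representative in `C¹` of the closure. -/
lemma IsSobolevH3.exists_isC1Representative (h : IsSobolevH3 ω w G H D) (hω : IsOpen ω)
    (hK : IsTriangulation ω K) (hL : HasLipschitzBoundary ω) :
    ∃ W g, IsC1Representative ω w W g := by
  have hex : ∀ T, ∃ W g, T ∈ triangles K → IsC1On (tri T) w W g := by
    intro T
    by_cases hT : T ∈ triangles K
    · obtain ⟨c, r, hb⟩ := exists_isBody hT
      obtain ⟨W, g, hWg, -⟩ := h.exists_isC1On hω hb (hK.interior_subset T hT)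
      exact ⟨W, g, fun _ => hWg⟩
    · exact ⟨0, 0, fun h => absurd h hT⟩
  choose W g hWg using hex
  -- Around an interior point of ω, a representative on a small ball agrees with that of every
  -- triangle on the overlap, so the triangle pieces agree with each other in ω.
  have hball : ∀ x ∈ ω, ∃ r > 0, Metric.ball x r ⊆ ω ∧ ∃ W₀ g₀, IsC1On (Metric.ball x r) w W₀ g₀ ∧
      ∀ T ∈ triangles K, ∀ y ∈ Metric.ball x r, y ∈ tri T → W T y = W₀ y ∧ g T y = g₀ y := by
    intro x hx
    obtain ⟨r, hr, hrω⟩ := Metric.nhds_basis_closedBall.mem_iff.1 (hω.mem_nhds hx)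
    obtain ⟨W₀, g₀, h₀, -⟩ := h.exists_isC1On hω (isBody_closedBall x hr)
      (interior_subset.trans hrω)
    have h₀' := h₀.mono Metric.ball_subset_closedBall
    refine ⟨r, hr, Metric.ball_subset_closedBall.trans hrω, W₀, g₀, h₀', fun T hT y hy hyT => ?_⟩
    obtain ⟨c, ρ, hb⟩ := exists_isBody hT
    have hS : tri T ∩ Metric.ball x r ⊆ closure (interior (tri T ∩ Metric.ball x r)) := by
      rintro z ⟨hz1, hz2⟩
      rw [interior_inter, Metric.isOpen_ball.interior_eq, Set.inter_comm]
      exact Metric.isOpen_ball.inter_closure ⟨hz2, hb.subset_closure_interior hz1⟩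
    have := ((hWg T hT).mono Set.inter_subset_left).eqOn (h₀'.mono Set.inter_subset_right) hS
    exact ⟨this.1 ⟨hyT, hy⟩, this.2 ⟨hyT, hy⟩⟩
  have hF : ∀ T ∈ triangles K, ContinuousOn (fun x => (W T x, g T x)) (tri T) := fun T hT =>
    (hWg T hT).continuousOn.prodMk (hWg T hT).continuousOn_grad
  obtain ⟨P, hPc, hP⟩ := exists_glue hK hF fun T hT T' hT' x hx hx' =>
    hL.eq_of_mem (F := fun T x => (W T x, g T x)) hK hF (fun A hA B hB y hy hyA hyB => by
      obtain ⟨r, hr, -, W₀, g₀, -, h0⟩ := hball y hy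
      have hA' := h0 A hA y (Metric.mem_ball_self hr) hyA
      have hB' := h0 B hB y (Metric.mem_ball_self hr) hyB
      exact Prod.ext (hA'.1.trans hB'.1.symm) (hA'.2.trans hB'.2.symm)) hT hT' hx hx'
  refine ⟨fun x => (P x).1, fun x => (P x).2, continuous_fst.comp_continuousOn hPc,
    continuous_snd.comp_continuousOn hPc, fun x hx => ?_, ?_⟩
  · obtain ⟨r, hr, hrω, W₀, g₀, h₀, h0⟩ := hball x hx
    have hloc : ∀ y ∈ Metric.ball x r, (P y).1 = W₀ y ∧ (P y).2 = g₀ y := by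
      intro y hy
      obtain ⟨T, hT, hyT⟩ := (mem_closure_iff_exists hK).1 (subset_closure (hrω hy))
      rw [hP T hT hyT]
      exact h0 T hT y hy hyT
    have hxr := Metric.mem_ball_self (x := x) hr
    have h1 := h₀.hasGradientAt x (by rwa [Metric.isOpen_ball.interior_eq])
    rw [← (hloc x hxr).2] at h1
    refine h1.congr_of_eventuallyEq ?_
    filter_upwards [Metric.isOpen_ball.mem_nhds hxr] with y hy using (hloc y hy).1
  · have h1 : ∀ᵐ x ∂(volume : Measure Plane), ∀ T ∈ triangles K, x ∈ tri T → W T x = w x := by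
      rw [ae_ball_iff (finite_triangles hK).countable]
      exact fun T hT => (ae_restrict_iff' (measurableSet_tri T)).1 (hWg T hT).ae_eq
    refine (ae_restrict_iff' hω.measurableSet).2 ?_
    filter_upwards [h1] with x hx hxω
    obtain ⟨T, hT, hxT⟩ := (mem_closure_iff_exists hK).1 (subset_closure hxω)
    rw [hP T hT hxT]
    exact hx T hT hxT

lemma exists_isDiscreteGradientH3 (h : IsSobolevH3 ω w G H D) (hω : IsOpen ω)
    (hK : IsTriangulation ω K) (hL : HasLipschitzBoundary ω) :
    ∃ θ, IsDiscreteGradientH3 ω K w θ := by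
  obtain ⟨W, g, hWg⟩ := h.exists_isC1Representative hω hK hL
  obtain ⟨v, hv, hvW⟩ := exists_isDKT hK W g
  obtain ⟨θ, hθ⟩ := exists_isDiscreteGradient hK hv
  exact ⟨θ, v, ⟨hv, W, g, hWg, hvW⟩, hθ⟩

/-- On a triangle, the discrete gradient is determined by any representative in `C¹`. -/
lemma IsDiscreteGradientH3.eqOn_gradForm {θ : Plane → Plane} (hθ : IsDiscreteGradientH3 ω K w θ)
    (hK : IsTriangulation ω K) (hT : T ∈ triangles K) {W : Plane → ℝ} {g : Plane → Plane}
    (hW : IsC1On (tri T) w W g) :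
    Set.EqOn θ (gradForm T g (trapezoidExcess W g)) (tri T) := by
  obtain ⟨v, ⟨hv, W', g', hW', hvW⟩, hθ⟩ := hθ
  obtain ⟨c, r, hb⟩ := exists_isBody hT
  obtain ⟨h1, h2⟩ := (hW'.isC1On hb (hK.interior_subset T hT)).eqOn hW hb.subset_closure_interior
  refine hθ.eqOn_gradForm_of_nodal hv hT fun z hz => ?_
  obtain ⟨h3, h4⟩ := hvW T hT z hz
  exact ⟨h3.trans (h1 (IsTri.vertex_mem hz)), h4.trans (h2 (IsTri.vertex_mem hz))⟩

/-- Uniqueness is local and independent of the regularity of the boundary: on each triangle the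
class of `w` has its own C¹ representative, which fixes the nodal data. -/
lemma IsDiscreteGradientH3.eqOn {θ θ' : Plane → Plane} (h : IsSobolevH3 ω w G H D) (hω : IsOpen ω)
    (hK : IsTriangulation ω K) (hθ : IsDiscreteGradientH3 ω K w θ)
    (hθ' : IsDiscreteGradientH3 ω K w θ') : Set.EqOn θ θ' (closure ω) := by
  intro x hx
  obtain ⟨T, hT, hxT⟩ := (mem_closure_iff_exists hK).1 hx
  obtain ⟨c, r, hb⟩ := exists_isBody hT
  obtain ⟨W, g, hWg, -⟩ := h.exists_isC1On hω hb (hK.interior_subset T hT)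
  rw [hθ.eqOn_gradForm hK hT hWg hxT, hθ'.eqOn_gradForm hK hT hWg hxT]

end

end

noncomputable section

/-! ### Approximation by the discrete gradient -/

open Filter Topology

lemma l2norm_sq_eq_sum {ι : Type} [Fintype ι] {S : Set Plane} {f : Plane → ι → ℝ}
    (hf : ∀ i, MemLp (fun x => f x i) 2 (volume.restrict S)) :
    l2norm S f ^ 2 = ∑ i, l2n (volume.restrict S) (fun x => f x i) ^ 2 := by
  rw [l2norm_sq, integral_finsetSum _ fun i _ => (hf i).integrable_sq]
  exact Finset.sum_congr rfl fun i _ => (l2n_sq (hf i)).symm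

/-- A crude triangle inequality; the factor two comes from bounding the square of a sum by twice the
sum of squares. -/
lemma l2norm_sub_le {ι : Type} [Fintype ι] {S : Set Plane} {f g k : Plane → ι → ℝ}
    (hf : ∀ i, MemLp (fun x => f x i) 2 (volume.restrict S))
    (hg : ∀ i, MemLp (fun x => g x i) 2 (volume.restrict S))
    (hk : ∀ i, MemLp (fun x => k x i) 2 (volume.restrict S)) :
    l2norm S (fun x i => f x i - k x i) ≤
      2 * l2norm S (fun x i => f x i - g x i) + 2 * l2norm S (fun x i => g x i - k x i) := by
  have n1 := l2norm_nonneg S (fun x i => f x i - g x i)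
  have n2 := l2norm_nonneg S (fun x i => g x i - k x i)
  refine le_of_sq_le_sq ?_ (by positivity)
  have h1 := l2norm_sq_eq_sum (f := fun x i => f x i - k x i) fun i => (hf i).sub (hk i)
  have h2 := l2norm_sq_eq_sum (f := fun x i => f x i - g x i) fun i => (hf i).sub (hg i)
  have h3 := l2norm_sq_eq_sum (f := fun x i => g x i - k x i) fun i => (hg i).sub (hk i)
  have h4 : l2norm S (fun x i => f x i - k x i) ^ 2 ≤
      2 * l2norm S (fun x i => f x i - g x i) ^ 2 + 2 * l2norm S (fun x i => g x i - k x i) ^ 2 := by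
    rw [h1, h2, h3, Finset.mul_sum, Finset.mul_sum, ← Finset.sum_add_distrib]
    refine Finset.sum_le_sum fun i _ => ?_
    have h5 := pow_le_pow_left₀ l2n_nonneg (l2n_sub_le (hf i) (hg i) (hk i)) 2
    refine h5.trans ?_
    nlinarith [sq_nonneg (l2n (volume.restrict S) (fun x => f x i - g x i) -
      l2n (volume.restrict S) (fun x => g x i - k x i))]
  nlinarith [mul_nonneg n1 n2]

section

variable {S : Set Plane} {c a b : Plane} {r m : ℝ} {W : Plane → ℝ} {g : Plane → Plane}
  {p₀ : Plane} {L : Plane →L[ℝ] Plane}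

/-- The trapezoidal rule integrates an affine field along a segment exactly, whether or not its
matrix is symmetric. Subtracting this quadratic primitive from `W` leaves a function of one variable
with small derivative. -/
lemma abs_sub_trapezoid_le_of_segment
    (hg : ∀ x ∈ segment ℝ a b, HasGradientAt W (g x) x)
    (hm : ∀ x ∈ segment ℝ a b, ‖g x - (p₀ + L (x - c))‖ ≤ m) :
    |W b - W a - 1 / 2 * inner ℝ ((p₀ + L (a - c)) + (p₀ + L (b - c))) (b - a)| ≤ m * ‖b - a‖ := by
  set e := b - a with he
  set φ : ℝ → ℝ := fun s => W (a + s • e) -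
    (s * inner ℝ (p₀ + L (a - c)) e + s ^ 2 / 2 * inner ℝ (L e) e) with hφ
  set φ' : ℝ → ℝ := fun s => inner ℝ (g (a + s • e) - (p₀ + L (a + s • e - c))) e with hφ'
  have hseg : ∀ s ∈ Set.Icc (0 : ℝ) 1, a + s • e ∈ segment ℝ a b := by
    intro s hs
    rw [segment_eq_image']
    exact ⟨s, hs, rfl⟩
  have hd : ∀ s ∈ Set.Icc (0 : ℝ) 1, HasDerivWithinAt φ (φ' s) (Set.Icc 0 1) s := by
    intro s hs
    have h1 : HasDerivAt (fun s : ℝ => a + s • e) e s := by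
      simpa using ((hasDerivAt_id s).smul_const e).const_add a
    have h2 := (hg _ (hseg s hs)).hasFDerivAt.comp_hasDerivAt s h1
    have h3 : HasDerivAt (fun s : ℝ => s * inner ℝ (p₀ + L (a - c)) e +
        s ^ 2 / 2 * inner ℝ (L e) e) (inner ℝ (p₀ + L (a - c)) e + s * inner ℝ (L e) e) s := by
      refine (((hasDerivAt_id s).mul_const _).add
        (((hasDerivAt_pow 2 s).div_const 2).mul_const _)).congr_deriv ?_
      simp
    refine ((h2.sub h3).congr_deriv ?_).hasDerivWithinAt
    have e1 : p₀ + L (a + s • e - c) = p₀ + L (a - c) + s • L e := by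
      rw [show a + s • e - c = (a - c) + s • e by abel, map_add, map_smul, add_assoc]
    simp only [hφ']
    rw [e1]
    simp only [inner_sub_left, inner_add_left, inner_smul_left,
      InnerProductSpace.toDual_apply_apply, conj_trivial]
  have hb : ∀ s ∈ Set.Ico (0 : ℝ) 1, ‖φ' s‖ ≤ m * ‖e‖ := by
    intro s hs
    refine (norm_inner_le_norm _ _).trans ?_
    gcongr
    exact hm _ (hseg s ⟨hs.1, hs.2.le⟩)
  have key := norm_image_sub_le_of_norm_deriv_le_segment_01' hd hb
  refine le_trans (le_of_eq ?_) key
  rw [Real.norm_eq_abs]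
  congr 1
  have e2 : b - c = (a - c) + e := by rw [he]; abel
  simp only [hφ, e2, map_add, inner_add_left, one_smul, zero_smul, add_zero, he, add_sub_cancel]
  ring

/-- The error of the trapezoidal rule for the increments of a function whose gradient is close to
an affine field. -/
lemma IsBody.abs_sub_trapezoid_le (hS : IsBody S c r) (hW : ContinuousOn W S)
    (hg : ∀ x ∈ interior S, HasGradientAt W (g x) x)
    (hm : ∀ x ∈ S, ‖g x - (p₀ + L (x - c))‖ ≤ m) (ha : a ∈ S) (hb : b ∈ S) :
    |W b - W a - 1 / 2 * inner ℝ ((p₀ + L (a - c)) + (p₀ + L (b - c))) (b - a)| ≤ m * ‖b - a‖ := by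
  have hc : c ∈ interior S := interior_mono hS.ball
    (by rw [interior_closedBall _ hS.pos.ne']; exact Metric.mem_ball_self hS.pos)
  -- The gradient is known only in the interior, so the end points are moved slightly towards `c`
  -- and then returned by continuity.
  set q : Plane → ℝ → Plane := fun a t => a + t • (c - a) with hq
  have hin : ∀ a ∈ S, ∀ t ∈ Set.Ioc (0 : ℝ) 1, q a t ∈ interior S := fun a ha t ht =>
    hS.convex.add_smul_sub_mem_interior' (subset_closure ha) hc ht
  have hev : ∀ᶠ t : ℝ in 𝓝[>] 0, t ∈ Set.Ioc (0 : ℝ) 1 := Ioc_mem_nhdsGT zero_lt_one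
  have hqc : ∀ a, Tendsto (q a) (𝓝[>] 0) (𝓝 a) := by
    intro a
    have : Continuous (q a) := by simp only [hq]; fun_prop
    have h := this.tendsto 0
    simp only [hq, zero_smul, add_zero] at h
    exact h.mono_left nhdsWithin_le_nhds
  have hWc : ∀ a ∈ S, Tendsto (fun t => W (q a t)) (𝓝[>] 0) (𝓝 (W a)) := fun a ha =>
    (hW a ha).tendsto.comp (tendsto_nhdsWithin_iff.2 ⟨hqc a, hev.mono fun t ht =>
      interior_subset (hin a ha t ht)⟩)
  have hLc : ∀ a, Tendsto (fun t => p₀ + L (q a t - c)) (𝓝[>] 0) (𝓝 (p₀ + L (a - c))) := fun a =>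
    ((L.continuous.tendsto _).comp ((hqc a).sub_const c)).const_add p₀
  have hl := (((hWc b hb).sub (hWc a ha)).sub ((((hLc a).add (hLc b)).inner
    ((hqc b).sub (hqc a))).const_mul (1 / 2))).abs
  refine le_of_tendsto_of_tendsto hl (((hqc b).sub (hqc a)).norm.const_mul m) ?_
  filter_upwards [hev] with t ht
  have hseg : segment ℝ (q a t) (q b t) ⊆ interior S :=
    hS.convex.interior.segment_subset (hin a ha t ht) (hin b hb t ht)
  exact abs_sub_trapezoid_le_of_segment (fun x hx => hg x (hseg hx))
    fun x hx => hm x (interior_subset (hseg hx))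

/-- Linear interpolation reproduces affine fields; the edge terms are left untouched. -/
lemma gradForm_eq_affine_add {T : Finset Plane} (hT : IsTri T) (p₀ : Plane) (L : Plane →L[ℝ] Plane)
    (c : Plane) (δ : Plane → Plane → ℝ) (x : Plane) :
    gradForm T g δ x = p₀ + L (x - c) + gradForm T (fun z => g z - (p₀ + L (z - c))) δ x := by
  have h1 : ∑ a ∈ T, bary T a x • (p₀ + L (a - c)) = p₀ + L (x - c) := by
    have : ∀ a, bary T a x • (p₀ + L (a - c)) = bary T a x • (p₀ - L c) + L (bary T a x • a) := by
      intro a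
      rw [map_sub, map_smul]
      module
    rw [Finset.sum_congr rfl fun a _ => this a, Finset.sum_add_distrib, ← Finset.sum_smul,
      ← map_sum, hT.sum_bary, hT.sum_bary_smul, map_sub]
    module
  simp only [gradForm, smul_sub, Finset.sum_sub_distrib, h1]
  abel

lemma gradFormDeriv_eq_affine_add {T : Finset Plane} (hT : IsTri T) (p₀ : Plane)
    (L : Plane →L[ℝ] Plane) (c : Plane) (δ : Plane → Plane → ℝ) (x v : Plane) :
    gradFormDeriv T g δ x v =
      L v + gradFormDeriv T (fun z => g z - (p₀ + L (z - c))) δ x v := by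
  have h1 : ∑ a ∈ T, dbary T a v • (p₀ + L (a - c)) = L v := by
    have : ∀ a, dbary T a v • (p₀ + L (a - c)) = dbary T a v • p₀ + L (dbary T a v • (a - c)) := by
      intro a
      rw [map_smul]
      module
    rw [Finset.sum_congr rfl fun a _ => this a, Finset.sum_add_distrib, ← Finset.sum_smul,
      ← map_sum, sum_dbary hT, sum_dbary_smul hT, zero_smul, zero_add]
  simp only [gradFormDeriv, smul_sub, Finset.sum_sub_distrib, h1]
  abel

end

/-- The linear map with matrix `B`. -/
def matMap (B : Fin 2 → Fin 2 → ℝ) : Plane →L[ℝ] Plane :=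
  ∑ i, (coordForm (B i)).smulRight (EuclideanSpace.single i 1)

lemma matMap_apply (B : Fin 2 → Fin 2 → ℝ) (v : Plane) (i : Fin 2) :
    matMap B v i = ∑ j, B i j * v j := by
  fin_cases i <;> simp [matMap]

section

variable {κ ρ : ℝ} {T : Finset Plane} {c : Plane} {w W : Plane → ℝ} {G : Fin 2 → Plane → ℝ}
  {H : Fin 2 → Fin 2 → Plane → ℝ} {D : Fin 2 → Fin 2 → Fin 2 → Plane → ℝ} {g θ : Plane → Plane}

lemma IsRegTri.isBody (hT : IsRegTri κ T c ρ) : IsBody (tri T) c ρ :=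
  ⟨IsTri.convex_tri T, IsTri.isCompact_tri T, hT.pos, hT.ball⟩

/-- On a convex set, a gradient field with two weak derivatives in `L²` is uniformly close to an
affine field, the linear part of which is the average of the derivative. -/
lemma IsBody.norm_sub_affine_le {S : Set Plane} {r h : ℝ} (hS : IsBody S c r)
    (hh : ∀ x ∈ S, ∀ y ∈ S, ‖x - y‖ ≤ h) (hG : ∀ i, IsSobolev S (G i) (H i))
    (hH : ∀ i j, IsSobolev S (H i j) (D i j)) (hgc : ContinuousOn g S)
    (hg : ∀ i, (fun x => g x i) =ᵐ[volume.restrict S] G i) {x : Plane} (hx : x ∈ S) :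
    ‖g x - (WithLp.toLp 2 (fun i => avgTaylor S (G i) (H i) c) +
      matMap (fun i j => (volume.real S)⁻¹ * ∫ y in S, H i j y) (x - c))‖ ^ 2 ≤
      h ^ 4 * (volume.real S)⁻¹ * l2norm S (fun x (p : Fin 2 × Fin 2 × Fin 2) =>
        D p.1 p.2.1 p.2.2 x) ^ 2 := by
  -- The averaged Taylor polynomial is affine in `x`, and its linear coefficients are the mean
  -- values of the second derivatives.
  have hav : ∀ i, avgTaylor S (G i) (H i) x = avgTaylor S (G i) (H i) c +
      ∑ j, (volume.real S)⁻¹ * (∫ y in S, H i j y) * (x j - c j) := by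
    intro i
    have hi := fun j => (abs_mul_coord_integral_le hS.isCompact hh ((hG i).memLp_deriv j) j hx).1
    have hi' := fun j =>
      (abs_mul_coord_integral_le hS.isCompact hh ((hG i).memLp_deriv j) j hS.center_mem).1
    have e : ∀ j, ∫ y in S, H i j y * (x j - y j) =
        (∫ y in S, H i j y * (c j - y j)) + (∫ y in S, H i j y) * (x j - c j) := by
      intro j
      rw [← integral_mul_const, ← sub_eq_iff_eq_add', ← integral_sub (hi j) (hi' j)]
      exact integral_congr_ae (Eventually.of_forall fun y => by simp only; ring)
    rw [avgTaylor_eq hS.isCompact hh (hG i).memLp (hG i).memLp_deriv hx,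
      avgTaylor_eq hS.isCompact hh (hG i).memLp (hG i).memLp_deriv hS.center_mem]
    simp only [e, Finset.sum_add_distrib, mul_assoc, ← Finset.mul_sum]
    ring
  rw [← sum_sq_eq_norm_sq, l2norm_sq_eq_sum (f := fun x (p : Fin 2 × Fin 2 × Fin 2) =>
        D p.1 p.2.1 p.2.2 x) fun p => (hH p.1 p.2.1).memLp_deriv p.2.2,
    Fintype.sum_prod_type, Finset.mul_sum]
  refine Finset.sum_le_sum fun i _ => ?_
  rw [Fintype.sum_prod_type]
  have hc : ContinuousOn (fun x => g x i) S :=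
    (EuclideanSpace.proj i : Plane →L[ℝ] ℝ).continuous.comp_continuousOn hgc
  have := hS.sq_sub_avgTaylor_le_of_isSobolev hh (hG i) (hH i) hc (hg i) hx
  rw [hav] at this
  simpa only [PiLp.sub_apply, PiLp.add_apply, matMap_apply] using this

/-- The approximation properties of the discrete gradient. -/
lemma exists_approx_le (κ : ℝ) : ∃ C : ℝ, 0 < C ∧ ∀ (T : Finset Plane) (c : Plane) (ρ : ℝ),
    IsRegTri κ T c ρ → ∀ (w W : Plane → ℝ) (G : Fin 2 → Plane → ℝ)
      (H : Fin 2 → Fin 2 → Plane → ℝ) (D : Fin 2 → Fin 2 → Fin 2 → Plane → ℝ) (g θ : Plane → Plane),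
    (∀ i, IsSobolev (tri T) (G i) (H i)) → (∀ i j, IsSobolev (tri T) (H i j) (D i j)) →
    IsC1On (tri T) w W g → (∀ i, (fun x => g x i) =ᵐ[volume.restrict (tri T)] G i) →
    Set.EqOn θ (gradForm T g (trapezoidExcess W g)) (tri T) →
    l2norm (tri T) (fun x i => G i x - θ x i) +
        diamT T * l2norm (tri T) (fun x (p : Fin 2 × Fin 2) => H p.1 p.2 x - jacT θ T x p) ≤
      C * diamT T ^ 2 * l2norm (tri T) (fun x (p : Fin 2 × Fin 2 × Fin 2) =>
        D p.1 p.2.1 p.2.2 x) := by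
  set β := volume.real (Metric.ball (0 : Plane) 1) with hβ
  have hβ0 : 0 < β := ENNReal.toReal_pos (Metric.measure_ball_pos _ _ one_pos).ne'
    measure_ball_lt_top.ne
  set M := |κ| / √β with hM
  -- The first summand bounds the error of the field, the second that of its derivative: 4 from the
  -- Poincaré inequality and the rest from the affine approximation. The last summand only ensures
  -- positivity.
  refine ⟨√(2 * β) * |κ| * (61 * M) + (4 + 2 * (√(4 * β) * |κ| * (60 * M))) + 1, by positivity,
    fun T c ρ hT w W G H D g θ hG hH hW hg hθ => ?_⟩
  have hκ0 : 0 < κ := by linarith [hT.two_le]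
  rw [abs_of_pos hκ0] at *
  have hS := hT.isBody
  have hρ := hT.pos
  set h := diamT T with hh_def
  have hh : ∀ x ∈ tri T, ∀ y ∈ tri T, ‖x - y‖ ≤ h := fun x hx y hy => IsTri.norm_sub_le_diam hx hy
  have h0 : 0 < h := hT.diam_pos
  have h2ρ : 2 * ρ ≤ h := IsTri.two_mul_le_diam hT.pos hT.ball
  set V := volume.real (tri T) with hV
  have hVle : β * ρ ^ 2 ≤ V := hT.le_volume
  have hV0 : 0 < V := hS.volume_pos
  set N := l2norm (tri T) (fun x (p : Fin 2 × Fin 2 × Fin 2) => D p.1 p.2.1 p.2.2 x) with hN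
  have hN0 : 0 ≤ N := l2norm_nonneg _ _
  set B : Fin 2 → Fin 2 → ℝ := fun i j => V⁻¹ * ∫ y in tri T, H i j y with hB
  set p₀ : Plane := WithLp.toLp 2 (fun i => avgTaylor (tri T) (G i) (H i) c) with hp₀
  set L := matMap B with hL
  set m := M * h * N with hm
  have hM0 : 0 ≤ M := by positivity
  have hm0 : 0 ≤ m := by positivity
  -- The area is at least βρ² and h is at most κρ, so h⁴/V is at most κ²h²/β; this explains the
  -- choice of `M`.
  have hgp : ∀ x ∈ tri T, ‖g x - (p₀ + L (x - c))‖ ≤ m := by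
    intro x hx
    have h1 := hS.norm_sub_affine_le hh hG hH hW.continuousOn_grad hg hx
    refine le_of_sq_le_sq (h1.trans ?_) hm0
    rw [hm, mul_pow, mul_pow, hM, div_pow, Real.sq_sqrt hβ0.le]
    refine mul_le_mul_of_nonneg_right ?_ (sq_nonneg N)
    rw [← div_eq_mul_inv, div_mul_eq_mul_div, div_le_div_iff₀ hV0 hβ0]
    have h3 : h ^ 2 ≤ κ ^ 2 * ρ ^ 2 := by
      rw [← mul_pow]
      exact pow_le_pow_left₀ h0.le hT.diam_le 2
    calc h ^ 4 * β = h ^ 2 * (h ^ 2 * β) := by ring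
      _ ≤ h ^ 2 * (κ ^ 2 * ρ ^ 2 * β) := by gcongr
      _ = κ ^ 2 * h ^ 2 * (β * ρ ^ 2) := by ring
      _ ≤ κ ^ 2 * h ^ 2 * V := by gcongr
  -- One part is the trapezoidal error relative to the affine field; the other comes from replacing
  -- the affine end point values by those of `g`.
  have hδ : ∀ a ∈ T, ∀ b ∈ T, |trapezoidExcess W g a b| ≤ 2 * m * ‖b - a‖ := by
    intro a ha b hb
    have ha' : a ∈ tri T := IsTri.vertex_mem ha
    have hb' : b ∈ tri T := IsTri.vertex_mem hb
    have h1 := hS.abs_sub_trapezoid_le hW.continuousOn hW.hasGradientAt hgp ha' hb'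
    set pa := p₀ + L (a - c)
    set pb := p₀ + L (b - c)
    have h2 : |1 / 2 * inner ℝ ((g a - pa) + (g b - pb)) (b - a)| ≤ m * ‖b - a‖ := by
      rw [abs_mul, abs_of_pos (by norm_num)]
      have h3 := abs_real_inner_le_norm ((g a - pa) + (g b - pb)) (b - a)
      have h4 : ‖(g a - pa) + (g b - pb)‖ ≤ m + m :=
        (norm_add_le _ _).trans (add_le_add (hgp a ha') (hgp b hb'))
      have h5 := mul_le_mul_of_nonneg_right h4 (norm_nonneg (b - a))
      linarith
    have e : trapezoidExcess W g a b = (W b - W a - 1 / 2 * inner ℝ (pa + pb) (b - a)) -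
        1 / 2 * inner ℝ ((g a - pa) + (g b - pb)) (b - a) := by
      rw [trapezoidExcess]
      simp only [inner_add_left, inner_sub_left]
      ring
    rw [e]
    refine (abs_sub _ _).trans ?_
    linarith
  have hθg : ∀ x ∈ tri T, ∀ i, |g x i - θ x i| ≤ 61 * m := by
    intro x hx i
    have h1 := norm_gradForm_le (g := fun z => g z - (p₀ + L (z - c))) (m := 2 * m) hT.toIsTri hx
      (fun a ha => (hgp a (IsTri.vertex_mem ha)).trans (by linarith)) hδ
    have h2 : g x - θ x = (g x - (p₀ + L (x - c))) -
        gradForm T (fun z => g z - (p₀ + L (z - c))) (trapezoidExcess W g) x := by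
      rw [hθ hx, gradForm_eq_affine_add hT.toIsTri p₀ L c]
      abel
    have h3 := abs_coord_le (g x - θ x) i
    rw [PiLp.sub_apply] at h3
    refine h3.trans ?_
    rw [h2]
    refine (norm_sub_le _ _).trans ?_
    linarith [hgp x hx]
  have hjac : ∀ x ∈ tri T, ∀ p : Fin 2 × Fin 2, |B p.1 p.2 - jacT θ T x p| ≤ 60 * m * ρ⁻¹ := by
    intro x hx p
    have h1 := norm_gradFormDeriv_le (g := fun z => g z - (p₀ + L (z - c))) (m := 2 * m)
      (r := (2 * ρ)⁻¹) (δ := trapezoidExcess W g) hT.toIsTri hT.norm_dbary hx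
      (fun a ha b hb => (norm_sub_le _ _).trans (by
        linarith [hgp a (IsTri.vertex_mem ha), hgp b (IsTri.vertex_mem hb)])) hδ
      (EuclideanSpace.single p.2 1)
    rw [jacT_gradForm hT.toIsTri hθ hx, gradFormDeriv_eq_affine_add hT.toIsTri p₀ L c,
      PiLp.add_apply, hL, matMap_apply]
    have h2 : ∑ j, B p.1 j * (EuclideanSpace.single p.2 (1 : ℝ) : Plane) j = B p.1 p.2 := by
      simp
    rw [h2, sub_add_cancel_left, abs_neg]
    refine (abs_coord_le _ _).trans (h1.trans (le_of_eq ?_))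
    rw [PiLp.norm_single, norm_one, mul_inv]
    ring
  have hcont : ∀ {P : Plane → ℝ}, ContinuousOn P (tri T) → MemLp P 2 (volume.restrict (tri T)) :=
    fun hP => hS.memLp_of_continuousOn hP
  have e1 : l2norm (tri T) (fun x i => G i x - θ x i) = l2norm (tri T) (fun x i => g x i - θ x i) := by
    rw [l2norm, l2norm]
    congr 1
    refine integral_congr_ae ?_
    filter_upwards [hg 0, hg 1] with x h0 h1
    simp only [Fin.sum_univ_two]
    rw [h0, h1]
  have b1 : l2norm (tri T) (fun x i => G i x - θ x i) ≤ √(2 * β) * (κ * ρ) * (61 * m) := by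
    rw [e1]
    have := l2norm_le_of_abs_le hT (f := fun x i => g x i - θ x i) (by positivity) hθg
    simpa using this
  have b2 : l2norm (tri T) (fun x (p : Fin 2 × Fin 2) => B p.1 p.2 - jacT θ T x p) ≤
      √(4 * β) * (κ * ρ) * (60 * m * ρ⁻¹) := by
    have := l2norm_le_of_abs_le hT (f := fun x (p : Fin 2 × Fin 2) => B p.1 p.2 - jacT θ T x p)
      (by positivity) hjac
    rwa [show ((Fintype.card (Fin 2 × Fin 2) : ℕ) : ℝ) = 4 by norm_num] at this
  -- Componentwise Poincaré inequality, since `B` consists of the mean values of `H`.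
  have b3 : l2norm (tri T) (fun x (p : Fin 2 × Fin 2) => H p.1 p.2 x - B p.1 p.2) ≤ 2 * h * N := by
    refine le_of_sq_le_sq ?_ (by positivity)
    rw [l2norm_sq_eq_sum (f := fun x (p : Fin 2 × Fin 2) => H p.1 p.2 x - B p.1 p.2) fun p =>
        (hH p.1 p.2).memLp.sub (hcont continuousOn_const), mul_pow, hN,
      l2norm_sq_eq_sum (f := fun x (p : Fin 2 × Fin 2 × Fin 2) => D p.1 p.2.1 p.2.2 x) fun p =>
        (hH p.1 p.2.1).memLp_deriv p.2.2, Fintype.sum_prod_type, Fintype.sum_prod_type,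
      Finset.mul_sum]
    refine Finset.sum_le_sum fun i _ => ?_
    rw [Fintype.sum_prod_type, Finset.mul_sum]
    refine Finset.sum_le_sum fun j _ => (hS.l2n_sub_average_le hh (hH i j)).trans ?_
    gcongr
    nlinarith [sq_nonneg h]
  have b4 := l2norm_sub_le (S := tri T) (f := fun x (p : Fin 2 × Fin 2) => H p.1 p.2 x)
    (g := fun x (p : Fin 2 × Fin 2) => B p.1 p.2) (k := jacT θ T)
    (fun p => (hH p.1 p.2).memLp) (fun p => hcont continuousOn_const) (fun p => by
      obtain ⟨P, hP, hPe⟩ := polyFun_jacT hT.toIsTri hθ p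
      exact hcont (hP.continuous.continuousOn.congr hPe))
  have b5 : √(2 * β) * (κ * ρ) * (61 * m) ≤ √(2 * β) * κ * (61 * M) * h ^ 2 * N := by
    rw [hm]
    have : ρ ≤ h := by linarith
    calc √(2 * β) * (κ * ρ) * (61 * (M * h * N)) = √(2 * β) * κ * (61 * M) * (ρ * h) * N := by ring
      _ ≤ √(2 * β) * κ * (61 * M) * (h * h) * N := by gcongr
      _ = _ := by ring
  have b6 : √(4 * β) * (κ * ρ) * (60 * m * ρ⁻¹) = √(4 * β) * κ * (60 * M) * h * N := by
    rw [hm]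
    field_simp
  have b7 : h * l2norm (tri T) (fun x (p : Fin 2 × Fin 2) => H p.1 p.2 x - jacT θ T x p) ≤
      h * (2 * (2 * h * N) + 2 * (√(4 * β) * κ * (60 * M) * h * N)) := by
    gcongr
    refine b4.trans ?_
    rw [b6] at b2
    linarith
  have : 0 ≤ h ^ 2 * N := by positivity
  have : 0 ≤ √(4 * β) * κ * (60 * M) * (h ^ 2 * N) := by positivity
  nlinarith

end

end

noncomputable section

/-! ### Comparison of global norms -/

section

open Filter Topology

variable {ω : Set Plane} {K : SimplicialComplex ℝ Plane} {T T' : Finset Plane}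

/-- On a common open set the barycentric coordinate of a vertex that is not shared would vanish,
hence, being affine, vanish everywhere; but it equals one at that vertex. -/
lemma disjoint_interior_tri (hT : T ∈ triangles K) (hT' : T' ∈ triangles K) (h : T ≠ T') :
    Disjoint (interior (tri T)) (interior (tri T')) := by
  rw [Set.disjoint_left]
  intro x hx hx'
  obtain ⟨z, hz, hz'⟩ : ∃ z ∈ T, z ∉ T' := by
    by_contra! hsub
    exact h (Finset.eq_of_subset_of_card_le hsub (hT.2.trans hT'.2.symm).ge)
  have h0 : ∀ y ∈ interior (tri T) ∩ interior (tri T'), bary T z y = 0 := fun y hy =>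
    (bary_eq_of_mem hT hT' (interior_subset hy.1) (interior_subset hy.2) z).2 hz'
  have h1 : HasFDerivAt (fun _ : Plane => (0 : ℝ)) (dbary T z) x := by
    refine (hasFDerivAt_bary T z x).congr_of_eventuallyEq ?_
    filter_upwards [(isOpen_interior.inter isOpen_interior).mem_nhds ⟨hx, hx'⟩] with y hy
      using (h0 y hy).symm
  have h2 : dbary T z = 0 := h1.unique (hasFDerivAt_const _ _)
  have h3 : bary T z (x + (z - x)) = bary T z x + dbary T z (z - x) := bary_add T z x (z - x)
  have h4 : bary T z z = 1 := by
    classical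
    rw [(isTri_of_mem_triangles hT).bary_vertex hz hz, if_pos rfl]
  rw [add_sub_cancel, h2, h0 x ⟨hx, hx'⟩, h4] at h3
  simp at h3

/-- What the open triangles miss of ω lies on finitely many boundaries of convex sets, which are
null. -/
lemma ae_eq_biUnion_interior (hK : IsTriangulation ω K) :
    ω =ᵐ[volume] ⋃ T ∈ (finite_triangles hK).toFinset, interior (tri T) := by
  have hnull : volume (⋃ T ∈ (finite_triangles hK).toFinset, frontier (tri T)) = 0 :=
    (measure_biUnion_null_iff (Finset.countable_toSet _)).2
      fun T _ => (IsTri.convex_tri T).addHaar_frontier _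
  have hsub : ⋃ T ∈ (finite_triangles hK).toFinset, interior (tri T) ⊆ ω :=
    Set.iUnion₂_subset fun T hT => hK.interior_subset T (by simpa using hT)
  refine (ae_eq_set.2 ⟨measure_mono_null ?_ hnull, ?_⟩)
  · rintro x ⟨hx, hx'⟩
    obtain ⟨T, hT, hxT⟩ := (mem_closure_iff_exists hK).1 (subset_closure hx)
    have hT' : T ∈ (finite_triangles hK).toFinset := by simpa using hT
    exact Set.mem_biUnion (x := T) hT' ⟨subset_closure hxT, fun h => hx' (Set.mem_biUnion (x := T) hT' h)⟩
  · rw [Set.sdiff_eq_empty.2 hsub, measure_empty]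

/-- Only values in open triangles count, so a global gradient may be replaced by elementwise ones
that are continuous up to the edges. -/
lemma l2norm_sq_eq_sum_tri (hK : IsTriangulation ω K) {ι : Type} [Fintype ι]
    {f : Plane → ι → ℝ} {F : Finset Plane → Plane → ι → ℝ}
    (hf : ∀ T ∈ triangles K, Set.EqOn f (F T) (interior (tri T)))
    (hF : ∀ T ∈ triangles K, ∀ i, ContinuousOn (fun x => F T x i) (tri T)) :
    l2norm ω f ^ 2 = ∑ T ∈ (finite_triangles hK).toFinset, l2norm (tri T) (F T) ^ 2 := by
  have hmem : ∀ {T}, T ∈ (finite_triangles hK).toFinset → T ∈ triangles K := fun h => by simpa using h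
  have hcont : ∀ T ∈ triangles K, IntegrableOn (fun x => ∑ i, F T x i ^ 2) (tri T) := fun T hT =>
    (continuousOn_finsetSum _ fun i _ => (hF T hT i).pow 2).integrableOn_compact
      (IsTri.isCompact_tri T)
  have heq : ∀ T ∈ triangles K, Set.EqOn (fun x => ∑ i, f x i ^ 2) (fun x => ∑ i, F T x i ^ 2)
      (interior (tri T)) := fun T hT x hx => by simp only [hf T hT hx]
  rw [l2norm_sq, setIntegral_congr_set (ae_eq_biUnion_interior hK),
    integral_biUnion_finset _ (fun T _ => isOpen_interior.measurableSet)
      (fun T hT T' hT' hne => disjoint_interior_tri (hmem hT) (hmem hT') hne)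
      fun T hT => ((hcont T (hmem hT)).mono_set interior_subset).congr_fun (heq T (hmem hT)).symm
        isOpen_interior.measurableSet]
  refine Finset.sum_congr rfl fun T hT => ?_
  obtain ⟨c, r, hb⟩ := exists_isBody (hmem hT)
  rw [l2norm_sq, setIntegral_congr_fun isOpen_interior.measurableSet (heq T (hmem hT)),
    hb.restrict_interior]

lemma gradient_eq_gradT {w : Plane → ℝ} {x : Plane} (hx : x ∈ interior (tri T)) :
    gradient w x = gradT w T x := by
  rw [gradT, gradientWithin, gradient, fderivWithin_of_mem_nhds (mem_interior_iff_mem_nhds.1 hx)]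

/-- Equivalence of the `L²` norms of the gradient and of the discrete gradient. -/
lemma exists_l2norm_gradient_le (κ : ℝ) : ∃ C : ℝ, 0 < C ∧
    ∀ (ω : Set Plane) (K : SimplicialComplex ℝ Plane), IsTriangulation ω K → IsShapeRegular κ K →
    ∀ w θ, IsDKT ω K w → IsDiscreteGradient ω K w θ →
    l2norm ω (fun x i => gradient w x i) ≤ C * l2norm ω (fun x i => θ x i) ∧
    l2norm ω (fun x i => θ x i) ≤ C * l2norm ω (fun x i => gradient w x i) := by
  obtain ⟨C, hC, h⟩ := exists_l2norm_theta_le κ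
  refine ⟨C, hC, fun ω K hK hκ w θ hw hθ => ?_⟩
  have hcont : ∀ {f : Plane → ℝ} {S : Set Plane}, (∃ P, PolyFun 2 P ∧ Set.EqOn f P S) →
      ContinuousOn f S := fun ⟨P, hP, hPe⟩ => hP.continuous.continuousOn.congr hPe
  have e1 := l2norm_sq_eq_sum_tri hK (f := fun x i => gradient w x i)
    (F := fun T x i => gradT w T x i)
    (fun T _ x hx => by simp only [gradient_eq_gradT hx])
    fun T hT i => hcont (polyFun_gradT (isTri_of_mem_triangles hT) (hw.reducedCubic T hT) i)
  have e2 := l2norm_sq_eq_sum_tri hK (f := fun x i => θ x i) (F := fun _ x i => θ x i)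
    (fun _ _ _ _ => rfl) fun T hT i => hcont (polyFun_theta (hθ.eqOn_gradForm hw hT) i)
  have hloc : ∀ T ∈ (finite_triangles hK).toFinset,
      l2norm (tri T) (fun x i => θ x i) ≤ C * l2norm (tri T) (fun x i => gradT w T x i) ∧
      l2norm (tri T) (fun x i => gradT w T x i) ≤ C * l2norm (tri T) (fun x i => θ x i) := by
    intro T hT
    have hT' : T ∈ triangles K := by simpa using hT
    obtain ⟨c, ρ, hr⟩ := hκ.exists_isRegTri hT'
    exact h T c ρ hr w θ (hw.reducedCubic T hT') (hθ.eqOn_gradForm hw hT')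
  constructor
  · refine le_of_sq_le_sq ?_ (mul_nonneg hC.le (l2norm_nonneg _ _))
    rw [mul_pow, e1, e2, Finset.mul_sum]
    refine Finset.sum_le_sum fun T hT => ?_
    rw [← mul_pow]
    exact pow_le_pow_left₀ (l2norm_nonneg _ _) (hloc T hT).2 2
  · refine le_of_sq_le_sq ?_ (mul_nonneg hC.le (l2norm_nonneg _ _))
    rw [mul_pow, e1, e2, Finset.mul_sum]
    refine Finset.sum_le_sum fun T hT => ?_
    rw [← mul_pow]
    exact pow_le_pow_left₀ (l2norm_nonneg _ _) (hloc T hT).1 2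

end

end

/-! ### The full proposition, assembled from the local and global estimates. -/

theorem mainTheorem4 (κ : ℝ) :
    ∃ c₁ c₂ c₃ c₄ : ℝ, 0 < c₁ ∧ 0 < c₂ ∧ 0 < c₃ ∧ 0 < c₄ ∧
      ∀ (ω : Set Plane) (K : SimplicialComplex ℝ Plane),
        IsOpen ω → IsTriangulation ω K → IsShapeRegular κ K →
        -- the discrete gradient is well defined on the space of DKT functions
        (∀ w : Plane → ℝ, IsDKT ω K w →
          (∃ θ, IsDiscreteGradient ω K w θ) ∧
          ∀ θ θ', IsDiscreteGradient ω K w θ → IsDiscreteGradient ω K w θ' →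
            Set.EqOn θ θ' (closure ω)) ∧
        -- and on `H³(ω)`, if the boundary is Lipschitz
        (HasLipschitzBoundary ω → ∀ w G H D, IsSobolevH3 ω w G H D →
          (∃ θ, IsDiscreteGradientH3 ω K w θ) ∧
          ∀ θ θ', IsDiscreteGradientH3 ω K w θ → IsDiscreteGradientH3 ω K w θ' →
            Set.EqOn θ θ' (closure ω)) ∧
        -- (i)
        (∀ w θ, IsDKT ω K w → IsDiscreteGradient ω K w θ →
          c₁⁻¹ * l2norm ω (fun x i => gradient w x i) ≤ l2norm ω (fun x i => θ x i) ∧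
          l2norm ω (fun x i => θ x i) ≤ c₁ * l2norm ω (fun x i => gradient w x i)) ∧
        -- (ii)
        (∀ w θ, IsDKT ω K w → IsDiscreteGradient ω K w θ → ∀ T ∈ triangles K,
          c₂⁻¹ * l2norm (tri T) (hessT w T) ≤ l2norm (tri T) (jacT θ T) ∧
          l2norm (tri T) (jacT θ T) ≤ c₂ * l2norm (tri T) (hessT w T)) ∧
        -- (iii)
        (∀ w G H D θ, IsSobolevH3 ω w G H D → IsDiscreteGradientH3 ω K w θ →
          ∀ T ∈ triangles K,
          l2norm (tri T) (fun x i => G i x - θ x i) +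
              diamT T * l2norm (tri T) (fun x (p : Fin 2 × Fin 2) =>
                H p.1 p.2 x - jacT θ T x p) ≤
            c₃ * diamT T ^ 2 * l2norm (tri T) (fun x (p : Fin 2 × Fin 2 × Fin 2) =>
              D p.1 p.2.1 p.2.2 x)) ∧
        -- (iv)
        (∀ w θ, IsDKT ω K w → IsDiscreteGradient ω K w θ → ∀ T ∈ triangles K,
          l2norm (tri T) (fun x i => θ x i - gradT w T x i) ≤
            c₄ * diamT T * l2norm (tri T) (jacT θ T)) := by
  obtain ⟨c₁, hc₁, h₁⟩ := exists_l2norm_gradient_le κ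
  obtain ⟨c₂, hc₂, h₂⟩ := exists_l2norm_jacT_le κ
  obtain ⟨c₃, hc₃, h₃⟩ := exists_approx_le κ
  obtain ⟨c₄, hc₄, h₄⟩ := exists_l2norm_theta_sub_le κ
  refine ⟨c₁, c₂, c₃, c₄, hc₁, hc₂, hc₃, hc₄, fun ω K hω hK hκ => ⟨?_, ?_, ?_, ?_, ?_, ?_⟩⟩
  · exact fun w hw => ⟨exists_isDiscreteGradient hK hw, fun θ θ' hθ hθ' => hθ.eqOn hK hw hθ'⟩
  · exact fun hL w G H D hw => ⟨exists_isDiscreteGradientH3 hw hω hK hL,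
      fun θ θ' hθ hθ' => hθ.eqOn hw hω hK hθ'⟩
  · intro w θ hw hθ
    obtain ⟨h, h'⟩ := h₁ ω K hK hκ w θ hw hθ
    exact ⟨(inv_mul_le_iff₀ hc₁).2 h, h'⟩
  · intro w θ hw hθ T hT
    obtain ⟨c, ρ, hr⟩ := hκ.exists_isRegTri hT
    obtain ⟨h, h'⟩ := h₂ T c ρ hr w θ (hw.reducedCubic T hT) (hθ.eqOn_gradForm hw hT)
    exact ⟨(inv_mul_le_iff₀ hc₂).2 h', h⟩
  · intro w G H D θ hw hθ T hT
    obtain ⟨c, ρ, hr⟩ := hκ.exists_isRegTri hT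
    have hin := hK.interior_subset T hT
    obtain ⟨-, hG, hH⟩ := hw.isSobolev hω hr.isBody hin
    -- A representative on the single triangle suffices: it identifies `θ` there, and its gradient
    -- is almost everywhere the weak gradient.
    obtain ⟨W, g, hW, hg⟩ := hw.exists_isC1On hω hr.isBody hin
    exact h₃ T c ρ hr w W G H D g θ hG hH hW hg (hθ.eqOn_gradForm hK hT hW)
  · intro w θ hw hθ T hT
    obtain ⟨c, ρ, hr⟩ := hκ.exists_isRegTri hT
    exact h₄ T c ρ hr w θ (hw.reducedCubic T hT) (hθ.eqOn_gradForm hw hT)
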